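/- Let $\mathbb K$ be an algebraically closed field of characteristic $0$. Let $(G,X,\partial)$ be a finite crossed module: $G$ and $X$ are finite groups, $G$ acts on $X$ by automorphisms, written $(g,x)\mapsto {}^g x$, and $\partial:X\to G$ is a homomorphism with ${}^{\partial(x)}x'=xx'x^{-1}$ and $\partial({}^gx)=g\,\partial(x)\,g^{-1}$. Let $\xi=(\omega,\gamma,\mu,c)$ be a normalized quasi-abelian $3$-cocycle on it, that is, functions $\omega:X^3\to\mathbb K^\times$, $\gamma:G^2\times X\to\mathbb K^\times$, $(g,h,x)\mapsto\gamma_{g,h}(x)$, $\mu:G\times X^2\to\mathbb K^\times$, $(g,x,y)\mapsto \mu_g(x,y)$, and $c:X^2\to\mathbb K^\times$, each of which equals $1$ as soon as one of its arguments (or indices) is the identity, such that for all $g,h,k\in G$ and $s,x,y,z\in X$: - $\omega(x,y,z)\,\omega(s,xy,z)\,\omega(s,x,y)=\omega(s,x,yz)\,\omega(sx,y,z)$; - $\gamma_{h,k}(x)\,\gamma_{g,hk}(x)=\gamma_{gh,k}(x)\,\gamma_{g,h}({}^kx)$; - $\dfrac{\mu_g(y,z)\,\mu_g(x,yz)}{\mu_g(xy,z)\,\mu_g(x,y)}=\dfrac{\omega({}^gx,{}^gy,{}^gz)}{\omega(x,y,z)}$;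 - $\dfrac{\gamma_{g,h}(x)\,\gamma_{g,h}(y)}{\gamma_{g,h}(xy)}=\dfrac{\mu_g({}^hx,{}^hy)\,\mu_h(x,y)}{\mu_{gh}(x,y)}$; - $\dfrac{c({}^gx,{}^gy)}{c(x,y)}=\dfrac{\mu_g(xyx^{-1},x)}{\mu_g(x,y)}\cdot\dfrac{\gamma_{g\partial(x)g^{-1},g}(y)}{\gamma_{g,\partial(x)}(y)}$; - $c(xy,z)=\dfrac{\omega(x,y,z)\,\omega(xyz(xy)^{-1},x,y)}{\omega(x,yzy^{-1},y)\,\gamma_{\partial(x),\partial(y)}(z)}\;c(x,yzy^{-1})\,c(y,z)$; - $c(x,yz)=\dfrac{\omega(xyx^{-1},x,z)}{\omega(x,y,z)\,\omega(xyx^{-1},xzx^{-1},x)\,\mu_{\partial(x)}(y,z)}\;c(x,y)\,c(x,z)$. **The category $\mathcal C(\xi)^G$.** Let $\mathcal C(\xi)$ be the $\mathbb K$-linear monoidal category of finite-dimensional $X$-graded vector spaces and degree-preserving linear maps, with the usual graded tensor product and the associativity constraint $(u\otimes v)\otimes w\mapsto\omega(x,y,z)\,u\otimes(v\otimes w)$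 for $u,v,w$ homogeneous of degrees $x,y,z$. The group $G$ acts on it by the tensor autoequivalences $T_g$ that do not change the underlying vector space and replace the degree $x$ by ${}^gx$; the tensor structure of $T_g$ is multiplication by $\mu_g(x,y)$ in degrees $x,y$, and $T_{gh}\cong T_gT_h$ is multiplication by $\gamma_{g,h}(x)$ in degree $x$. The maps $V\otimes W\to T_{\partial(x)}(W)\otimes V$, $v\otimes w\mapsto c(x,y)\,w\otimes v$ ($V$ concentrated in degree $x$, $w$ of degree $y$) make $\mathcal C(\xi)$ a braided $G$-crossed category. Its equivariantization $\mathcal C(\xi)^G$ is the braided monoidal category of objects $V$ of $\mathcal C(\xi)$ with isomorphisms $u_g:T_g(V)\to V$, $g\in G$, such that $u_{gh}=u_g\circ T_g(u_h)\circ\gamma_{g,h}$. Thus an object is an $X$-graded space $V$ with bijective linear maps $g\,\triangleright:V_x\to V_{{}^gx}$ satisfying $$gh\triangleright v=\gamma_{g,h}(x)\,\bigl(g\triangleright(h\triangleright v)\bigr)\quad(v\in V_x),$$ morphisms are the degree-preserving linear maps that commute with all $g\,\triangleright$, the tensor product carries the action $g\triangleright(v\otimes w)=\mu_g(x,y)\,(g\triangleright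 v)\otimes(g\triangleright w)$ for $v$, $w$ of degrees $x,y$, the associativity constraint is that of $\mathcal C(\xi)$, and the braiding is $v\otimes w\mapsto c(x,y)\,(\partial(x)\triangleright w)\otimes v$. **The algebra $H(\xi)$.** Let $H(\xi)$ be the quasi-triangular quasi-Hopf algebra over $\mathbb K$ with basis $\{t_xg\}_{(x,g)\in X\times G}$ and $$(t_xg)(t_yh)=\delta_{x,{}^hy}\,\gamma_{g,h}(y)^{-1}\,t_y(gh),\qquad 1=\sum_{x}t_xe,$$ $$\Delta(t_xg)=\sum_{ab=x}\mu_g(a,b)\,t_ag\otimes t_bg,\qquad \varepsilon(t_xg)=\delta_{x,e},$$ $$\Phi=\sum_{x,y,z}\omega(x,y,z)\,t_xe\otimes t_ye\otimes t_ze,\qquad R=\sum_{x,y}c(x,y)\,t_xe\otimes t_y\partial(x),$$ $$\alpha=1,\qquad \beta=\sum_x\omega(x^{-1},x,x^{-1})\,t_xe,\qquad S(t_xg)=\frac{\gamma_{g^{-1},g}(x^{-1})}{\mu_g(x,x^{-1})}\;t_{{}^g(x^{-1})}\,g^{-1},$$ and let $H(\xi)$-$\mathrm{Mod}$ be the braided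 monoidal category of finite-dimensional left $H(\xi)$-modules, in which $H(\xi)$ acts on $V\otimes W$ through $\Delta$ and on the unit object $\mathbb K$ through $\varepsilon$, the associativity constraint $(U\otimes V)\otimes W\to U\otimes(V\otimes W)$ is the action of $\Phi$, and the braiding is the action of $R$ on $V\otimes W$ followed by the flip. **Proposition.** $\mathcal C(\xi)^G$ and $H(\xi)$-$\mathrm{Mod}$ are equivalent as braided fusion categories. More precisely, both are fusion categories over $\mathbb K$, and there is a $\mathbb K$-linear braided tensor equivalence $H(\xi)$-$\mathrm{Mod}\to\mathcal C(\xi)^G$ that is the identity on underlying vector spaces, on morphisms and on tensor products; it endows a module $V$ with the grading $V=\bigoplus_{x\in X}V_x$, $V_x=(t_xe)V$, and with the twisted action $g\triangleright v=(t_xg)v$ for $v\in V_x$. On both sides the associativity constraint is $$(u\otimes v)\otimes w\mapsto\omega(x,y,z)\,u\otimes(v\otimes w)$$ and the braiding is $$v\otimes w\mapsto c(x,y)\,(\partial(x)\triangleright w)\otimes v,$$ for $u,v,w$ homogeneous of degrees $x,y,z$ in the first formula, and $v,w$ homogeneous of degrees $x,y$ in the second. -/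

import Mathlib

open CategoryTheory MonoidalCategory
open scoped TensorProduct

universe u v w

set_option linter.unusedSectionVars false

/-! ### Crossed modules and quasi-abelian 3-cocycles -/

/-- A crossed module `(G, X, ∂)`: the group `G` acts on the group `X` by automorphisms
(written `g • x`), and `∂ : X → G` is a homomorphism satisfying the two usual axioms. -/
structure CrossedModule (X : Type v) (G : Type w) [Group X] [Group G]
    [MulDistribMulAction G X] where
  bd : X →* G
  bd_smul : ∀ x x' : X, bd x • x' = x * x' * x⁻¹
  smul_bd : ∀ (g : G) (x : X), bd (g • x) = g * bd x * g⁻¹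

/-- A quasi-abelian 3-cocycle `(ω, γ, μ, c)` on a crossed module with values in `Kˣ`. -/
structure QuasiAbelianCocycle (K : Type u) [Field K] {X : Type v} {G : Type w} [Group X]
    [Group G] [MulDistribMulAction G X] (M : CrossedModule X G) where
  ω : X → X → X → Kˣ
  γ : G → G → X → Kˣ
  μ : G → X → X → Kˣ
  c : X → X → Kˣ
  /-- `ω` is a 3-cocycle on `X`. -/
  ω_cocycle : ∀ s x y z : X,
    ω x y z * ω s (x * y) z * ω s x y = ω s x (y * z) * ω (s * x) y z
  /-- `γ` is a 2-cocycle on `G` with values in the right `G`-module of functions `X → Kˣ`. -/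
  γ_cocycle : ∀ (g h k : G) (x : X),
    γ h k x * γ g (h * k) x = γ (g * h) k x * γ g h (k • x)
  /-- `d (μ_g) = ω^g / ω`. -/
  μ_ω : ∀ (g : G) (x y z : X),
    μ g y z * μ g x (y * z) / (μ g (x * y) z * μ g x y) =
      ω (g • x) (g • y) (g • z) / ω x y z
  /-- `d (γ_{g,h}) = (d μ)_{g,h}`. -/
  γ_μ : ∀ (g h : G) (x y : X),
    γ g h x * γ g h y / γ g h (x * y) =
      μ g (h • x) (h • y) * μ h x y / μ (g * h) x y
  /-- invariance of `c` up to `μ` and `γ`. -/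
  c_inv : ∀ (g : G) (x y : X),
    c (g • x) (g • y) / c x y =
      μ g (x * y * x⁻¹) x / μ g x y * (γ (g * M.bd x * g⁻¹) g y / γ g (M.bd x) y)
  c_mul_left : ∀ x y z : X,
    c (x * y) z =
      ω x y z * ω ((x * y) * z * (x * y)⁻¹) x y /
          (ω x (y * z * y⁻¹) y * γ (M.bd x) (M.bd y) z) *
        (c x (y * z * y⁻¹) * c y z)
  c_mul_right : ∀ x y z : X,
    c x (y * z) =
      ω (x * y * x⁻¹) x z /
          (ω x y z * ω (x * y * x⁻¹) (x * z * x⁻¹) x * μ (M.bd x) y z) *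
        (c x y * c x z)

/-- A normalized quasi-abelian 3-cocycle: every component takes the value `1` as soon as one of
its arguments (including the group elements in the index) is the identity. -/
structure NormalizedCocycle (K : Type u) [Field K] {X : Type v} {G : Type w} [Group X]
    [Group G] [MulDistribMulAction G X] (M : CrossedModule X G)
    extends QuasiAbelianCocycle K M where
  ω_one₁ : ∀ y z, ω 1 y z = 1
  ω_one₂ : ∀ x z, ω x 1 z = 1
  ω_one₃ : ∀ x y, ω x y 1 = 1
  γ_one₁ : ∀ h x, γ 1 h x = 1
  γ_one₂ : ∀ g x, γ g 1 x = 1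
  γ_one₃ : ∀ g h, γ g h 1 = 1
  μ_one₁ : ∀ x y, μ 1 x y = 1
  μ_one₂ : ∀ g y, μ g 1 y = 1
  μ_one₃ : ∀ g x, μ g x 1 = 1
  c_one₁ : ∀ y, c 1 y = 1
  c_one₂ : ∀ x, c x 1 = 1

/-! ### Gradings by a finite group -/

namespace Grading

variable {K : Type*} [Field K] {X : Type*} [Fintype X]
  {V W Z V' W' : Type*} [AddCommGroup V] [Module K V] [AddCommGroup W] [Module K W]
  [AddCommGroup Z] [Module K Z] [AddCommGroup V'] [Module K V'] [AddCommGroup W'] [Module K W']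
  {p : X → Module.End K V} {q : X → Module.End K W} {r : X → Module.End K Z}

theorem ext₁ (hp : CompleteOrthogonalIdempotents p) {f g : V →ₗ[K] Z}
    (h : ∀ x v, p x v = v → f v = g v) : f = g := by
  ext v
  have hv : v = ∑ x, p x v := by
    rw [← LinearMap.sum_apply, hp.complete]; rfl
  rw [hv, map_sum, map_sum]
  refine Finset.sum_congr rfl fun x _ => h x _ ?_
  rw [← Module.End.mul_apply, (hp.idem x).eq]

/-- A complete family of orthogonal idempotents `p x` of `End V` is the family of projections of
the direct sum decomposition `V = ⨁ V_x` into the ranges `V_x` of `p x`. -/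
theorem isInternal [DecidableEq X] (hp : CompleteOrthogonalIdempotents p) :
    DirectSum.IsInternal fun x => LinearMap.range (p x) := by
  have key : ∀ (x y : X) (v : V), p x (p y v) = if x = y then p x v else 0 := fun x y v => by
    rw [← Module.End.mul_apply, hp.mul_eq]; split_ifs <;> rfl
  rw [DirectSum.isInternal_submodule_iff_iSupIndep_and_iSup_eq_top]
  constructor
  · rw [iSupIndep_def]
    refine fun x => Submodule.disjoint_def.2 ?_
    rintro _ ⟨v, rfl⟩ hv
    have h0 : (⨆ j, ⨆ (_ : j ≠ x), LinearMap.range (p j)) ≤ LinearMap.ker (p x) := by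
      refine iSup₂_le fun j hj => ?_
      rintro _ ⟨w, rfl⟩
      rw [LinearMap.mem_ker, key, if_neg (Ne.symm hj)]
    have := h0 hv
    rwa [LinearMap.mem_ker, key, if_pos rfl] at this
  · rw [eq_top_iff]
    intro v _
    have hv : v = ∑ x, p x v := by
      rw [← LinearMap.sum_apply, hp.complete]; rfl
    rw [hv]
    exact Submodule.sum_mem _ fun x _ => Submodule.mem_iSup_of_mem x ⟨v, rfl⟩

theorem apply_hom [DecidableEq X] (hp : CompleteOrthogonalIdempotents p) {x : X} {v : V}
    (h : p x v = v) (y : X) : p y v = if x = y then v else 0 := by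
  conv_lhs => rw [← h]
  rw [← Module.End.mul_apply, hp.mul_eq]
  split_ifs with h1 h2 h2
  · subst h1; exact h
  · exact absurd h1.symm h2
  · exact absurd h2.symm h1
  · rfl

theorem ext₂ (hp : CompleteOrthogonalIdempotents p) (hq : CompleteOrthogonalIdempotents q)
    {f g : V ⊗[K] W →ₗ[K] Z}
    (h : ∀ x y v w, p x v = v → q y w = w → f (v ⊗ₜ w) = g (v ⊗ₜ w)) : f = g := by
  refine TensorProduct.ext (ext₁ hp fun x v hv => ext₁ hq fun y w hw => ?_)
  exact h x y v w hv hw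

theorem ext₃ (hp : CompleteOrthogonalIdempotents p) (hq : CompleteOrthogonalIdempotents q)
    (hr : CompleteOrthogonalIdempotents r) {f g : (V ⊗[K] W) ⊗[K] Z →ₗ[K] V'}
    (h : ∀ x y z v w t, p x v = v → q y w = w → r z t = t →
      f ((v ⊗ₜ w) ⊗ₜ t) = g ((v ⊗ₜ w) ⊗ₜ t)) : f = g := by
  refine TensorProduct.ext (ext₂ hp hq fun x y v w hv hw => ext₁ hr fun z t ht => ?_)
  exact h x y z v w t hv hw ht

theorem ext₃' (hp : CompleteOrthogonalIdempotents p) (hq : CompleteOrthogonalIdempotents q)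
    (hr : CompleteOrthogonalIdempotents r) {f g : V ⊗[K] (W ⊗[K] Z) →ₗ[K] V'}
    (h : ∀ x y z v w t, p x v = v → q y w = w → r z t = t →
      f (v ⊗ₜ (w ⊗ₜ t)) = g (v ⊗ₜ (w ⊗ₜ t))) : f = g := by
  refine TensorProduct.ext (ext₁ hp fun x v hv => ext₂ hq hr fun y z w t hw ht => ?_)
  exact h x y z v w t hv hw ht

/-- The operator acting on vectors of degree `x` as the scalar `s x`. -/
noncomputable def diag₁ (p : X → Module.End K V) (s : X → K) : V →ₗ[K] V :=
  ∑ x, s x • p x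

/-- The operator acting on `v ⊗ w`, with `v`, `w` of degrees `x`, `y`, as the scalar `s x y`. -/
noncomputable def diag₂ (p : X → Module.End K V) (q : X → Module.End K W) (s : X → X → K) :
    V ⊗[K] W →ₗ[K] V ⊗[K] W :=
  ∑ x, ∑ y, s x y • TensorProduct.map (p x) (q y)

/-- The operator acting on `u ⊗ (v ⊗ w)`, with `u`, `v`, `w` of degrees `x`, `y`, `z`, as the
scalar `s x y z`. -/
noncomputable def diag₃ (p : X → Module.End K V) (q : X → Module.End K W)
    (r : X → Module.End K Z) (s : X → X → X → K) :
    V ⊗[K] (W ⊗[K] Z) →ₗ[K] V ⊗[K] (W ⊗[K] Z) :=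
  ∑ x, ∑ y, ∑ z, s x y z • TensorProduct.map (p x) (TensorProduct.map (q y) (r z))

theorem diag₁_apply (hp : CompleteOrthogonalIdempotents p) (s : X → K) {x : X} {v : V}
    (hv : p x v = v) : diag₁ p s v = s x • v := by
  classical
  simp [diag₁, apply_hom hp hv]

theorem diag₂_apply (hp : CompleteOrthogonalIdempotents p) (hq : CompleteOrthogonalIdempotents q)
    (s : X → X → K) {x y : X} {v : V} {w : W} (hv : p x v = v) (hw : q y w = w) :
    diag₂ p q s (v ⊗ₜ w) = s x y • v ⊗ₜ w := by
  classical
  simp [diag₂, apply_hom hp hv, apply_hom hq hw, TensorProduct.ite_tmul, TensorProduct.tmul_ite]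

theorem diag₃_apply (hp : CompleteOrthogonalIdempotents p) (hq : CompleteOrthogonalIdempotents q)
    (hr : CompleteOrthogonalIdempotents r)
    (s : X → X → X → K) {x y z : X} {v : V} {w : W} {t : Z} (hv : p x v = v) (hw : q y w = w)
    (ht : r z t = t) :
    diag₃ p q r s (v ⊗ₜ (w ⊗ₜ t)) = s x y z • v ⊗ₜ (w ⊗ₜ t) := by
  classical
  simp [diag₃, apply_hom hp hv, apply_hom hq hw, apply_hom hr ht, TensorProduct.ite_tmul,
    TensorProduct.tmul_ite]

variable [Group X] [DecidableEq X]

/-- The grading of a tensor product: the product of vectors of degrees `x`, `y` has degree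
`x * y`. -/
noncomputable def tensor (p : X → Module.End K V) (q : X → Module.End K W) (z : X) :
    Module.End K (V ⊗[K] W) :=
  diag₂ p q fun x y => if x * y = z then 1 else 0

theorem tensor_apply (hp : CompleteOrthogonalIdempotents p)
    (hq : CompleteOrthogonalIdempotents q) {x y : X} {v : V} {w : W} (hv : p x v = v)
    (hw : q y w = w) (z : X) :
    tensor p q z (v ⊗ₜ w) = if x * y = z then v ⊗ₜ w else 0 := by
  rw [tensor, diag₂_apply hp hq _ hv hw]; split_ifs <;> simp

theorem tensor_hom (hp : CompleteOrthogonalIdempotents p)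
    (hq : CompleteOrthogonalIdempotents q) {x y : X} {v : V} {w : W} (hv : p x v = v)
    (hw : q y w = w) : tensor p q (x * y) (v ⊗ₜ w) = v ⊗ₜ w := by
  rw [tensor_apply hp hq hv hw, if_pos rfl]

theorem isGrading_tensor (hp : CompleteOrthogonalIdempotents p)
    (hq : CompleteOrthogonalIdempotents q) : CompleteOrthogonalIdempotents (tensor p q) where
  idem z := ext₂ hp hq fun x y v w hv hw => by
    rw [Module.End.mul_apply, tensor_apply hp hq hv hw]
    split_ifs with h
    · rw [tensor_apply hp hq hv hw, if_pos h]
    · simp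
  ortho z z' hz := ext₂ hp hq fun x y v w hv hw => by
    rw [Module.End.mul_apply, tensor_apply hp hq hv hw]
    split_ifs with h
    · rw [tensor_apply hp hq hv hw, if_neg (by rw [h]; exact hz.symm)]; rfl
    · simp
  complete := ext₂ hp hq fun x y v w hv hw => by
    rw [LinearMap.sum_apply]
    simp [tensor_apply hp hq hv hw]


theorem graded₁ (hp : CompleteOrthogonalIdempotents p) (hq : CompleteOrthogonalIdempotents q)
    {f : V →ₗ[K] W} (hf : ∀ x v, p x v = v → q x (f v) = f v) (x : X) (v : V) :
    f (p x v) = q x (f v) := by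
  refine LinearMap.congr_fun (ext₁ (f := f ∘ₗ p x) (g := q x ∘ₗ f) hp fun y v hv => ?_) v
  rw [LinearMap.comp_apply, LinearMap.comp_apply, apply_hom hp hv, apply_hom hq (hf y v hv)]
  split_ifs <;> simp

theorem graded₂ (hp : CompleteOrthogonalIdempotents p) (hq : CompleteOrthogonalIdempotents q)
    (hr : CompleteOrthogonalIdempotents r) {f : V ⊗[K] W →ₗ[K] Z}
    (hf : ∀ x y v w, p x v = v → q y w = w → r (x * y) (f (v ⊗ₜ w)) = f (v ⊗ₜ w))
    (d : X) (t : V ⊗[K] W) : f (tensor p q d t) = r d (f t) := by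
  refine LinearMap.congr_fun (ext₂ (f := f ∘ₗ tensor p q d) (g := r d ∘ₗ f) hp hq
    fun x y v w hv hw => ?_) t
  rw [LinearMap.comp_apply, LinearMap.comp_apply, tensor_apply hp hq hv hw,
    apply_hom hr (hf x y v w hv hw)]
  split_ifs <;> simp

/-- The map `(u ⊗ v) ⊗ w ↦ s(x,y,z) u ⊗ (v ⊗ w)`, for `u`, `v`, `w` of degrees `x`, `y`, `z`. -/
noncomputable def assocHom (p : X → Module.End K V) (q : X → Module.End K W)
    (r : X → Module.End K Z) (s : X → X → X → Kˣ) : (V ⊗[K] W) ⊗[K] Z →ₗ[K] V ⊗[K] (W ⊗[K] Z) :=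
  diag₃ p q r (fun x y z => (s x y z : K)) ∘ₗ (TensorProduct.assoc K V W Z).toLinearMap

/-- The inverse of `assocHom`. -/
noncomputable def assocInv (p : X → Module.End K V) (q : X → Module.End K W)
    (r : X → Module.End K Z) (s : X → X → X → Kˣ) : V ⊗[K] (W ⊗[K] Z) →ₗ[K] (V ⊗[K] W) ⊗[K] Z :=
  (TensorProduct.assoc K V W Z).symm.toLinearMap ∘ₗ
    diag₃ p q r (fun x y z => ((s x y z)⁻¹ : Kˣ))

theorem assocHom_apply (hp : CompleteOrthogonalIdempotents p)
    (hq : CompleteOrthogonalIdempotents q) (hr : CompleteOrthogonalIdempotents r)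
    (s : X → X → X → Kˣ) {x y z : X} {v : V} {w : W} {t : Z} (hv : p x v = v) (hw : q y w = w)
    (ht : r z t = t) :
    assocHom p q r s ((v ⊗ₜ w) ⊗ₜ t) = (s x y z : K) • v ⊗ₜ (w ⊗ₜ t) :=
  diag₃_apply hp hq hr _ hv hw ht

theorem assocInv_apply (hp : CompleteOrthogonalIdempotents p)
    (hq : CompleteOrthogonalIdempotents q) (hr : CompleteOrthogonalIdempotents r)
    (s : X → X → X → Kˣ) {x y z : X} {v : V} {w : W} {t : Z} (hv : p x v = v) (hw : q y w = w)
    (ht : r z t = t) :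
    assocInv p q r s (v ⊗ₜ (w ⊗ₜ t)) = (((s x y z)⁻¹ : Kˣ) : K) • (v ⊗ₜ w) ⊗ₜ t := by
  rw [assocInv, LinearMap.comp_apply, diag₃_apply hp hq hr _ hv hw ht, map_smul]
  rfl

theorem assocHom_graded (hp : CompleteOrthogonalIdempotents p)
    (hq : CompleteOrthogonalIdempotents q) (hr : CompleteOrthogonalIdempotents r)
    (s : X → X → X → Kˣ) (d : X) (t : (V ⊗[K] W) ⊗[K] Z) :
    assocHom p q r s (tensor (tensor p q) r d t) =
      tensor p (tensor q r) d (assocHom p q r s t) := by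
  refine LinearMap.congr_fun (ext₃ (f := assocHom p q r s ∘ₗ tensor (tensor p q) r d)
    (g := tensor p (tensor q r) d ∘ₗ assocHom p q r s) hp hq hr
    fun x y z v w t hv hw ht => ?_) t
  rw [LinearMap.comp_apply, LinearMap.comp_apply,
    tensor_apply (isGrading_tensor hp hq) hr (tensor_hom hp hq hv hw) ht,
    assocHom_apply hp hq hr s hv hw ht, map_smul,
    tensor_apply hp (isGrading_tensor hq hr) hv (tensor_hom hq hr hw ht), mul_assoc]
  split_ifs
  · exact assocHom_apply hp hq hr s hv hw ht
  · simp

theorem assocInv_comp (hp : CompleteOrthogonalIdempotents p)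
    (hq : CompleteOrthogonalIdempotents q) (hr : CompleteOrthogonalIdempotents r)
    (s : X → X → X → Kˣ) : assocInv p q r s ∘ₗ assocHom p q r s = LinearMap.id :=
  ext₃ hp hq hr fun x y z v w t hv hw ht => by
    rw [LinearMap.comp_apply, assocHom_apply hp hq hr s hv hw ht, map_smul,
      assocInv_apply hp hq hr s hv hw ht, smul_smul]
    simp

theorem assocHom_comp (hp : CompleteOrthogonalIdempotents p)
    (hq : CompleteOrthogonalIdempotents q) (hr : CompleteOrthogonalIdempotents r)
    (s : X → X → X → Kˣ) : assocHom p q r s ∘ₗ assocInv p q r s = LinearMap.id :=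
  ext₃' hp hq hr fun x y z v w t hv hw ht => by
    rw [LinearMap.comp_apply, assocInv_apply hp hq hr s hv hw ht, map_smul,
      assocHom_apply hp hq hr s hv hw ht, smul_smul]
    simp

theorem pentagon (hp : CompleteOrthogonalIdempotents p) (hq : CompleteOrthogonalIdempotents q)
    (hr : CompleteOrthogonalIdempotents r) {p' : X → Module.End K V'}
    (hp' : CompleteOrthogonalIdempotents p') {s : X → X → X → Kˣ}
    (hs : ∀ a x y z, s x y z * s a (x * y) z * s a x y = s a x (y * z) * s (a * x) y z) :
    TensorProduct.map LinearMap.id (assocHom q r p' s) ∘ₗ assocHom p (tensor q r) p' s ∘ₗ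
        TensorProduct.map (assocHom p q r s) LinearMap.id =
      assocHom p q (tensor r p') s ∘ₗ assocHom (tensor p q) r p' s :=
  TensorProduct.ext <| ext₃ hp hq hr fun a x y v w t hv hw ht => ext₁ hp' fun z v' hv' => by
    change TensorProduct.map LinearMap.id (assocHom q r p' s) (assocHom p (tensor q r) p' s
      (assocHom p q r s ((v ⊗ₜ w) ⊗ₜ t) ⊗ₜ v')) =
      assocHom p q (tensor r p') s (assocHom (tensor p q) r p' s (((v ⊗ₜ w) ⊗ₜ t) ⊗ₜ v'))
    rw [assocHom_apply hp hq hr s hv hw ht, ← TensorProduct.smul_tmul', map_smul,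
      assocHom_apply hp (isGrading_tensor hq hr) hp' s hv (tensor_hom hq hr hw ht) hv',
      assocHom_apply (isGrading_tensor hp hq) hr hp' s (tensor_hom hp hq hv hw) ht hv',
      map_smul (assocHom p q (tensor r p') s),
      assocHom_apply hp hq (isGrading_tensor hr hp') s hv hw (tensor_hom hr hp' ht hv'),
      map_smul, map_smul, TensorProduct.map_tmul, assocHom_apply hq hr hp' s hw ht hv',
      TensorProduct.tmul_smul, smul_smul, smul_smul, smul_smul]
    congr 1
    have := congrArg Units.val (hs a x y z)
    simp only [Units.val_mul] at this
    linear_combination this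

theorem assocHom_natural {p' : X → Module.End K V'} {q' : X → Module.End K W'}
    {Z' : Type*} [AddCommGroup Z'] [Module K Z'] {r' : X → Module.End K Z'}
    (hp : CompleteOrthogonalIdempotents p) (hq : CompleteOrthogonalIdempotents q)
    (hr : CompleteOrthogonalIdempotents r) (hp' : CompleteOrthogonalIdempotents p')
    (hq' : CompleteOrthogonalIdempotents q') (hr' : CompleteOrthogonalIdempotents r')
    (s : X → X → X → Kˣ) {f : V →ₗ[K] V'} {g : W →ₗ[K] W'} {h : Z →ₗ[K] Z'}
    (hf : ∀ x v, f (p x v) = p' x (f v)) (hg : ∀ x v, g (q x v) = q' x (g v))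
    (hh : ∀ x v, h (r x v) = r' x (h v)) :
    assocHom p' q' r' s ∘ₗ TensorProduct.map (TensorProduct.map f g) h =
      TensorProduct.map f (TensorProduct.map g h) ∘ₗ assocHom p q r s :=
  ext₃ hp hq hr fun x y z v w t hv hw ht => by
    simp only [LinearMap.comp_apply, TensorProduct.map_tmul]
    rw [assocHom_apply hp hq hr s hv hw ht,
      assocHom_apply hp' hq' hr' s (x := x) (y := y) (z := z) (by rw [← hf, hv])
        (by rw [← hg, hw]) (by rw [← hh, ht]), map_smul]
    rfl

theorem tensor_natural {p' : X → Module.End K V'} {q' : X → Module.End K W'}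
    (hp : CompleteOrthogonalIdempotents p) (hq : CompleteOrthogonalIdempotents q)
    (hp' : CompleteOrthogonalIdempotents p')
    (hq' : CompleteOrthogonalIdempotents q') {f : V →ₗ[K] V'} {g : W →ₗ[K] W'}
    (hf : ∀ x v, f (p x v) = p' x (f v)) (hg : ∀ x v, g (q x v) = q' x (g v)) (d : X)
    (t : V ⊗[K] W) :
    TensorProduct.map f g (tensor p q d t) = tensor p' q' d (TensorProduct.map f g t) :=
  graded₂ hp hq (isGrading_tensor hp' hq') (fun x y v w hv hw => by
    rw [TensorProduct.map_tmul]
    exact tensor_hom hp' hq' (by rw [← hf, hv]) (by rw [← hg, hw])) d t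

variable (K X) in
/-- The ground field, concentrated in degree `1`. -/
def unit (x : X) : Module.End K K := if x = 1 then 1 else 0

theorem unit_hom (a : K) : unit K X 1 a = a := by
  rw [unit, if_pos rfl]; rfl

variable (K X) in
theorem isGrading_unit : CompleteOrthogonalIdempotents (unit K X) where
  idem x := by
    change _ * _ = _
    unfold unit
    split_ifs <;> simp
  ortho x y h := by
    change unit K X x * unit K X y = 0
    unfold unit
    split_ifs with h1 h2
    · exact absurd (h1.trans h2.symm) h
    all_goals simp
  complete := by simp [unit]

theorem ext_unit {f g : K →ₗ[K] Z} (h : f 1 = g 1) : f = g := LinearMap.ext_ring h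

theorem lid_graded (hp : CompleteOrthogonalIdempotents p) (d : X) (t : K ⊗[K] V) :
    TensorProduct.lid K V (tensor (unit K X) p d t) = p d (TensorProduct.lid K V t) := by
  refine LinearMap.congr_fun (TensorProduct.ext (ext_unit (ext₁ hp fun x v hv => ?_)) :
    (TensorProduct.lid K V).toLinearMap ∘ₗ tensor (unit K X) p d =
      p d ∘ₗ (TensorProduct.lid K V).toLinearMap) t
  simp only [LinearMap.compr₂ₛₗ_apply, TensorProduct.mk_apply, LinearMap.comp_apply,
    LinearEquiv.coe_coe, TensorProduct.lid_tmul, one_smul]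
  rw [tensor_apply (isGrading_unit K X) hp (unit_hom 1) hv, one_mul, apply_hom hp hv]
  split_ifs <;> simp

theorem rid_graded (hp : CompleteOrthogonalIdempotents p) (d : X) (t : V ⊗[K] K) :
    TensorProduct.rid K V (tensor p (unit K X) d t) = p d (TensorProduct.rid K V t) := by
  refine LinearMap.congr_fun (TensorProduct.ext (ext₁ hp fun x v hv => ext_unit ?_) :
    (TensorProduct.rid K V).toLinearMap ∘ₗ tensor p (unit K X) d =
      p d ∘ₗ (TensorProduct.rid K V).toLinearMap) t
  simp only [LinearMap.compr₂ₛₗ_apply, TensorProduct.mk_apply, LinearMap.comp_apply,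
    LinearEquiv.coe_coe, TensorProduct.rid_tmul, one_smul]
  rw [tensor_apply hp (isGrading_unit K X) hv (unit_hom 1), mul_one, apply_hom hp hv]
  split_ifs <;> simp

theorem triangle (hp : CompleteOrthogonalIdempotents p) (hq : CompleteOrthogonalIdempotents q)
    {s : X → X → X → Kˣ} (hs : ∀ x z, s x 1 z = 1) :
    TensorProduct.map LinearMap.id (TensorProduct.lid K W).toLinearMap ∘ₗ
        assocHom p (unit K X) q s =
      TensorProduct.map (TensorProduct.rid K V).toLinearMap LinearMap.id :=
  ext₃ hp (isGrading_unit K X) hq fun x _ y v a w hv _ hw => by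
    rw [LinearMap.comp_apply, assocHom_apply hp (isGrading_unit K X) hq s hv (unit_hom a) hw, hs]
    simp [TensorProduct.smul_tmul]

end Grading

/-! ### The pointed category `Vec_X^ω` -/

section CrossedPointed

variable {K : Type u} [Field K] {X : Type v} {G : Type w} [Group X] [Group G]
  [MulDistribMulAction G X] [Fintype X] {M : CrossedModule X G}

/-- Objects of the crossed pointed category `C(ξ)`, i.e. of `Vec_X^ω`: finite dimensional
`X`-graded vector spaces `V = ⨁ V_x`. The grading is recorded by the projections
`proj x : V → V_x ⊆ V`; a vector `v` has degree `x` iff `proj x v = v`.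
The cocycle `ξ` only matters for the further structure of the category. -/
structure CrossedPointed (ξ : NormalizedCocycle K M) where
  carrier : Type u
  [addCommGroup : AddCommGroup carrier]
  [module : Module K carrier]
  [finite : FiniteDimensional K carrier]
  proj : X → Module.End K carrier
  isGrading : CompleteOrthogonalIdempotents proj

namespace CrossedPointed

variable {ξ : NormalizedCocycle K M}

attribute [instance] addCommGroup module finite

/-- Degree preserving linear maps. -/
def homs (V W : CrossedPointed ξ) : Submodule K (V.carrier →ₗ[K] W.carrier) where
  carrier := {f | ∀ x v, f (V.proj x v) = W.proj x (f v)}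
  add_mem' hf hg x v := by
    simp only [Set.mem_ofPred_eq] at hf hg
    simp [hf x v, hg x v]
  zero_mem' x v := by simp
  smul_mem' a f hf x v := by
    simp only [Set.mem_ofPred_eq] at hf
    simp [hf x v]

instance : Category (CrossedPointed ξ) where
  Hom V W := homs V W
  id V := ⟨LinearMap.id, fun _ _ => rfl⟩
  comp f g := ⟨g.1 ∘ₗ f.1, fun x v => by
    rw [LinearMap.comp_apply, f.2, g.2]; rfl⟩

/-- The linear map underlying a morphism. -/
def lin {V W : CrossedPointed ξ} (f : V ⟶ W) : V.carrier →ₗ[K] W.carrier := Subtype.val f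

theorem hom_ext {V W : CrossedPointed ξ} {f g : V ⟶ W} (h : lin f = lin g) : f = g :=
  Subtype.ext h

theorem lin_proj {V W : CrossedPointed ξ} (f : V ⟶ W) (x : X) (v : V.carrier) :
    lin f (V.proj x v) = W.proj x (lin f v) := f.2 x v

theorem lin_hom {V W : CrossedPointed ξ} (f : V ⟶ W) {x : X} {v : V.carrier}
    (hv : V.proj x v = v) : W.proj x (lin f v) = lin f v := by
  rw [← lin_proj, hv]

@[simp] theorem lin_id (V : CrossedPointed ξ) : lin (𝟙 V) = LinearMap.id := rfl

@[simp] theorem lin_comp {U V W : CrossedPointed ξ} (f : U ⟶ V) (g : V ⟶ W) :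
    lin (f ≫ g) = lin g ∘ₗ lin f := rfl

instance : Preadditive (CrossedPointed ξ) where
  homGroup V W := inferInstanceAs (AddCommGroup (homs V W))
  add_comp _ _ _ f f' g := hom_ext (LinearMap.comp_add (lin f) (lin f') (lin g))
  comp_add _ _ _ f g g' := hom_ext (LinearMap.add_comp (lin f) (lin g') (lin g))

instance : Linear K (CrossedPointed ξ) where
  homModule V W := inferInstanceAs (Module K (homs V W))
  smul_comp _ _ _ a f g := hom_ext (LinearMap.comp_smul (lin g) a (lin f))
  comp_smul _ _ _ f a g := hom_ext (LinearMap.smul_comp a (lin g) (lin f))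

@[simp] theorem lin_add {V W : CrossedPointed ξ} (f g : V ⟶ W) :
    lin (f + g) = lin f + lin g := rfl

@[simp] theorem lin_zero {V W : CrossedPointed ξ} : lin (0 : V ⟶ W) = 0 := rfl

@[simp] theorem lin_smul {V W : CrossedPointed ξ} (a : K) (f : V ⟶ W) :
    lin (a • f) = a • lin f := rfl

theorem lin_sum {ι : Type*} {V W : CrossedPointed ξ} (s : Finset ι) (f : ι → (V ⟶ W)) :
    lin (∑ i ∈ s, f i) = ∑ i ∈ s, lin (f i) :=
  map_sum (homs V W).subtype f s

/-- Mutually inverse degree preserving linear maps as an isomorphism. -/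
def mkIso {V W : CrossedPointed ξ} (f : V ⟶ W) (g : W.carrier →ₗ[K] V.carrier)
    (h₁ : g ∘ₗ lin f = LinearMap.id) (h₂ : lin f ∘ₗ g = LinearMap.id) : V ≅ W where
  hom := f
  inv := ⟨g, fun x w => by
    have h1 : ∀ v, g (lin f v) = v := LinearMap.congr_fun h₁
    have h2 : ∀ w, lin f (g w) = w := LinearMap.congr_fun h₂
    rw [← h1 (V.proj x (g w)), lin_proj, h2]⟩
  hom_inv_id := hom_ext h₁
  inv_hom_id := hom_ext h₂

@[simp] theorem mkIso_hom {V W : CrossedPointed ξ} (f : V ⟶ W) (g : W.carrier →ₗ[K] V.carrier)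
    (h₁ : g ∘ₗ lin f = LinearMap.id) (h₂ : lin f ∘ₗ g = LinearMap.id) :
    (mkIso f g h₁ h₂).hom = f := rfl

theorem iso_hom_inv {V W : CrossedPointed ξ} (e : V ≅ W) (w : W.carrier) :
    lin e.hom (lin e.inv w) = w :=
  LinearMap.congr_fun (congrArg lin e.inv_hom_id) w

theorem iso_inv_hom {V W : CrossedPointed ξ} (e : V ≅ W) (v : V.carrier) :
    lin e.inv (lin e.hom v) = v :=
  LinearMap.congr_fun (congrArg lin e.hom_inv_id) v

variable [DecidableEq X]

/-- The tensor product of graded vector spaces. -/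
noncomputable def tensorObj (V W : CrossedPointed ξ) : CrossedPointed ξ where
  carrier := V.carrier ⊗[K] W.carrier
  proj := Grading.tensor V.proj W.proj
  isGrading := Grading.isGrading_tensor V.isGrading W.isGrading

variable (ξ) in
/-- The ground field in degree `1`. -/
def unit : CrossedPointed ξ where
  carrier := K
  proj := Grading.unit K X
  isGrading := Grading.isGrading_unit K X

/-- The tensor product of morphisms. -/
noncomputable def tensorHom {V V' W W' : CrossedPointed ξ} (f : V ⟶ V') (g : W ⟶ W') :
    tensorObj V W ⟶ tensorObj V' W' :=
  ⟨TensorProduct.map (lin f) (lin g), Grading.tensor_natural V.isGrading W.isGrading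
    V'.isGrading W'.isGrading (lin_proj f) (lin_proj g)⟩

/-- The associator `(u ⊗ v) ⊗ w ↦ ω(x,y,z) u ⊗ (v ⊗ w)`, for `u`, `v`, `w` of degrees
`x`, `y`, `z`. -/
noncomputable def associator (U V W : CrossedPointed ξ) :
    tensorObj (tensorObj U V) W ≅ tensorObj U (tensorObj V W) :=
  mkIso (V := tensorObj (tensorObj U V) W) (W := tensorObj U (tensorObj V W))
    ⟨Grading.assocHom U.proj V.proj W.proj ξ.ω,
      Grading.assocHom_graded U.isGrading V.isGrading W.isGrading ξ.ω⟩
    (Grading.assocInv U.proj V.proj W.proj ξ.ω)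
    (Grading.assocInv_comp U.isGrading V.isGrading W.isGrading ξ.ω)
    (Grading.assocHom_comp U.isGrading V.isGrading W.isGrading ξ.ω)

/-- `Vec_X^ω` as a monoidal category. (As `ω` is normalized, the unit constraints
`a ⊗ v ↦ ω(1,1,x)⁻¹ a v` and `v ⊗ a ↦ ω(x,1,1) a v` are the usual ones.) -/
noncomputable instance : MonoidalCategoryStruct (CrossedPointed ξ) where
  tensorObj := tensorObj
  tensorHom := tensorHom
  whiskerLeft V _ _ f := tensorHom (𝟙 V) f
  whiskerRight f V := tensorHom f (𝟙 V)
  tensorUnit := unit ξ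
  associator := associator
  leftUnitor V := mkIso (V := tensorObj (unit ξ) V)
    ⟨(TensorProduct.lid K V.carrier).toLinearMap, Grading.lid_graded (K := K) V.isGrading⟩
    (TensorProduct.lid K V.carrier).symm.toLinearMap
    (TensorProduct.lid K V.carrier).symm_comp (TensorProduct.lid K V.carrier).comp_symm
  rightUnitor V := mkIso (V := tensorObj V (unit ξ))
    ⟨(TensorProduct.rid K V.carrier).toLinearMap, Grading.rid_graded (K := K) V.isGrading⟩
    (TensorProduct.rid K V.carrier).symm.toLinearMap
    (TensorProduct.rid K V.carrier).symm_comp (TensorProduct.rid K V.carrier).comp_symm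

noncomputable instance : MonoidalCategory (CrossedPointed ξ) :=
  MonoidalCategory.ofTensorHom
    (id_tensorHom_id := fun _ _ => hom_ext TensorProduct.map_id)
    (id_tensorHom := fun _ _ _ _ => rfl)
    (tensorHom_id := fun _ _ => rfl)
    (tensorHom_comp_tensorHom := fun f₁ f₂ g₁ g₂ =>
      hom_ext (TensorProduct.map_comp (lin g₁) (lin g₂) (lin f₁) (lin f₂)).symm)
    (associator_naturality := fun {U V W U' V' W'} f g h => hom_ext <|
      Grading.assocHom_natural U.isGrading V.isGrading W.isGrading U'.isGrading V'.isGrading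
        W'.isGrading ξ.ω (lin_proj f) (lin_proj g) (lin_proj h))
    (leftUnitor_naturality := fun f => hom_ext <|
      TensorProduct.ext' fun (a : K) v => ((lin f).map_smul a v).symm)
    (rightUnitor_naturality := fun f => hom_ext <|
      TensorProduct.ext' fun v (a : K) => ((lin f).map_smul a v).symm)
    (pentagon := fun S U V W => hom_ext <|
      Grading.pentagon S.isGrading U.isGrading V.isGrading W.isGrading ξ.ω_cocycle)
    (triangle := fun V W => hom_ext <| Grading.triangle V.isGrading W.isGrading ξ.ω_one₂)

theorem lin_tensorHom {V V' W W' : CrossedPointed ξ} (f : V ⟶ V') (g : W ⟶ W') :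
    lin (f ⊗ₘ g) = TensorProduct.map (lin f) (lin g) := rfl

theorem lin_whiskerRight {V V' : CrossedPointed ξ} (f : V ⟶ V') (W : CrossedPointed ξ) :
    lin (f ▷ W) = TensorProduct.map (lin f) LinearMap.id := rfl

theorem lin_whiskerLeft (V : CrossedPointed ξ) {W W' : CrossedPointed ξ} (f : W ⟶ W') :
    lin (V ◁ f) = TensorProduct.map LinearMap.id (lin f) := rfl

instance : MonoidalPreadditive (CrossedPointed ξ) where
  whiskerLeft_zero := hom_ext (TensorProduct.map_zero_right _)
  zero_whiskerRight := hom_ext (TensorProduct.map_zero_left _)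
  whiskerLeft_add f g := hom_ext (TensorProduct.map_add_right _ (lin f) (lin g))
  add_whiskerRight f g := hom_ext (TensorProduct.map_add_left (lin f) (lin g) _)

instance : MonoidalLinear K (CrossedPointed ξ) where
  whiskerLeft_smul _ _ _ r f := hom_ext (TensorProduct.map_smul_right r _ (lin f))
  smul_whiskerRight r _ _ f _ := hom_ext (TensorProduct.map_smul_left r (lin f) _)

end CrossedPointed

end CrossedPointed

/-! ### Group actions on tensor categories and equivariantization -/

open Functor.OplaxMonoidal in
/-- An action of a group `G` on a `K`-linear monoidal category `C`, i.e. a tensor functor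
`T : G → Aut_⊗(C)`. The tensor and unit-preserving structures of `T g` are
`δ (T g) X Y : T_g (X ⊗ Y) ⟶ T_g X ⊗ T_g Y` and `η (T g) : T_g 𝟙 ⟶ 𝟙`, and
those of `T` are `γ` and `ι`. -/
structure TensorAction (K : Type*) [Field K] (G : Type*) [Group G] (C : Type*) [Category C]
    [Preadditive C] [Linear K C] [MonoidalCategory C] where
  T : G → C ⥤ C
  [additive : ∀ g, (T g).Additive]
  [linear : ∀ g, (T g).Linear K]
  [monoidal : ∀ g, (T g).Monoidal]
  γ : ∀ g h, T (g * h) ≅ T h ⋙ T g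
  ι : T 1 ≅ 𝟭 C
  /-- `γ g h` and `ι` are isomorphisms of tensor functors. -/
  γ_tensor : ∀ g h (X Y : C),
    (γ g h).hom.app (X ⊗ Y) ≫ (T g).map (δ (T h) X Y) ≫ δ (T g) ((T h).obj X) ((T h).obj Y) =
      δ (T (g * h)) X Y ≫ ((γ g h).hom.app X ⊗ₘ (γ g h).hom.app Y)
  γ_unit : ∀ g h,
    (γ g h).hom.app (𝟙_ C) ≫ (T g).map (η (T h)) ≫ η (T g) = η (T (g * h))
  ι_tensor : ∀ X Y : C, ι.hom.app (X ⊗ Y) = δ (T 1) X Y ≫ (ι.hom.app X ⊗ₘ ι.hom.app Y)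
  ι_unit : ι.hom.app (𝟙_ C) = η (T 1)
  /-- `T` is a tensor functor. -/
  γ_assoc : ∀ g h k (X : C),
    (γ (g * h) k).hom.app X ≫ (γ g h).hom.app ((T k).obj X) =
      eqToHom (by rw [mul_assoc]) ≫ (γ g (h * k)).hom.app X ≫ (T g).map ((γ h k).hom.app X)
  γ_one_left : ∀ g (X : C),
    (γ 1 g).hom.app X ≫ ι.hom.app ((T g).obj X) = eqToHom (by rw [one_mul]; rfl)
  γ_one_right : ∀ g (X : C),
    (γ g 1).hom.app X ≫ (T g).map (ι.hom.app X) = eqToHom (by rw [mul_one]; rfl)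

attribute [instance] TensorAction.additive TensorAction.linear TensorAction.monoidal

section Equivariantization

variable {K : Type*} [Field K] {G : Type*} [Group G] {C : Type*} [Category C]
  [Preadditive C] [Linear K C] [MonoidalCategory C]

/-- A `G`-equivariant object: an object with isomorphisms `u g : T_g X ≅ X` such that
`u_{gh} = u_g ∘ T_g(u_h) ∘ γ_{g,h}(X)`. -/
structure Equivariantization (A : TensorAction K G C) where
  obj : C
  u : ∀ g, (A.T g).obj obj ≅ obj
  u_mul : ∀ g h,
    (u (g * h)).hom = (A.γ g h).hom.app obj ≫ (A.T g).map (u h).hom ≫ (u g).hom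

namespace Equivariantization

variable {A : TensorAction K G C}

open Functor.OplaxMonoidal

/-- Morphisms commuting with the equivariant structures. -/
def homs (V W : Equivariantization A) : Submodule K (V.obj ⟶ W.obj) where
  carrier := {f | ∀ g, (A.T g).map f ≫ (W.u g).hom = (V.u g).hom ≫ f}
  add_mem' hf hf' g := by
    simp only [Set.mem_ofPred_eq] at hf hf'
    simp [Functor.map_add, hf g, hf' g]
  zero_mem' g := by simp
  smul_mem' a f hf g := by
    simp only [Set.mem_ofPred_eq] at hf
    simp [Functor.map_smul, hf g]

instance : Category (Equivariantization A) where
  Hom V W := homs V W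
  id V := ⟨𝟙 V.obj, fun g => by simp⟩
  comp f f' := ⟨f.1 ≫ f'.1, fun g => by
    rw [Functor.map_comp, Category.assoc, f'.2 g, ← Category.assoc, f.2 g, Category.assoc]⟩
  id_comp f := Subtype.ext (Category.id_comp f.1)
  comp_id f := Subtype.ext (Category.comp_id f.1)
  assoc f g h := Subtype.ext (Category.assoc f.1 g.1 h.1)

/-- The underlying morphism of an equivariant morphism. -/
def und {V W : Equivariantization A} (f : V ⟶ W) : V.obj ⟶ W.obj := Subtype.val f

theorem und_comm {V W : Equivariantization A} (f : V ⟶ W) (g : G) :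
    (A.T g).map (und f) ≫ (W.u g).hom = (V.u g).hom ≫ und f := f.2 g

theorem hom_ext {V W : Equivariantization A} {f f' : V ⟶ W} (h : und f = und f') : f = f' :=
  Subtype.ext h

@[simp] theorem und_id (V : Equivariantization A) : und (𝟙 V) = 𝟙 V.obj := rfl

@[simp] theorem und_comp {U V W : Equivariantization A} (f : U ⟶ V) (f' : V ⟶ W) :
    und (f ≫ f') = und f ≫ und f' := rfl

instance : Preadditive (Equivariantization A) where
  homGroup V W := inferInstanceAs (AddCommGroup (homs V W))
  add_comp _ _ _ f f' g := hom_ext (Preadditive.add_comp _ _ _ (und f) (und f') (und g))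
  comp_add _ _ _ f g g' := hom_ext (Preadditive.comp_add _ _ _ (und f) (und g) (und g'))

instance : Linear K (Equivariantization A) where
  homModule V W := inferInstanceAs (Module K (homs V W))
  smul_comp _ _ _ a f g := hom_ext (Linear.smul_comp _ _ _ a (und f) (und g))
  comp_smul _ _ _ f a g := hom_ext (Linear.comp_smul _ _ _ (und f) a (und g))

/-- An isomorphism of the underlying objects that commutes with the equivariant structures. -/
def mkIso {V W : Equivariantization A} (e : V.obj ≅ W.obj)
    (he : ∀ g, (A.T g).map e.hom ≫ (W.u g).hom = (V.u g).hom ≫ e.hom) : V ≅ W where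
  hom := ⟨e.hom, he⟩
  inv := ⟨e.inv, fun g => by
    rw [← cancel_mono e.hom, Category.assoc, ← he g, Category.assoc, e.inv_hom_id,
      Category.comp_id, ← CategoryTheory.Functor.map_comp_assoc, e.inv_hom_id, CategoryTheory.Functor.map_id,
      Category.id_comp]⟩
  hom_inv_id := hom_ext e.hom_inv_id
  inv_hom_id := hom_ext e.inv_hom_id

theorem tensor_mul (V W : Equivariantization A) (g h : G) :
    δ (A.T (g * h)) V.obj W.obj ≫ ((V.u (g * h)).hom ⊗ₘ (W.u (g * h)).hom) =
      (A.γ g h).hom.app (V.obj ⊗ W.obj) ≫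
        (A.T g).map (δ (A.T h) V.obj W.obj ≫ ((V.u h).hom ⊗ₘ (W.u h).hom)) ≫
          δ (A.T g) V.obj W.obj ≫ ((V.u g).hom ⊗ₘ (W.u g).hom) := by
  rw [V.u_mul, W.u_mul, ← MonoidalCategory.tensorHom_comp_tensorHom, ← Category.assoc,
    ← A.γ_tensor, CategoryTheory.Functor.map_comp, Category.assoc, Category.assoc, Category.assoc,
    ← MonoidalCategory.tensorHom_comp_tensorHom, δ_natural_assoc]

theorem tensor_comm {V V' W W' : Equivariantization A} (f : V ⟶ V') (f' : W ⟶ W') (g : G) :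
    (A.T g).map (und f ⊗ₘ und f') ≫ δ (A.T g) V'.obj W'.obj ≫
        ((V'.u g).hom ⊗ₘ (W'.u g).hom) =
      (δ (A.T g) V.obj W.obj ≫ ((V.u g).hom ⊗ₘ (W.u g).hom)) ≫ (und f ⊗ₘ und f') := by
  rw [← δ_natural_assoc, Category.assoc, MonoidalCategory.tensorHom_comp_tensorHom,
    MonoidalCategory.tensorHom_comp_tensorHom, und_comm, und_comm]

theorem associator_comm (U V W : Equivariantization A) (g : G) :
    (A.T g).map (α_ U.obj V.obj W.obj).hom ≫ δ (A.T g) U.obj (V.obj ⊗ W.obj) ≫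
        ((U.u g).hom ⊗ₘ (δ (A.T g) V.obj W.obj ≫ ((V.u g).hom ⊗ₘ (W.u g).hom))) =
      (δ (A.T g) (U.obj ⊗ V.obj) W.obj ≫
        ((δ (A.T g) U.obj V.obj ≫ ((U.u g).hom ⊗ₘ (V.u g).hom)) ⊗ₘ (W.u g).hom)) ≫
          (α_ U.obj V.obj W.obj).hom := by
  have e₁ : ((U.u g).hom ⊗ₘ (δ (A.T g) V.obj W.obj ≫ ((V.u g).hom ⊗ₘ (W.u g).hom))) =
      (A.T g).obj U.obj ◁ δ (A.T g) V.obj W.obj ≫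
        ((U.u g).hom ⊗ₘ ((V.u g).hom ⊗ₘ (W.u g).hom)) := by
    rw [← MonoidalCategory.id_tensorHom, MonoidalCategory.tensorHom_comp_tensorHom,
      Category.id_comp]
  have e₂ : ((δ (A.T g) U.obj V.obj ≫ ((U.u g).hom ⊗ₘ (V.u g).hom)) ⊗ₘ (W.u g).hom) =
      δ (A.T g) U.obj V.obj ▷ (A.T g).obj W.obj ≫
        (((U.u g).hom ⊗ₘ (V.u g).hom) ⊗ₘ (W.u g).hom) := by
    rw [← MonoidalCategory.tensorHom_id, MonoidalCategory.tensorHom_comp_tensorHom,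
      Category.id_comp]
  rw [e₁, e₂, ← Functor.OplaxMonoidal.associativity_assoc,
    ← MonoidalCategory.associator_naturality]
  simp only [Category.assoc]

theorem leftUnitor_comm (V : Equivariantization A) (g : G) :
    (A.T g).map (λ_ V.obj).hom ≫ (V.u g).hom =
      (δ (A.T g) (𝟙_ C) V.obj ≫ (η (A.T g) ⊗ₘ (V.u g).hom)) ≫ (λ_ V.obj).hom := by
  rw [← left_unitality_hom, Category.assoc, Category.assoc, Category.assoc,
    MonoidalCategory.tensorHom_def, Category.assoc, MonoidalCategory.leftUnitor_naturality]

theorem rightUnitor_comm (V : Equivariantization A) (g : G) :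
    (A.T g).map (ρ_ V.obj).hom ≫ (V.u g).hom =
      (δ (A.T g) V.obj (𝟙_ C) ≫ ((V.u g).hom ⊗ₘ η (A.T g))) ≫ (ρ_ V.obj).hom := by
  rw [← right_unitality_hom, Category.assoc, Category.assoc, Category.assoc,
    MonoidalCategory.tensorHom_def', Category.assoc, MonoidalCategory.rightUnitor_naturality]

/-- The tensor product of `(X, u)` and `(X', u')`: the object `X ⊗ X'` with the equivariant
structure `(u_g ⊗ u'_g) ∘ μ_g(X, X')`. -/
def tensorObj (V W : Equivariantization A) : Equivariantization A where
  obj := V.obj ⊗ W.obj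
  u g := (Functor.Monoidal.μIso (A.T g) V.obj W.obj).symm ≪≫ (V.u g ⊗ᵢ W.u g)
  u_mul := tensor_mul V W

theorem tensorObj_u (V W : Equivariantization A) (g : G) :
    ((tensorObj V W).u g).hom = δ (A.T g) V.obj W.obj ≫ ((V.u g).hom ⊗ₘ (W.u g).hom) := rfl

variable (A) in
/-- The unit object, with the equivariant structure `T_g 𝟙 ≅ 𝟙`. -/
def unit : Equivariantization A where
  obj := 𝟙_ C
  u g := (Functor.Monoidal.εIso (A.T g)).symm
  u_mul g h := (A.γ_unit g h).symm

theorem unit_u (g : G) : ((unit A).u g).hom = η (A.T g) := rfl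

instance : MonoidalCategoryStruct (Equivariantization A) where
  tensorObj := tensorObj
  tensorHom f f' := ⟨und f ⊗ₘ und f', tensor_comm f f'⟩
  whiskerLeft V _ _ f := ⟨V.obj ◁ und f, fun g => by
    have := tensor_comm (𝟙 V) f g
    rw [und_id, MonoidalCategory.id_tensorHom] at this
    exact this⟩
  whiskerRight f V := ⟨und f ▷ V.obj, fun g => by
    have := tensor_comm f (𝟙 V) g
    rw [und_id, MonoidalCategory.tensorHom_id] at this
    exact this⟩
  tensorUnit := unit A
  associator U V W := mkIso (V := tensorObj (tensorObj U V) W) (W := tensorObj U (tensorObj V W))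
    (α_ U.obj V.obj W.obj) (associator_comm U V W)
  leftUnitor V := mkIso (V := tensorObj (unit A) V) (λ_ V.obj) (leftUnitor_comm V)
  rightUnitor V := mkIso (V := tensorObj V (unit A)) (ρ_ V.obj) (rightUnitor_comm V)

instance : MonoidalCategory (Equivariantization A) where
  tensorHom_def f g := hom_ext (MonoidalCategory.tensorHom_def (und f) (und g))
  id_tensorHom_id V W := hom_ext (MonoidalCategory.id_tensorHom_id V.obj W.obj)
  tensorHom_comp_tensorHom f₁ f₂ g₁ g₂ := hom_ext
    (MonoidalCategory.tensorHom_comp_tensorHom (und f₁) (und f₂) (und g₁) (und g₂))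
  whiskerLeft_id V W := hom_ext (MonoidalCategory.whiskerLeft_id V.obj W.obj)
  id_whiskerRight V W := hom_ext (MonoidalCategory.id_whiskerRight V.obj W.obj)
  associator_naturality f g h := hom_ext
    (MonoidalCategory.associator_naturality (und f) (und g) (und h))
  leftUnitor_naturality f := hom_ext (MonoidalCategory.leftUnitor_naturality (und f))
  rightUnitor_naturality f := hom_ext (MonoidalCategory.rightUnitor_naturality (und f))
  pentagon U V W Z := hom_ext (MonoidalCategory.pentagon U.obj V.obj W.obj Z.obj)
  triangle V W := hom_ext (MonoidalCategory.triangle V.obj W.obj)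

instance [MonoidalPreadditive C] : MonoidalPreadditive (Equivariantization A) where
  whiskerLeft_zero {V _ _} := hom_ext (MonoidalPreadditive.whiskerLeft_zero (X := V.obj))
  zero_whiskerRight {V _ _} := hom_ext (MonoidalPreadditive.zero_whiskerRight (X := V.obj))
  whiskerLeft_add f g := hom_ext (MonoidalPreadditive.whiskerLeft_add (und f) (und g))
  add_whiskerRight f g := hom_ext (MonoidalPreadditive.add_whiskerRight (und f) (und g))

instance [MonoidalPreadditive C] [MonoidalLinear K C] :
    MonoidalLinear K (Equivariantization A) where
  whiskerLeft_smul V _ _ r f := hom_ext (MonoidalLinear.whiskerLeft_smul V.obj r (und f))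
  smul_whiskerRight r _ _ f V := hom_ext (MonoidalLinear.smul_whiskerRight r (und f) V.obj)

end Equivariantization

end Equivariantization

/-! ### The crossed structure of `C(ξ)` -/

namespace Grading

section Twist

variable {K : Type*} [Field K] {X : Type*} [Fintype X] [Group X] [DecidableEq X]
  {G : Type*} [Group G] [MulDistribMulAction G X]
  {V W Z : Type*} [AddCommGroup V] [Module K V] [AddCommGroup W] [Module K W]
  [AddCommGroup Z] [Module K Z]
  {p : X → Module.End K V} {q : X → Module.End K W} {r : X → Module.End K Z}

/-- The grading in which a vector of original degree `x` has degree `g • x`. -/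
def twist (g : G) (p : X → Module.End K V) (x : X) : Module.End K V := p (g⁻¹ • x)

theorem isGrading_twist (g : G) (hp : CompleteOrthogonalIdempotents p) :
    CompleteOrthogonalIdempotents (twist g p) :=
  (CompleteOrthogonalIdempotents.equiv (MulAction.toPerm (g⁻¹ : G))).2 hp

theorem twist_hom (g : G) {x : X} {v : V} (hv : p x v = v) : twist g p (g • x) v = v := by
  rw [twist, inv_smul_smul, hv]

theorem diag₁_graded (hp : CompleteOrthogonalIdempotents p) {r : X → Module.End K V}
    (hr : CompleteOrthogonalIdempotents r) {p' : X → Module.End K V}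
    (hp' : CompleteOrthogonalIdempotents p') (φ : X → X) (h : ∀ x v, p x v = v → p' (φ x) v = v)
    (h' : ∀ x v, p x v = v → r (φ x) v = v) (s : X → K) (d : X) (v : V) :
    diag₁ p s (p' d v) = r d (diag₁ p s v) := by
  refine LinearMap.congr_fun (ext₁ (f := diag₁ p s ∘ₗ p' d) (g := r d ∘ₗ diag₁ p s) hp
    fun x v hv => ?_) v
  rw [LinearMap.comp_apply, LinearMap.comp_apply, diag₁_apply hp s hv, map_smul,
    apply_hom hp' (h x v hv), apply_hom hr (h' x v hv)]
  split_ifs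
  · exact diag₁_apply hp s hv
  · simp

theorem diag₂_graded (g : G) (hp : CompleteOrthogonalIdempotents p)
    (hq : CompleteOrthogonalIdempotents q) (s : X → X → K) (d : X) (t : V ⊗[K] W) :
    diag₂ p q s (twist g (tensor p q) d t) =
      tensor (twist g p) (twist g q) d (diag₂ p q s t) := by
  refine LinearMap.congr_fun (ext₂ (f := diag₂ p q s ∘ₗ twist g (tensor p q) d)
    (g := tensor (twist g p) (twist g q) d ∘ₗ diag₂ p q s) hp hq fun x y v w hv hw => ?_) t
  rw [LinearMap.comp_apply, LinearMap.comp_apply, diag₂_apply hp hq s hv hw, map_smul,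
    apply_hom (isGrading_twist g (isGrading_tensor hp hq))
      (twist_hom g (tensor_hom hp hq hv hw)),
    tensor_apply (isGrading_twist g hp) (isGrading_twist g hq) (twist_hom g hv)
      (twist_hom g hw), smul_mul']
  split_ifs
  · exact diag₂_apply hp hq s hv hw
  · simp

theorem diag₁_comp (hp : CompleteOrthogonalIdempotents p) {s t : X → K}
    (h : ∀ x, s x * t x = 1) : diag₁ p s ∘ₗ diag₁ p t = LinearMap.id :=
  ext₁ hp fun x v hv => by
    rw [LinearMap.comp_apply, diag₁_apply hp t hv, map_smul, diag₁_apply hp s hv, smul_smul,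
      mul_comm, h, one_smul, LinearMap.id_apply]

theorem diag₂_comp (hp : CompleteOrthogonalIdempotents p)
    (hq : CompleteOrthogonalIdempotents q) {s t : X → X → K}
    (h : ∀ x y, s x y * t x y = 1) : diag₂ p q s ∘ₗ diag₂ p q t = LinearMap.id :=
  ext₂ hp hq fun x y v w hv hw => by
    rw [LinearMap.comp_apply, diag₂_apply hp hq t hv hw, map_smul, diag₂_apply hp hq s hv hw,
      smul_smul, mul_comm, h, one_smul, LinearMap.id_apply]

theorem diag₁_natural (hp : CompleteOrthogonalIdempotents p)
    (hq : CompleteOrthogonalIdempotents q) (s : X → K) {f : V →ₗ[K] W}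
    (hf : ∀ x v, f (p x v) = q x (f v)) : diag₁ q s ∘ₗ f = f ∘ₗ diag₁ p s :=
  ext₁ hp fun x v hv => by
    rw [LinearMap.comp_apply, LinearMap.comp_apply, diag₁_apply hp s hv,
      diag₁_apply hq s (x := x) (by rw [← hf, hv]), map_smul]

theorem diag₂_natural {V' W' : Type*} [AddCommGroup V'] [Module K V'] [AddCommGroup W']
    [Module K W'] {p' : X → Module.End K V'} {q' : X → Module.End K W'}
    (hp : CompleteOrthogonalIdempotents p) (hq : CompleteOrthogonalIdempotents q)
    (hp' : CompleteOrthogonalIdempotents p') (hq' : CompleteOrthogonalIdempotents q')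
    (s : X → X → K) {f : V →ₗ[K] V'} {g : W →ₗ[K] W'} (hf : ∀ x v, f (p x v) = p' x (f v))
    (hg : ∀ x v, g (q x v) = q' x (g v)) :
    diag₂ p' q' s ∘ₗ TensorProduct.map f g = TensorProduct.map f g ∘ₗ diag₂ p q s :=
  ext₂ hp hq fun x y v w hv hw => by
    rw [LinearMap.comp_apply, LinearMap.comp_apply, diag₂_apply hp hq s hv hw,
      TensorProduct.map_tmul, diag₂_apply hp' hq' s (x := x) (y := y) (by rw [← hf, hv])
        (by rw [← hg, hw]), map_smul, TensorProduct.map_tmul]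

theorem twist_assoc (g : G) (hp : CompleteOrthogonalIdempotents p)
    (hq : CompleteOrthogonalIdempotents q) (hr : CompleteOrthogonalIdempotents r)
    {s : X → X → X → Kˣ} {m : X → X → Kˣ}
    (h : ∀ x y z, m y z * m x (y * z) / (m (x * y) z * m x y) =
      s (g • x) (g • y) (g • z) / s x y z) :
    assocHom (twist g p) (twist g q) (twist g r) s ∘ₗ
        TensorProduct.map (diag₂ p q fun x y => (m x y : K)) LinearMap.id ∘ₗ
          diag₂ (tensor p q) r (fun x y => (m x y : K)) =
      TensorProduct.map LinearMap.id (diag₂ q r fun x y => (m x y : K)) ∘ₗ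
        diag₂ p (tensor q r) (fun x y => (m x y : K)) ∘ₗ assocHom p q r s :=
  ext₃ hp hq hr fun x y z v w t hv hw ht => by
    simp only [LinearMap.comp_apply]
    rw [assocHom_apply hp hq hr s hv hw ht,
      diag₂_apply (isGrading_tensor hp hq) hr _ (tensor_hom hp hq hv hw) ht,
      map_smul, map_smul, map_smul, map_smul,
      diag₂_apply hp (isGrading_tensor hq hr) _ hv (tensor_hom hq hr hw ht), map_smul,
      TensorProduct.map_tmul, TensorProduct.map_tmul, diag₂_apply hp hq _ hv hw,
      diag₂_apply hq hr _ hw ht, LinearMap.id_apply, LinearMap.id_apply,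
      ← TensorProduct.smul_tmul', map_smul, assocHom_apply (isGrading_twist g hp)
        (isGrading_twist g hq) (isGrading_twist g hr) s (twist_hom g hv) (twist_hom g hw)
        (twist_hom g ht), TensorProduct.tmul_smul, smul_smul, smul_smul, smul_smul, smul_smul]
    congr 1
    have := h x y z
    rw [div_eq_div_iff_mul_eq_mul] at this
    have := congrArg Units.val this
    simp only [Units.val_mul] at this
    linear_combination -this

theorem twist_lid (hp : CompleteOrthogonalIdempotents p) {m : X → X → Kˣ}
    (h : ∀ y, m 1 y = 1) :
    (TensorProduct.lid K V).symm.toLinearMap =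
      TensorProduct.map LinearMap.id LinearMap.id ∘ₗ
        diag₂ (unit K X) p (fun x y => (m x y : K)) ∘ₗ
          (TensorProduct.lid K V).symm.toLinearMap :=
  ext₁ hp fun x v hv => by
    simp only [LinearMap.comp_apply, LinearEquiv.coe_coe, TensorProduct.lid_symm_apply]
    rw [diag₂_apply (isGrading_unit K X) hp _ (unit_hom 1) hv, h]
    simp

theorem twist_rid (hp : CompleteOrthogonalIdempotents p) {m : X → X → Kˣ}
    (h : ∀ y, m y 1 = 1) :
    (TensorProduct.rid K V).symm.toLinearMap =
      TensorProduct.map LinearMap.id LinearMap.id ∘ₗ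
        diag₂ p (unit K X) (fun x y => (m x y : K)) ∘ₗ
          (TensorProduct.rid K V).symm.toLinearMap :=
  ext₁ hp fun x v hv => by
    simp only [LinearMap.comp_apply, LinearEquiv.coe_coe, TensorProduct.rid_symm_apply]
    rw [diag₂_apply hp (isGrading_unit K X) _ hv (unit_hom 1), h]
    simp

theorem γ_tensor (h : G) (hp : CompleteOrthogonalIdempotents p)
    (hq : CompleteOrthogonalIdempotents q) {c : X → Kˣ} {m₁ m₂ m₃ : X → X → Kˣ}
    (H : ∀ x y, c x * c y / c (x * y) = m₁ (h • x) (h • y) * m₂ x y / m₃ x y) :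
    diag₂ (twist h p) (twist h q) (fun x y => (m₁ x y : K)) ∘ₗ
        diag₂ p q (fun x y => (m₂ x y : K)) ∘ₗ diag₁ (tensor p q) (fun x => (c x : K)) =
      TensorProduct.map (diag₁ p fun x => (c x : K)) (diag₁ q fun x => (c x : K)) ∘ₗ
        diag₂ p q (fun x y => (m₃ x y : K)) :=
  ext₂ hp hq fun x y v w hv hw => by
    simp only [LinearMap.comp_apply]
    rw [diag₁_apply (isGrading_tensor hp hq) _ (tensor_hom hp hq hv hw), map_smul,
      diag₂_apply hp hq _ hv hw, diag₂_apply hp hq _ hv hw, map_smul, map_smul, map_smul,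
      diag₂_apply (isGrading_twist h hp) (isGrading_twist h hq) _ (twist_hom h hv)
        (twist_hom h hw), TensorProduct.map_tmul, diag₁_apply hp _ hv, diag₁_apply hq _ hw,
      TensorProduct.smul_tmul_smul, smul_smul, smul_smul, smul_smul]
    congr 1
    have := H x y
    rw [div_eq_div_iff_mul_eq_mul] at this
    have := congrArg Units.val this
    simp only [Units.val_mul] at this
    linear_combination -this

theorem γ_unit {c : X → Kˣ} (h : c 1 = 1) :
    (LinearMap.id ∘ₗ LinearMap.id) ∘ₗ diag₁ (unit K X) (fun x => (c x : K)) = LinearMap.id :=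
  ext_unit (by
    simp only [LinearMap.comp_apply]
    rw [diag₁_apply (isGrading_unit K X) _ (unit_hom 1), h]
    simp)

theorem ι_tensor (hp : CompleteOrthogonalIdempotents p)
    (hq : CompleteOrthogonalIdempotents q) {m : X → X → Kˣ} (h : ∀ x y, m x y = 1) :
    LinearMap.id = TensorProduct.map LinearMap.id LinearMap.id ∘ₗ
      diag₂ p q (fun x y => (m x y : K)) :=
  ext₂ hp hq fun x y v w hv hw => by
    rw [LinearMap.comp_apply, diag₂_apply hp hq _ hv hw, h]
    simp

theorem γ_assoc (k : G) (hp : CompleteOrthogonalIdempotents p)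
    {c₁ c₂ c₃ c₄ : X → Kˣ} (H : ∀ x, c₁ x * c₂ x = c₃ x * c₄ (k • x)) :
    diag₁ (twist k p) (fun x => (c₄ x : K)) ∘ₗ diag₁ p (fun x => (c₃ x : K)) =
      (diag₁ p (fun x => (c₁ x : K)) ∘ₗ diag₁ p (fun x => (c₂ x : K))) ∘ₗ LinearMap.id :=
  ext₁ hp fun x v hv => by
    simp only [LinearMap.comp_apply, LinearMap.id_apply]
    rw [diag₁_apply hp _ hv, diag₁_apply hp _ hv, map_smul, map_smul, diag₁_apply hp _ hv,
      diag₁_apply (isGrading_twist k hp) _ (twist_hom k hv), smul_smul, smul_smul]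
    congr 1
    have := congrArg Units.val (H x)
    simp only [Units.val_mul] at this
    linear_combination -this

theorem γ_one (hp : CompleteOrthogonalIdempotents p) {c : X → Kˣ} (h : ∀ x, c x = 1) :
    LinearMap.id ∘ₗ diag₁ p (fun x => (c x : K)) = LinearMap.id :=
  ext₁ hp fun x v hv => by
    rw [LinearMap.comp_apply, diag₁_apply hp _ hv, h]
    simp

end Twist

end Grading

namespace CrossedPointed

variable {K : Type u} [Field K] {X : Type v} {G : Type w} [Group X] [Group G]
  [MulDistribMulAction G X] [Fintype X] [DecidableEq X] {M : CrossedModule X G}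
  {ξ : NormalizedCocycle K M}

/-- The object `T_g V`: the vector space `V`, in which a vector of degree `x` in `V` has
degree `g • x`. -/
def twistObj (g : G) (V : CrossedPointed ξ) : CrossedPointed ξ where
  carrier := V.carrier
  proj := Grading.twist g V.proj
  isGrading := Grading.isGrading_twist g V.isGrading

variable (ξ) in
/-- The functor `T_g`. -/
def T (g : G) : CrossedPointed ξ ⥤ CrossedPointed ξ where
  obj V := twistObj g V
  map {V W} f := ⟨lin (V := V) (W := W) f, fun x v => lin_proj f (g⁻¹ • x) v⟩

theorem lin_T_map (g : G) {V W : CrossedPointed ξ} (f : V ⟶ W) :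
    lin ((T ξ g).map f) = lin f := rfl

/-- The tensor structure `μ_g(x,y) id : T_g (V ⊗ W) ≅ T_g V ⊗ T_g W` of `T_g`. -/
noncomputable def μIso (g : G) (V W : CrossedPointed ξ) :
    (T ξ g).obj (V ⊗ W) ≅ (T ξ g).obj V ⊗ (T ξ g).obj W :=
  mkIso (V := twistObj g (tensorObj V W)) (W := tensorObj (twistObj g V) (twistObj g W))
    ⟨Grading.diag₂ V.proj W.proj (fun x y => (ξ.μ g x y : K)),
      Grading.diag₂_graded g V.isGrading W.isGrading _⟩
    (Grading.diag₂ V.proj W.proj (fun x y => ((ξ.μ g x y)⁻¹ : Kˣ)))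
    (Grading.diag₂_comp V.isGrading W.isGrading (by simp))
    (Grading.diag₂_comp V.isGrading W.isGrading (by simp))

/-- The unit-preserving structure of `T_g`; it is given by `μ_g(1,1)⁻¹ = 1`. -/
def νIso (g : G) : (T ξ g).obj (𝟙_ (CrossedPointed ξ)) ≅ 𝟙_ (CrossedPointed ξ) :=
  mkIso (V := twistObj g (unit ξ)) (W := unit ξ)
    ⟨LinearMap.id, fun x (a : K) => by
      change Grading.unit K X (g⁻¹ • x) a = Grading.unit K X x a
      simp only [Grading.unit, inv_smul_eq_iff, smul_one]⟩
    LinearMap.id rfl rfl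

noncomputable instance (g : G) : (T ξ g).OplaxMonoidal where
  η := (νIso g).hom
  δ V W := (μIso g V W).hom
  δ_natural_left {V V'} f W := hom_ext <|
    (Grading.diag₂_natural V.isGrading W.isGrading V'.isGrading W.isGrading _
      (lin_proj f) (lin_proj (𝟙 W))).symm
  δ_natural_right {V V'} W f := hom_ext <|
    (Grading.diag₂_natural W.isGrading V.isGrading W.isGrading V'.isGrading _
      (lin_proj (𝟙 W)) (lin_proj f)).symm
  oplax_associativity U V W := hom_ext <| LinearMap.ext fun t =>
    LinearMap.congr_fun (Grading.twist_assoc g U.isGrading V.isGrading W.isGrading (ξ.μ_ω g)) t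
  oplax_left_unitality V := hom_ext <| Grading.twist_lid V.isGrading (ξ.μ_one₂ g)
  oplax_right_unitality V := hom_ext <| Grading.twist_rid V.isGrading (ξ.μ_one₃ g)

noncomputable instance (g : G) : (T ξ g).Monoidal :=
  have : IsIso (Functor.OplaxMonoidal.η (T ξ g)) := (νIso g).isIso_hom
  have : ∀ V W, IsIso (Functor.OplaxMonoidal.δ (T ξ g) V W) := fun V W => (μIso g V W).isIso_hom
  Functor.Monoidal.ofOplaxMonoidal (T ξ g)

/-- The tensor structure `γ_{g,h}(x) id : T_{gh} V ≅ T_g (T_h V)` of `T`. -/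
noncomputable def γIso (g h : G) : T ξ (g * h) ≅ T ξ h ⋙ T ξ g :=
  NatIso.ofComponents
    (fun V => mkIso (V := twistObj (g * h) V) (W := twistObj g (twistObj h V))
      ⟨Grading.diag₁ V.proj (fun x => (ξ.γ g h x : K)),
        Grading.diag₁_graded V.isGrading
          (Grading.isGrading_twist g (Grading.isGrading_twist h V.isGrading))
          (Grading.isGrading_twist (g * h) V.isGrading) (fun x => g • h • x)
          (fun x v hv => by rw [← mul_smul]; exact Grading.twist_hom _ hv)
          (fun x v hv => Grading.twist_hom g (Grading.twist_hom h hv)) _⟩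
      (Grading.diag₁ V.proj (fun x => ((ξ.γ g h x)⁻¹ : Kˣ)))
      (Grading.diag₁_comp V.isGrading (by simp)) (Grading.diag₁_comp V.isGrading (by simp)))
    fun {V W} f => hom_ext <| Grading.diag₁_natural V.isGrading W.isGrading _ (lin_proj f)

/-- The unit-preserving structure `T_1 V ≅ V` of `T`; it is given by `γ_{1,1}(x)⁻¹ = 1`. -/
def ιIso : T ξ 1 ≅ 𝟭 (CrossedPointed ξ) :=
  NatIso.ofComponents
    (fun V => mkIso (V := twistObj 1 V) (W := V)
      ⟨LinearMap.id, fun x v => by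
        change V.proj ((1 : G)⁻¹ • x) v = V.proj x v
        rw [inv_one, one_smul]⟩ LinearMap.id rfl rfl)
    fun f => rfl

theorem lin_eqToHom {g g' : G} (h : g = g') {V : CrossedPointed ξ}
    (e : (T ξ g).obj V = (T ξ g').obj V) :
    lin (eqToHom e) = (LinearMap.id : V.carrier →ₗ[K] V.carrier) := by
  subst h; rfl

variable (ξ) in
/-- The action of `G` on `C(ξ)`. -/
noncomputable def action : TensorAction K G (CrossedPointed ξ) where
  T := T ξ
  additive _ := { map_add := rfl }
  linear _ := { map_smul := fun _ _ => rfl }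
  γ := γIso
  ι := ιIso
  γ_tensor g h V W := hom_ext <| Grading.γ_tensor h V.isGrading W.isGrading (ξ.γ_μ g h)
  γ_unit g h := hom_ext <| Grading.γ_unit (ξ.γ_one₃ g h)
  ι_tensor V W := hom_ext <| Grading.ι_tensor V.isGrading W.isGrading ξ.μ_one₁
  ι_unit := hom_ext rfl
  γ_assoc g h k V := hom_ext <| by
    simp only [lin_comp]
    rw [lin_eqToHom (mul_assoc g h k)]
    exact Grading.γ_assoc k V.isGrading (ξ.γ_cocycle g h k)
  γ_one_left g V := hom_ext <| (Grading.γ_one V.isGrading (ξ.γ_one₁ g)).trans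
    (lin_eqToHom (one_mul g) _).symm
  γ_one_right g V := hom_ext <| (Grading.γ_one V.isGrading (ξ.γ_one₂ g)).trans
    (lin_eqToHom (mul_one g) _).symm

end CrossedPointed

/-! ### The braiding of the equivariantization `C(ξ)^G` -/

namespace CrossedPointed

variable {K : Type u} [Field K] {X : Type v} {G : Type w} [Group X] [Group G]
  [MulDistribMulAction G X] [Fintype X] [DecidableEq X] {M : CrossedModule X G}
  {ξ : NormalizedCocycle K M}

section Raw

variable {V W Z : Type*} [AddCommGroup V] [Module K V] [AddCommGroup W] [Module K W]
  [AddCommGroup Z] [Module K Z] {p : X → Module.End K V} {q : X → Module.End K W}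
  {r : X → Module.End K Z}

open Grading

variable (ξ p q) in
/-- A linear map of the form `v ⊗ w ↦ c(x,y) (A (∂ x) w ⊗ v)`, for `v`, `w` of degrees
`x`, `y`. -/
def IsBraid (A : G → W →ₗ[K] W) (B : V ⊗[K] W →ₗ[K] W ⊗[K] V) : Prop :=
  ∀ x y v w, p x v = v → q y w = w → B (v ⊗ₜ w) = (ξ.c x y : K) • (A (M.bd x) w ⊗ₜ v)

/-- `A g` sends vectors of degree `x` to vectors of degree `g • x`. -/
def IsShift (q : X → Module.End K W) (A : G → W →ₗ[K] W) : Prop :=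
  ∀ g y w, q y w = w → q (g • y) (A g w) = A g w

variable (ξ p q) in
/-- `g ▷ (v ⊗ w) = μ_g(x,y) (g ▷ v ⊗ g ▷ w)`, for `v`, `w` of degrees `x`, `y`. -/
def IsTensor (A : G → V →ₗ[K] V) (A' : G → W →ₗ[K] W)
    (A'' : G → V ⊗[K] W →ₗ[K] V ⊗[K] W) : Prop :=
  ∀ g x y v w, p x v = v → q y w = w →
    A'' g (v ⊗ₜ w) = (ξ.μ g x y : K) • (A g v ⊗ₜ A' g w)

variable (ξ q) in
/-- `gh ▷ w = γ_{g,h}(x) (g ▷ (h ▷ w))`, for `w` of degree `x`. -/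
def IsTwisted (A : G → W →ₗ[K] W) : Prop :=
  ∀ g h x w, q x w = w → A (g * h) w = (ξ.γ g h x : K) • A g (A h w)

theorem braid_hexagon_forward (hp : CompleteOrthogonalIdempotents p)
    (hq : CompleteOrthogonalIdempotents q) (hr : CompleteOrthogonalIdempotents r)
    {A : G → W →ₗ[K] W} {A' : G → Z →ₗ[K] Z} {A'' : G → W ⊗[K] Z →ₗ[K] W ⊗[K] Z}
    (hA : IsShift q A) (hA' : IsShift r A') (hA'' : IsTensor ξ q r A A' A'')
    {B₁ : V ⊗[K] W →ₗ[K] W ⊗[K] V} {B₂ : V ⊗[K] Z →ₗ[K] Z ⊗[K] V}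
    {B₃ : V ⊗[K] (W ⊗[K] Z) →ₗ[K] (W ⊗[K] Z) ⊗[K] V} (h₁ : IsBraid ξ p q A B₁)
    (h₂ : IsBraid ξ p r A' B₂) (h₃ : IsBraid ξ p (tensor q r) A'' B₃) :
    assocHom q r p ξ.ω ∘ₗ B₃ ∘ₗ assocHom p q r ξ.ω =
      TensorProduct.map LinearMap.id B₂ ∘ₗ assocHom q p r ξ.ω ∘ₗ
        TensorProduct.map B₁ LinearMap.id :=
  ext₃ hp hq hr fun x y z v w t hv hw ht => by
    simp only [LinearMap.comp_apply]
    rw [assocHom_apply hp hq hr ξ.ω hv hw ht, TensorProduct.map_tmul, h₁ x y v w hv hw,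
      LinearMap.id_apply, ← TensorProduct.smul_tmul', map_smul, map_smul,
      h₃ x (y * z) _ _ hv (tensor_hom hq hr hw ht), hA'' _ y z w t hw ht,
      map_smul (assocHom q p r ξ.ω), assocHom_apply hq hp hr ξ.ω (hA _ y w hw) hv ht,
      ← TensorProduct.smul_tmul', map_smul, map_smul,
      assocHom_apply hq hr hp ξ.ω (hA _ y w hw) (hA' _ z t ht) hv, map_smul, map_smul,
      TensorProduct.map_tmul, h₂ x z v t hv ht, LinearMap.id_apply, TensorProduct.tmul_smul,
      smul_smul, smul_smul, smul_smul, smul_smul, smul_smul, M.bd_smul, M.bd_smul]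
    congr 1
    have := congrArg Units.val (ξ.c_mul_right x y z)
    rw [div_mul_eq_mul_div, eq_comm, ← Units.ext_iff, div_eq_iff_eq_mul] at this
    have := congrArg Units.val this
    simp only [Units.val_mul] at this
    linear_combination -this

theorem braid_hexagon_reverse (hp : CompleteOrthogonalIdempotents p)
    (hq : CompleteOrthogonalIdempotents q) (hr : CompleteOrthogonalIdempotents r)
    {A : G → Z →ₗ[K] Z} (hA : IsShift r A) (hA' : IsTwisted ξ r A)
    {B₁ : W ⊗[K] Z →ₗ[K] Z ⊗[K] W} {B₂ : V ⊗[K] Z →ₗ[K] Z ⊗[K] V}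
    {B₃ : (V ⊗[K] W) ⊗[K] Z →ₗ[K] Z ⊗[K] (V ⊗[K] W)} (h₁ : IsBraid ξ q r A B₁)
    (h₂ : IsBraid ξ p r A B₂) (h₃ : IsBraid ξ (tensor p q) r A B₃) :
    assocInv r p q ξ.ω ∘ₗ B₃ ∘ₗ assocInv p q r ξ.ω =
      TensorProduct.map B₂ LinearMap.id ∘ₗ assocInv p r q ξ.ω ∘ₗ
        TensorProduct.map LinearMap.id B₁ :=
  ext₃' hp hq hr fun x y z v w t hv hw ht => by
    simp only [LinearMap.comp_apply]
    rw [assocInv_apply hp hq hr ξ.ω hv hw ht, TensorProduct.map_tmul, h₁ y z w t hw ht,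
      LinearMap.id_apply, TensorProduct.tmul_smul, map_smul, map_smul,
      h₃ (x * y) z _ _ (tensor_hom hp hq hv hw) ht, map_mul, hA' _ _ z t ht,
      map_smul (assocInv p r q ξ.ω), assocInv_apply hp hr hq ξ.ω hv (hA _ z t ht) hw,
      ← TensorProduct.smul_tmul', map_smul, map_smul,
      assocInv_apply hr hp hq ξ.ω (hA _ _ _ (hA _ z t ht)) hv hw, map_smul, map_smul,
      TensorProduct.map_tmul, h₂ x _ v _ hv (hA _ z t ht), LinearMap.id_apply,
      ← TensorProduct.smul_tmul', smul_smul, smul_smul, smul_smul, smul_smul, smul_smul,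
      ← mul_smul, ← map_mul, M.bd_smul, M.bd_smul, ← Units.val_mul, ← Units.val_mul,
      ← Units.val_mul, ← Units.val_mul, ← Units.val_mul]
    congr 2
    rw [ξ.c_mul_left x y z]
    apply Additive.ofMul.injective
    simp only [ofMul_mul, ofMul_inv, ofMul_div]
    abel

theorem braid_equivariant (hp : CompleteOrthogonalIdempotents p)
    (hq : CompleteOrthogonalIdempotents q)
    {A : G → V →ₗ[K] V} {A' : G → W →ₗ[K] W} {A₁ : G → V ⊗[K] W →ₗ[K] V ⊗[K] W}
    {A₂ : G → W ⊗[K] V →ₗ[K] W ⊗[K] V} (hA : IsShift p A) (hA' : IsShift q A')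
    (hq' : IsTwisted ξ q A') (h₁ : IsTensor ξ p q A A' A₁) (h₂ : IsTensor ξ q p A' A A₂)
    {B : V ⊗[K] W →ₗ[K] W ⊗[K] V} (hB : IsBraid ξ p q A' B) (g : G) :
    A₂ g ∘ₗ B = B ∘ₗ A₁ g :=
  ext₂ hp hq fun x y v w hv hw => by
    rw [LinearMap.comp_apply, LinearMap.comp_apply, hB x y v w hv hw, map_smul,
      h₁ g x y v w hv hw, map_smul, hB _ _ _ _ (hA g x v hv) (hA' g y w hw),
      h₂ g _ _ _ _ (hA' (M.bd x) y w hw) hv, M.smul_bd]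
    have e₁ := hq' (g * M.bd x * g⁻¹) g y w hw
    rw [inv_mul_cancel_right, hq' g (M.bd x) y w hw] at e₁
    have e₂ : A' (g * M.bd x * g⁻¹) (A' g w) =
        (((ξ.γ (g * M.bd x * g⁻¹) g y)⁻¹ * ξ.γ g (M.bd x) y : Kˣ) : K) •
          A' g (A' (M.bd x) w) := by
      rw [Units.val_mul, mul_smul, e₁, smul_smul]; simp
    rw [e₂, ← TensorProduct.smul_tmul', smul_smul, smul_smul, smul_smul, M.bd_smul,
      ← Units.val_mul, ← Units.val_mul, ← Units.val_mul]
    congr 2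
    have := ξ.c_inv g x y
    rw [div_eq_iff_eq_mul] at this
    rw [this]
    apply Additive.ofMul.injective
    simp only [ofMul_mul, ofMul_inv, ofMul_div]
    abel

theorem braid_natural_right {W' : Type*} [AddCommGroup W'] [Module K W']
    {q' : X → Module.End K W'}
    (hp : CompleteOrthogonalIdempotents p) (hq : CompleteOrthogonalIdempotents q)
    {A : G → W →ₗ[K] W} {A' : G → W' →ₗ[K] W'} {f : W →ₗ[K] W'}
    (hf : ∀ x w, f (q x w) = q' x (f w)) (hfA : ∀ g, A' g ∘ₗ f = f ∘ₗ A g)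
    {B : V ⊗[K] W →ₗ[K] W ⊗[K] V} {B' : V ⊗[K] W' →ₗ[K] W' ⊗[K] V}
    (h : IsBraid ξ p q A B) (h' : IsBraid ξ p q' A' B') :
    B' ∘ₗ TensorProduct.map LinearMap.id f = TensorProduct.map f LinearMap.id ∘ₗ B :=
  ext₂ hp hq fun x y v w hv hw => by
    rw [LinearMap.comp_apply, LinearMap.comp_apply, TensorProduct.map_tmul,
      LinearMap.id_apply, h x y v w hv hw, h' x y _ _ hv (by rw [← hf, hw]), map_smul, TensorProduct.map_tmul,
      ← LinearMap.comp_apply, hfA]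
    rfl

theorem braid_natural_left {V' : Type*} [AddCommGroup V'] [Module K V']
    {p' : X → Module.End K V'}
    (hp : CompleteOrthogonalIdempotents p) (hq : CompleteOrthogonalIdempotents q)
    {A : G → W →ₗ[K] W} {f : V →ₗ[K] V'} (hf : ∀ x v, f (p x v) = p' x (f v))
    {B : V ⊗[K] W →ₗ[K] W ⊗[K] V} {B' : V' ⊗[K] W →ₗ[K] W ⊗[K] V'}
    (h : IsBraid ξ p q A B) (h' : IsBraid ξ p' q A B') :
    B' ∘ₗ TensorProduct.map f LinearMap.id = TensorProduct.map LinearMap.id f ∘ₗ B :=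
  ext₂ hp hq fun x y v w hv hw => by
    rw [LinearMap.comp_apply, LinearMap.comp_apply, TensorProduct.map_tmul,
      LinearMap.id_apply, h x y v w hv hw, h' x y _ _ (by rw [← hf, hv]) hw, map_smul, TensorProduct.map_tmul]
    rfl

end Raw

end CrossedPointed

namespace CrossedPointed

variable {K : Type u} [Field K] {X : Type v} {G : Type w} [Group X] [Group G]
  [MulDistribMulAction G X] [Fintype X] [DecidableEq X] {M : CrossedModule X G}
  {ξ : NormalizedCocycle K M}

section RawHom

variable {V W : Type*} [AddCommGroup V] [Module K V] [AddCommGroup W] [Module K W]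
  {p : X → Module.End K V} {q : X → Module.End K W} [DecidableEq G]

open Grading

variable (ξ p q) in
/-- The map `v ⊗ w ↦ c(x,y) (w ⊗ v)`, for `v`, `w` of degrees `x`, `y`, if `∂ x = g`, and
`v ⊗ w ↦ 0` if `∂ x ≠ g`. -/
noncomputable def flip (g : G) : V ⊗[K] W →ₗ[K] W ⊗[K] V :=
  (TensorProduct.comm K V W).toLinearMap ∘ₗ
    diag₂ p q fun x y => if M.bd x = g then (ξ.c x y : K) else 0

variable (ξ p q) in
/-- The map in the opposite direction, with the inverse scalars. -/
noncomputable def flipInv (g : G) : W ⊗[K] V →ₗ[K] V ⊗[K] W :=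
  (TensorProduct.comm K W V).toLinearMap ∘ₗ
    diag₂ q p fun y x => if M.bd x = g then ((ξ.c x y)⁻¹ : Kˣ) else 0

theorem flip_apply (hp : CompleteOrthogonalIdempotents p)
    (hq : CompleteOrthogonalIdempotents q) (g : G) {x y : X} {v : V} {w : W} (hv : p x v = v)
    (hw : q y w = w) :
    flip ξ p q g (v ⊗ₜ w) = (if M.bd x = g then (ξ.c x y : K) else 0) • (w ⊗ₜ v) := by
  rw [flip, LinearMap.comp_apply, diag₂_apply hp hq _ hv hw, map_smul]
  rfl

theorem flipInv_apply (hp : CompleteOrthogonalIdempotents p)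
    (hq : CompleteOrthogonalIdempotents q) (g : G) {x y : X} {v : V} {w : W} (hv : p x v = v)
    (hw : q y w = w) :
    flipInv ξ p q g (w ⊗ₜ v) =
      (if M.bd x = g then (((ξ.c x y)⁻¹ : Kˣ) : K) else 0) • (v ⊗ₜ w) := by
  rw [flipInv, LinearMap.comp_apply, diag₂_apply hq hp _ hw hv, map_smul]
  rfl

theorem flip_graded (hp : CompleteOrthogonalIdempotents p)
    (hq : CompleteOrthogonalIdempotents q) (g : G) (d : X) (t : V ⊗[K] W) :
    flip ξ p q g (tensor p q d t) = tensor (twist g q) p d (flip ξ p q g t) :=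
  graded₂ (f := flip ξ p q g) hp hq (isGrading_tensor (isGrading_twist g hq) hp) (fun x y v w hv hw => by
    rw [flip_apply hp hq g hv hw]
    split_ifs with h
    · rw [map_smul, tensor_apply (isGrading_twist g hq) hp (twist_hom g hw) hv, if_pos]
      rw [← h, M.bd_smul, inv_mul_cancel_right]
    · simp) d t

variable [Fintype G]

theorem isBraid_sum (hp : CompleteOrthogonalIdempotents p)
    (hq : CompleteOrthogonalIdempotents q) (A : G → W →ₗ[K] W) :
    IsBraid ξ p q A (∑ g, TensorProduct.map (A g) LinearMap.id ∘ₗ flip ξ p q g) :=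
  fun x y v w hv hw => by
    rw [LinearMap.sum_apply, Finset.sum_eq_single (M.bd x)]
    · rw [LinearMap.comp_apply, flip_apply hp hq _ hv hw, if_pos rfl, map_smul]; rfl
    · intro g _ hg
      rw [LinearMap.comp_apply, flip_apply hp hq _ hv hw, if_neg hg.symm, zero_smul, map_zero]
    · simp

theorem sum_flipInv_apply (hp : CompleteOrthogonalIdempotents p)
    (hq : CompleteOrthogonalIdempotents q) {A : G → W →ₗ[K] W}
    (hA : ∀ g y w, q y w = w → q (g⁻¹ • y) (A g w) = A g w) {x y : X} {v : V} {w : W}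
    (hv : p x v = v) (hw : q y w = w) :
    (∑ g, flipInv ξ p q g ∘ₗ TensorProduct.map (A g) LinearMap.id) (w ⊗ₜ v) =
      (((ξ.c x ((M.bd x)⁻¹ • y))⁻¹ : Kˣ) : K) • (v ⊗ₜ A (M.bd x) w) := by
  rw [LinearMap.sum_apply, Finset.sum_eq_single (M.bd x)]
  · rw [LinearMap.comp_apply, TensorProduct.map_tmul, LinearMap.id_apply,
      flipInv_apply hp hq _ hv (hA _ y w hw), if_pos rfl]
  · intro g _ hg
    rw [LinearMap.comp_apply, TensorProduct.map_tmul, LinearMap.id_apply,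
      flipInv_apply hp hq _ hv (hA _ y w hw), if_neg hg.symm, zero_smul]
  · simp

theorem braid_comp_inv (hp : CompleteOrthogonalIdempotents p)
    (hq : CompleteOrthogonalIdempotents q) {A A' : G → W →ₗ[K] W}
    (hA' : ∀ g y w, q y w = w → q (g⁻¹ • y) (A' g w) = A' g w)
    (h : ∀ g w, A g (A' g w) = w) :
    (∑ g, TensorProduct.map (A g) LinearMap.id ∘ₗ flip ξ p q g) ∘ₗ
        (∑ g, flipInv ξ p q g ∘ₗ TensorProduct.map (A' g) LinearMap.id) = LinearMap.id :=
  ext₂ hq hp fun y x w v hw hv => by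
    rw [LinearMap.comp_apply, sum_flipInv_apply hp hq hA' hv hw, map_smul,
      isBraid_sum hp hq A x _ v _ hv (hA' _ y w hw), h, smul_smul]
    simp

theorem inv_comp_braid (hp : CompleteOrthogonalIdempotents p)
    (hq : CompleteOrthogonalIdempotents q) {A A' : G → W →ₗ[K] W}
    (hA : IsShift q A) (hA' : ∀ g y w, q y w = w → q (g⁻¹ • y) (A' g w) = A' g w)
    (h : ∀ g w, A' g (A g w) = w) :
    (∑ g, flipInv ξ p q g ∘ₗ TensorProduct.map (A' g) LinearMap.id) ∘ₗ
        (∑ g, TensorProduct.map (A g) LinearMap.id ∘ₗ flip ξ p q g) = LinearMap.id :=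
  ext₂ hp hq fun x y v w hv hw => by
    rw [LinearMap.comp_apply, isBraid_sum hp hq A x y v w hv hw, map_smul,
      sum_flipInv_apply hp hq hA' hv (hA _ y w hw), h, smul_smul, inv_smul_smul]
    simp

end RawHom

/-- The `G`-braiding of `C(ξ)`: on the summand `V_g ⊗ W` of `V ⊗ W`, where
`V_g = ⨁_{∂ x = g} V_x` is the component of `V` of degree `g` in the `G`-grading of `C(ξ)`, it is
the isomorphism `V_g ⊗ W ≅ T_g W ⊗ V_g`, `v ⊗ w ↦ c(x,y) w ⊗ v`, for `v`, `w` of degrees `x`, `y`;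
on the summands `V_h ⊗ W` with `h ≠ g` it is zero. -/
noncomputable def crossedBraiding [DecidableEq G] (g : G) (V W : CrossedPointed ξ) :
    V ⊗ W ⟶ (T ξ g).obj W ⊗ V :=
  (⟨flip ξ V.proj W.proj g, flip_graded V.isGrading W.isGrading g⟩ :
    homs (tensorObj V W) (tensorObj (twistObj g W) V))

end CrossedPointed

/-- The equivariantization `C(ξ)^G`. -/
abbrev EquivariantCategory {K : Type u} [Field K] {X : Type v} {G : Type w} [Group X] [Group G]
    [MulDistribMulAction G X] [Fintype X] [DecidableEq X] {M : CrossedModule X G}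
    (ξ : NormalizedCocycle K M) :=
  Equivariantization (CrossedPointed.action ξ)

namespace EquivariantCategory

variable {K : Type u} [Field K] {X : Type v} {G : Type w} [Group X] [Group G]
  [MulDistribMulAction G X] [Fintype X] [DecidableEq X] {M : CrossedModule X G}
  {ξ : NormalizedCocycle K M}

open CrossedPointed

/-- The vector space underlying an equivariant object. -/
abbrev carrier (V : EquivariantCategory ξ) : Type u := V.obj.carrier

/-- The projection onto the vectors of degree `x`. -/
abbrev proj (V : EquivariantCategory ξ) (x : X) : Module.End K V.carrier := V.obj.proj x

theorem isGrading (V : EquivariantCategory ξ) : CompleteOrthogonalIdempotents V.proj :=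
  V.obj.isGrading

/-- The twisted action `v ↦ g ▷ v` of `G` on an equivariant object `V`, i.e. the equivariant
structure `u_g : T_g V ≅ V` as a linear map from `V` to itself. -/
def act (V : EquivariantCategory ξ) (g : G) : V.carrier →ₗ[K] V.carrier :=
  lin (V := twistObj g V.obj) (W := V.obj) (V.u g).hom

/-- The inverse of `act`. -/
def actInv (V : EquivariantCategory ξ) (g : G) : V.carrier →ₗ[K] V.carrier :=
  lin (V := V.obj) (W := twistObj g V.obj) (V.u g).inv

theorem act_actInv (V : EquivariantCategory ξ) (g : G) (v : V.carrier) :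
    V.act g (V.actInv g v) = v := iso_hom_inv (V.u g) v

theorem actInv_act (V : EquivariantCategory ξ) (g : G) (v : V.carrier) :
    V.actInv g (V.act g v) = v := iso_inv_hom (V.u g) v

theorem act_shift (V : EquivariantCategory ξ) : IsShift V.proj V.act := fun g _ _ hv =>
  lin_hom (V.u g).hom (Grading.twist_hom g hv)

theorem actInv_shift (V : EquivariantCategory ξ) (g : G) (x : X) (v : V.carrier)
    (hv : V.proj x v = v) : V.proj (g⁻¹ • x) (V.actInv g v) = V.actInv g v :=
  lin_hom (V.u g).inv hv

theorem act_twisted (V : EquivariantCategory ξ) : IsTwisted ξ V.proj V.act :=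
  fun g h x v hv => by
    refine (LinearMap.congr_fun (congrArg lin (V.u_mul g h)) v).trans ?_
    change V.act g (V.act h (Grading.diag₁ V.proj (fun x => (ξ.γ g h x : K)) v)) = _
    rw [Grading.diag₁_apply V.isGrading _ hv, map_smul, map_smul]

theorem act_tensor (V W : EquivariantCategory ξ) :
    IsTensor ξ V.proj W.proj V.act W.act (act (V ⊗ W)) :=
  fun g x y v w hv hw => by
    change TensorProduct.map (V.act g) (W.act g)
      (Grading.diag₂ V.proj W.proj (fun x y => (ξ.μ g x y : K)) (v ⊗ₜ w)) = _
    rw [Grading.diag₂_apply V.isGrading W.isGrading _ hv hw, map_smul, TensorProduct.map_tmul]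

theorem act_comm {V W : EquivariantCategory ξ} (f : V ⟶ W) (g : G) :
    W.act g ∘ₗ lin (Equivariantization.und f) = lin (Equivariantization.und f) ∘ₗ V.act g :=
  congrArg lin (Equivariantization.und_comm f g)

variable [Fintype G] [DecidableEq G]

/-- The morphism `⨁ V_g ⊗ W ⟶ ⨁ T_g W ⊗ V_g ⟶ ⨁ W ⊗ V_g` underlying the braiding: the
`G`-braiding followed by the equivariant structure of `W`. -/
noncomputable def braidingHom (V W : EquivariantCategory ξ) : V.obj ⊗ W.obj ⟶ W.obj ⊗ V.obj :=
  ∑ g, crossedBraiding g V.obj W.obj ≫ ((W.u g).hom ▷ V.obj)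

theorem lin_braidingHom (V W : EquivariantCategory ξ) : lin (braidingHom V W) =
    ∑ g, TensorProduct.map (W.act g) LinearMap.id ∘ₗ flip ξ V.proj W.proj g :=
  lin_sum _ _

theorem isBraid_braidingHom (V W : EquivariantCategory ξ) :
    IsBraid ξ V.proj W.proj W.act (lin (braidingHom V W)) := by
  rw [lin_braidingHom]
  exact isBraid_sum V.isGrading W.isGrading W.act

/-- The braiding `v ⊗ w ↦ c(x,y) (∂ x ▷ w ⊗ v)`, for `v`, `w` of degrees `x`, `y`. -/
noncomputable def braiding (V W : EquivariantCategory ξ) : V ⊗ W ≅ W ⊗ V :=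
  Equivariantization.mkIso (V := V ⊗ W) (W := W ⊗ V)
    (CrossedPointed.mkIso (V := V.obj ⊗ W.obj) (W := W.obj ⊗ V.obj) (braidingHom V W)
      (∑ g, flipInv ξ V.proj W.proj g ∘ₗ TensorProduct.map (W.actInv g) LinearMap.id)
      (by
        rw [lin_braidingHom]
        exact inv_comp_braid V.isGrading W.isGrading W.act_shift W.actInv_shift W.actInv_act)
      (by
        rw [lin_braidingHom]
        exact braid_comp_inv V.isGrading W.isGrading W.actInv_shift W.act_actInv))
    fun g => CrossedPointed.hom_ext <|
      braid_equivariant V.isGrading W.isGrading V.act_shift W.act_shift W.act_twisted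
        (act_tensor V W) (act_tensor W V) (isBraid_braidingHom V W) g

/-- The braided tensor category `C(ξ)^G`. -/
noncomputable instance : BraidedCategory (EquivariantCategory ξ) where
  braiding := braiding
  braiding_naturality_right U V W f := Equivariantization.hom_ext <| CrossedPointed.hom_ext <|
    braid_natural_right U.isGrading V.isGrading (lin_proj (Equivariantization.und f))
      (act_comm f) (isBraid_braidingHom U V) (isBraid_braidingHom U W)
  braiding_naturality_left {U V} f W := Equivariantization.hom_ext <| CrossedPointed.hom_ext <|
    braid_natural_left U.isGrading W.isGrading (lin_proj (Equivariantization.und f))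
      (isBraid_braidingHom U W) (isBraid_braidingHom V W)
  hexagon_forward U V W := Equivariantization.hom_ext <| CrossedPointed.hom_ext <|
    braid_hexagon_forward U.isGrading V.isGrading W.isGrading V.act_shift W.act_shift
      (act_tensor V W) (isBraid_braidingHom U V) (isBraid_braidingHom U W)
      (isBraid_braidingHom U (V ⊗ W))
  hexagon_reverse U V W := Equivariantization.hom_ext <| CrossedPointed.hom_ext <|
    braid_hexagon_reverse U.isGrading V.isGrading W.isGrading W.act_shift W.act_twisted
      (isBraid_braidingHom V W) (isBraid_braidingHom U W) (isBraid_braidingHom (U ⊗ V) W)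

end EquivariantCategory

/-! ### Quasi-triangular quasi-Hopf algebras -/

section QuasiHopf

variable (K : Type*) [Field K] (H : Type*) [Ring H] [Algebra K H]

open Algebra.TensorProduct in
/-- A quasi-bialgebra structure on the algebra `H`, with coproduct `Δ`, counit `ε` and Drinfeld
associator `Φ ∈ H ⊗ H ⊗ H`. -/
class QuasiBialgebra where
  Δ : H →ₐ[K] H ⊗[K] H
  ε : H →ₐ[K] K
  Φ : (H ⊗[K] (H ⊗[K] H))ˣ
  /-- `(id ⊗ Δ)(Δ a) = Φ (Δ ⊗ id)(Δ a) Φ⁻¹` -/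
  quasi_coassoc : ∀ a : H,
    map (AlgHom.id K H) Δ (Δ a) * Φ =
      Φ * Algebra.TensorProduct.assoc K K K H H H (map Δ (AlgHom.id K H) (Δ a))
  /-- `(id ⊗ id ⊗ Δ)(Φ) (Δ ⊗ id ⊗ id)(Φ) = (1 ⊗ Φ) (id ⊗ Δ ⊗ id)(Φ) (Φ ⊗ 1)` -/
  pentagon :
    map (AlgHom.id K H) (map (AlgHom.id K H) Δ) Φ.val *
        Algebra.TensorProduct.assoc K K K H H (H ⊗[K] H) (map Δ (AlgHom.id K (H ⊗[K] H)) Φ.val) =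
      (1 : H) ⊗ₜ[K] Φ.val *
        map (AlgHom.id K H)
          ((Algebra.TensorProduct.assoc K K K H H H).toAlgHom.comp (map Δ (AlgHom.id K H))) Φ.val *
        map (AlgHom.id K H) (Algebra.TensorProduct.assoc K K K H H H).toAlgHom
          (Algebra.TensorProduct.assoc K K K H (H ⊗[K] H) H (Φ.val ⊗ₜ[K] (1 : H)))
  counit_left : ∀ a : H, Algebra.TensorProduct.lid K H (map ε (AlgHom.id K H) (Δ a)) = a
  counit_right : ∀ a : H, Algebra.TensorProduct.rid K K H (map (AlgHom.id K H) ε (Δ a)) = a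
  /-- `(id ⊗ ε ⊗ id)(Φ) = 1` -/
  counit_mid : map (AlgHom.id K H)
    ((Algebra.TensorProduct.lid K H).toAlgHom.comp (map ε (AlgHom.id K H))) Φ.val = 1

open QuasiBialgebra Algebra.TensorProduct in
/-- A quasi-triangular quasi-Hopf algebra structure on the algebra `H`: a quasi-bialgebra with a
universal `R`-matrix, and with an antipode `(S, α, β)`.
For `Φ = ∑ X ⊗ Y ⊗ Z`, the element `Φ_{ijk}` has `X`, `Y` and `Z` in the tensor factors with the
numbers `i`, `j` and `k`. -/
class QuasiTriangularQuasiHopf extends QuasiBialgebra K H where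
  R : (H ⊗[K] H)ˣ
  /-- `Δ^op(a) = R Δ(a) R⁻¹` -/
  R_comm : ∀ a : H, Algebra.TensorProduct.comm K H H (Δ a) * R = R * Δ a
  /-- `(Δ ⊗ id)(R) = Φ₃₁₂ R₁₃ Φ₁₃₂⁻¹ R₂₃ Φ` -/
  hexagon₁ : Algebra.TensorProduct.assoc K K K H H H (map Δ (AlgHom.id K H) R.val) =
    map (AlgHom.id K H) (Algebra.TensorProduct.comm K H H).toAlgHom
        (leftComm K H H H Φ.val) *
      leftComm K H H H ((1 : H) ⊗ₜ R.val) *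
      map (AlgHom.id K H) (Algebra.TensorProduct.comm K H H).toAlgHom Φ⁻¹.val *
      (1 : H) ⊗ₜ R.val * Φ.val
  /-- `(id ⊗ Δ)(R) = Φ₂₃₁⁻¹ R₁₃ Φ₂₁₃ R₁₂ Φ⁻¹` -/
  hexagon₂ : map (AlgHom.id K H) Δ R.val =
    leftComm K H H H
        (map (AlgHom.id K H) (Algebra.TensorProduct.comm K H H).toAlgHom Φ⁻¹.val) *
      leftComm K H H H ((1 : H) ⊗ₜ R.val) *
      leftComm K H H H Φ.val *
      Algebra.TensorProduct.assoc K K K H H H (R.val ⊗ₜ (1 : H)) * Φ⁻¹.val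
  /-- The antipode, an anti-automorphism of the algebra `H`. -/
  S : H →ₗ[K] H
  S_bijective : Function.Bijective S
  α : H
  β : H
  S_one : S 1 = 1
  S_mul : ∀ a b : H, S (a * b) = S b * S a
  /-- `∑ S(a') α a'' = ε(a) α` -/
  S_left : ∀ a : H, LinearMap.mul' K H
    (TensorProduct.map (LinearMap.mulRight K α ∘ₗ S) LinearMap.id (Δ a)) = ε a • α
  /-- `∑ a' β S(a'') = ε(a) β` -/
  S_right : ∀ a : H, LinearMap.mul' K H
    (TensorProduct.map (LinearMap.mulRight K β) S (Δ a)) = ε a • β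
  /-- `∑ X β S(Y) α Z = 1`, where `Φ = ∑ X ⊗ Y ⊗ Z` -/
  S_Φ : LinearMap.mul' K H (TensorProduct.map (LinearMap.mulRight K β)
    (LinearMap.mul' K H ∘ₗ TensorProduct.map (LinearMap.mulRight K α ∘ₗ S)
      LinearMap.id) Φ.val) = 1
  /-- `∑ S(P) α Q β S(T) = 1`, where `Φ⁻¹ = ∑ P ⊗ Q ⊗ T` -/
  S_Φ_inv : LinearMap.mul' K H (TensorProduct.map (LinearMap.mulRight K α ∘ₗ S)
    (LinearMap.mul' K H ∘ₗ TensorProduct.map (LinearMap.mulRight K β) S) Φ⁻¹.val) = 1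

end QuasiHopf

/-! ### Modules over a quasi-triangular quasi-Hopf algebra -/

namespace QuasiHopf

variable {K : Type*} [Field K] {A B C A' B' : Type*} [Ring A] [Algebra K A] [Ring B] [Algebra K B]
  [Ring C] [Algebra K C] [Ring A'] [Algebra K A'] [Ring B'] [Algebra K B']
  {V W Z : Type*} [AddCommGroup V] [Module K V] [AddCommGroup W] [Module K W]
  [AddCommGroup Z] [Module K Z]

/-- The action of `A ⊗ B` on the tensor product of an `A`-module and a `B`-module. -/
noncomputable def tens (ρ : A →ₐ[K] Module.End K V) (σ : B →ₐ[K] Module.End K W) :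
    A ⊗[K] B →ₐ[K] Module.End K (V ⊗[K] W) :=
  Module.endTensorEndAlgHom.comp (Algebra.TensorProduct.map ρ σ)

theorem tens_tmul (ρ : A →ₐ[K] Module.End K V) (σ : B →ₐ[K] Module.End K W) (a : A) (b : B) :
    tens ρ σ (a ⊗ₜ b) = TensorProduct.map (ρ a) (σ b) := rfl

theorem tens_map (ρ : A →ₐ[K] Module.End K V) (σ : B →ₐ[K] Module.End K W) (f : A' →ₐ[K] A)
    (g : B' →ₐ[K] B) (x : A' ⊗[K] B') :
    tens (ρ.comp f) (σ.comp g) x = tens ρ σ (Algebra.TensorProduct.map f g x) := by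
  induction x with
  | zero => simp
  | add x y hx hy => simp only [map_add, hx, hy]
  | tmul a b => rfl

theorem tens_map_left (ρ : A →ₐ[K] Module.End K V) (σ : B →ₐ[K] Module.End K W) (f : A' →ₐ[K] A)
    (x : A' ⊗[K] B) :
    tens (ρ.comp f) σ x = tens ρ σ (Algebra.TensorProduct.map f (AlgHom.id K B) x) :=
  tens_map ρ σ f (AlgHom.id K B) x

theorem tens_map_right (ρ : A →ₐ[K] Module.End K V) (σ : B →ₐ[K] Module.End K W)
    (g : B' →ₐ[K] B) (x : A ⊗[K] B') :
    tens ρ (σ.comp g) x = tens ρ σ (Algebra.TensorProduct.map (AlgHom.id K A) g x) :=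
  tens_map ρ σ (AlgHom.id K A) g x

theorem tens_assoc (ρ : A →ₐ[K] Module.End K V) (σ : B →ₐ[K] Module.End K W)
    (τ : C →ₐ[K] Module.End K Z) (x : (A ⊗[K] B) ⊗[K] C) :
    (TensorProduct.assoc K V W Z).toLinearMap ∘ₗ tens (tens ρ σ) τ x =
      tens ρ (tens σ τ) (Algebra.TensorProduct.assoc K K K A B C x) ∘ₗ
        (TensorProduct.assoc K V W Z).toLinearMap := by
  induction x with
  | zero => simp
  | add x y hx hy => simp only [map_add, LinearMap.comp_add, LinearMap.add_comp, hx, hy]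
  | tmul x c =>
    induction x with
    | zero => simp
    | add x y hx hy =>
      simp only [TensorProduct.add_tmul, map_add, LinearMap.comp_add, LinearMap.add_comp, hx, hy]
    | tmul a b => exact TensorProduct.ext_threefold fun _ _ _ => rfl

theorem tens_comm (ρ : A →ₐ[K] Module.End K V) (σ : B →ₐ[K] Module.End K W) (x : A ⊗[K] B) :
    (TensorProduct.comm K V W).toLinearMap ∘ₗ tens ρ σ x =
      tens σ ρ (Algebra.TensorProduct.comm K A B x) ∘ₗ
        (TensorProduct.comm K V W).toLinearMap := by
  induction x with
  | zero => simp
  | add x y hx hy => simp only [map_add, LinearMap.comp_add, LinearMap.add_comp, hx, hy]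
  | tmul a b => exact TensorProduct.ext' fun _ _ => rfl

theorem map_id_tens (ρ : A →ₐ[K] Module.End K V) (σ : B →ₐ[K] Module.End K W) (b : B) :
    TensorProduct.map LinearMap.id (σ b) = tens ρ σ ((1 : A) ⊗ₜ b) := by
  rw [tens_tmul, map_one]; rfl

theorem map_tens_id (ρ : A →ₐ[K] Module.End K V) (σ : B →ₐ[K] Module.End K W) (a : A) :
    TensorProduct.map (ρ a) LinearMap.id = tens ρ σ (a ⊗ₜ (1 : B)) := by
  rw [tens_tmul, map_one]; rfl

theorem tens_mul (ρ : A →ₐ[K] Module.End K V) (σ : B →ₐ[K] Module.End K W) (x y : A ⊗[K] B) :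
    tens ρ σ (x * y) = tens ρ σ x ∘ₗ tens ρ σ y := map_mul _ _ _

/-- `id ⊗ f` intertwines the actions if `f` does so up to `F`. -/
theorem map_id_comp_tens {D : Type*} [Ring D] [Algebra K D] {U : Type*} [AddCommGroup U]
    [Module K U] (ρ : D →ₐ[K] Module.End K U) (σ : A →ₐ[K] Module.End K V)
    (τ : B →ₐ[K] Module.End K W) (F : A →ₐ[K] B) (f : V →ₗ[K] W)
    (h : ∀ a, f ∘ₗ σ a = τ (F a) ∘ₗ f) (x : D ⊗[K] A) :
    TensorProduct.map LinearMap.id f ∘ₗ tens ρ σ x =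
      tens ρ τ (Algebra.TensorProduct.map (AlgHom.id K D) F x) ∘ₗ
        TensorProduct.map LinearMap.id f := by
  induction x with
  | zero => simp
  | add x y hx hy => simp only [map_add, LinearMap.comp_add, LinearMap.add_comp, hx, hy]
  | tmul d a =>
    refine TensorProduct.ext' fun u v => ?_
    change ρ d u ⊗ₜ[K] f (σ a v) = ρ d u ⊗ₜ[K] (τ (F a) (f v))
    rw [← LinearMap.comp_apply, h]
    rfl

theorem map_comp_id_tens {D : Type*} [Ring D] [Algebra K D] {U : Type*} [AddCommGroup U]
    [Module K U] (ρ : D →ₐ[K] Module.End K U) (σ : A →ₐ[K] Module.End K V)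
    (τ : B →ₐ[K] Module.End K W) (F : A →ₐ[K] B) (f : V →ₗ[K] W)
    (h : ∀ a, f ∘ₗ σ a = τ (F a) ∘ₗ f) (x : A ⊗[K] D) :
    TensorProduct.map f LinearMap.id ∘ₗ tens σ ρ x =
      tens τ ρ (Algebra.TensorProduct.map F (AlgHom.id K D) x) ∘ₗ
        TensorProduct.map f LinearMap.id := by
  induction x with
  | zero => simp
  | add x y hx hy => simp only [map_add, LinearMap.comp_add, LinearMap.add_comp, hx, hy]
  | tmul a d =>
    refine TensorProduct.ext' fun v u => ?_
    change f (σ a v) ⊗ₜ[K] ρ d u = (τ (F a) (f v)) ⊗ₜ[K] ρ d u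
    rw [← LinearMap.comp_apply, h]
    rfl

end QuasiHopf

namespace QuasiHopf

section Raw

variable {K : Type*} [Field K] {A B C : Type*} [Ring A] [Algebra K A] [Ring B] [Algebra K B]
  [Ring C] [Algebra K C]
  {V W Z : Type*} [AddCommGroup V] [Module K V] [AddCommGroup W] [Module K W]
  [AddCommGroup Z] [Module K Z]

theorem tens_assoc_apply (ρ : A →ₐ[K] Module.End K V) (σ : B →ₐ[K] Module.End K W)
    (τ : C →ₐ[K] Module.End K Z) (x : (A ⊗[K] B) ⊗[K] C) (t : (V ⊗[K] W) ⊗[K] Z) :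
    TensorProduct.assoc K V W Z (tens (tens ρ σ) τ x t) =
      tens ρ (tens σ τ) (Algebra.TensorProduct.assoc K K K A B C x)
        (TensorProduct.assoc K V W Z t) :=
  LinearMap.congr_fun (tens_assoc ρ σ τ x) t

theorem tens_assoc_symm_apply (ρ : A →ₐ[K] Module.End K V) (σ : B →ₐ[K] Module.End K W)
    (τ : C →ₐ[K] Module.End K Z) (x : (A ⊗[K] B) ⊗[K] C) (t : V ⊗[K] (W ⊗[K] Z)) :
    tens (tens ρ σ) τ x ((TensorProduct.assoc K V W Z).symm t) =
      (TensorProduct.assoc K V W Z).symm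
        (tens ρ (tens σ τ) (Algebra.TensorProduct.assoc K K K A B C x) t) := by
  rw [LinearEquiv.eq_symm_apply, tens_assoc_apply, LinearEquiv.apply_symm_apply]

theorem tens_comm_apply (ρ : A →ₐ[K] Module.End K V) (σ : B →ₐ[K] Module.End K W)
    (x : A ⊗[K] B) (t : V ⊗[K] W) :
    TensorProduct.comm K V W (tens ρ σ x t) =
      tens σ ρ (Algebra.TensorProduct.comm K A B x) (TensorProduct.comm K V W t) :=
  LinearMap.congr_fun (tens_comm ρ σ x) t

theorem tens_leftComm_apply (ρ : A →ₐ[K] Module.End K V) (σ : B →ₐ[K] Module.End K W)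
    (τ : C →ₐ[K] Module.End K Z) (x : A ⊗[K] (B ⊗[K] C)) (t : V ⊗[K] (W ⊗[K] Z)) :
    TensorProduct.leftComm K V W Z (tens ρ (tens σ τ) x t) =
      tens σ (tens ρ τ) (Algebra.TensorProduct.leftComm K A B C x)
        (TensorProduct.leftComm K V W Z t) := by
  induction x with
  | zero => simp
  | add x y hx hy => simp only [map_add, LinearMap.add_apply, hx, hy]
  | tmul a y =>
    induction y with
    | zero => simp
    | add x y hx hy => simp only [TensorProduct.tmul_add, map_add, LinearMap.add_apply, hx, hy]
    | tmul b c =>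
      induction t with
      | zero => simp
      | add x y hx hy => simp only [map_add, hx, hy]
      | tmul v y =>
        induction y with
        | zero => simp
        | add x y hx hy => simp only [TensorProduct.tmul_add, map_add, hx, hy]
        | tmul w z => rfl

theorem tens_mul_apply (ρ : A →ₐ[K] Module.End K V) (σ : B →ₐ[K] Module.End K W)
    (x y : A ⊗[K] B) (t : V ⊗[K] W) : tens ρ σ x (tens ρ σ y t) = tens ρ σ (x * y) t := by
  rw [map_mul]; rfl

theorem map_id_comm_tens (ρ : A →ₐ[K] Module.End K V) (σ : B →ₐ[K] Module.End K W)
    (τ : C →ₐ[K] Module.End K Z) (x : A ⊗[K] (B ⊗[K] C)) (t : V ⊗[K] (W ⊗[K] Z)) :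
    TensorProduct.map LinearMap.id (TensorProduct.comm K W Z).toLinearMap
        (tens ρ (tens σ τ) x t) =
      tens ρ (tens τ σ) (Algebra.TensorProduct.map (AlgHom.id K A)
        (Algebra.TensorProduct.comm K B C).toAlgHom x)
        (TensorProduct.map LinearMap.id (TensorProduct.comm K W Z).toLinearMap t) :=
  LinearMap.congr_fun (map_id_comp_tens ρ (tens σ τ) (tens τ σ)
    (Algebra.TensorProduct.comm K B C).toAlgHom _ (fun a => tens_comm σ τ a) x) t

theorem map_id_assoc_tens {D : Type*} [Ring D] [Algebra K D] {U : Type*} [AddCommGroup U]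
    [Module K U] (π : D →ₐ[K] Module.End K U)
    (ρ : A →ₐ[K] Module.End K V) (σ : B →ₐ[K] Module.End K W)
    (τ : C →ₐ[K] Module.End K Z) (x : D ⊗[K] ((A ⊗[K] B) ⊗[K] C))
    (t : U ⊗[K] ((V ⊗[K] W) ⊗[K] Z)) :
    TensorProduct.map LinearMap.id (TensorProduct.assoc K V W Z).toLinearMap
        (tens π (tens (tens ρ σ) τ) x t) =
      tens π (tens ρ (tens σ τ)) (Algebra.TensorProduct.map (AlgHom.id K D)
        (Algebra.TensorProduct.assoc K K K A B C).toAlgHom x)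
        (TensorProduct.map LinearMap.id (TensorProduct.assoc K V W Z).toLinearMap t) :=
  LinearMap.congr_fun (map_id_comp_tens π (tens (tens ρ σ) τ) (tens ρ (tens σ τ))
    (Algebra.TensorProduct.assoc K K K A B C).toAlgHom _ (fun a => tens_assoc ρ σ τ a) x) t

end Raw

section Str

variable {K : Type*} [Field K] {H : Type*} [Ring H] [Algebra K H]
  {U V W Z : Type*} [AddCommGroup U] [Module K U] [AddCommGroup V] [Module K V]
  [AddCommGroup W] [Module K W] [AddCommGroup Z] [Module K Z]
  (π : H →ₐ[K] Module.End K U) (ρ : H →ₐ[K] Module.End K V) (σ : H →ₐ[K] Module.End K W)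
  (τ : H →ₐ[K] Module.End K Z)

open QuasiBialgebra QuasiTriangularQuasiHopf

section Bialgebra

variable [QuasiBialgebra K H]

/-- The action of `H` on a tensor product of two `H`-modules, via the coproduct. -/
noncomputable def tensorRep : H →ₐ[K] Module.End K (V ⊗[K] W) := (tens ρ σ).comp Δ

/-- The action of `H` on the ground field, via the counit. -/
noncomputable def unitRep (K : Type*) [Field K] (H : Type*) [Ring H] [Algebra K H]
    [QuasiBialgebra K H] : H →ₐ[K] Module.End K K := (Algebra.lmul K K).comp ε

/-- The associator `(u ⊗ v) ⊗ w ↦ Φ (u ⊗ (v ⊗ w))`. -/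
noncomputable def assocHom : (U ⊗[K] V) ⊗[K] W →ₗ[K] U ⊗[K] (V ⊗[K] W) :=
  tens π (tens ρ σ) (Φ (K := K) (H := H)).val ∘ₗ (TensorProduct.assoc K U V W).toLinearMap

/-- The inverse of the associator. -/
noncomputable def assocInv : U ⊗[K] (V ⊗[K] W) →ₗ[K] (U ⊗[K] V) ⊗[K] W :=
  (TensorProduct.assoc K U V W).symm.toLinearMap ∘ₗ
    tens π (tens ρ σ) (Φ (K := K) (H := H))⁻¹.val

theorem assocHom_apply (t : (U ⊗[K] V) ⊗[K] W) : assocHom π ρ σ t =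
    tens π (tens ρ σ) (Φ (K := K) (H := H)).val (TensorProduct.assoc K U V W t) := rfl

theorem assocInv_apply (t : U ⊗[K] (V ⊗[K] W)) : assocInv π ρ σ t =
    (TensorProduct.assoc K U V W).symm (tens π (tens ρ σ) (Φ (K := K) (H := H))⁻¹.val t) := rfl

theorem assocInv_comp : assocInv π ρ σ ∘ₗ assocHom π ρ σ = LinearMap.id :=
  LinearMap.ext fun t => by
    rw [LinearMap.comp_apply, assocInv_apply, assocHom_apply, tens_mul_apply, Units.inv_mul,
      map_one]
    simp

theorem assocHom_comp : assocHom π ρ σ ∘ₗ assocInv π ρ σ = LinearMap.id :=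
  LinearMap.ext fun t => by
    rw [LinearMap.comp_apply, assocInv_apply, assocHom_apply, LinearEquiv.apply_symm_apply,
      tens_mul_apply, Units.mul_inv, map_one]
    simp

theorem assocHom_rep (a : H) (t : (U ⊗[K] V) ⊗[K] W) :
    assocHom π ρ σ (tensorRep (tensorRep π ρ) σ a t) =
      tensorRep π (tensorRep ρ σ) a (assocHom π ρ σ t) := by
  simp only [tensorRep, AlgHom.comp_apply, assocHom_apply, tens_map_left, tens_map_right,
    tens_assoc_apply, tens_mul_apply, quasi_coassoc]

theorem rep_pentagon (t : ((U ⊗[K] V) ⊗[K] W) ⊗[K] Z) :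
    TensorProduct.map LinearMap.id (assocHom ρ σ τ)
      (assocHom π (tensorRep ρ σ) τ (TensorProduct.map (assocHom π ρ σ) LinearMap.id t)) =
    assocHom π ρ (tensorRep σ τ) (assocHom (tensorRep π ρ) σ τ t) := by
  have e1 : ∀ t, TensorProduct.map LinearMap.id (assocHom ρ σ τ) t =
      tens π (tens ρ (tens σ τ)) ((1 : H) ⊗ₜ (Φ (K := K) (H := H)).val)
        (TensorProduct.map (LinearMap.id : U →ₗ[K] U)
          (TensorProduct.assoc K V W Z).toLinearMap t) := fun t => by
    rw [← map_id_tens, ← LinearMap.comp_apply, ← TensorProduct.map_comp]; rfl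
  have e2 : ∀ t, TensorProduct.map (assocHom π ρ σ) LinearMap.id t =
      tens (tens π (tens ρ σ)) τ ((Φ (K := K) (H := H)).val ⊗ₜ (1 : H))
        (TensorProduct.map (TensorProduct.assoc K U V W).toLinearMap
          (LinearMap.id : Z →ₗ[K] Z) t) := fun t => by
    rw [← map_tens_id, ← LinearMap.comp_apply, ← TensorProduct.map_comp]; rfl
  have e3 : ∀ x t, tens π (tens (tensorRep ρ σ) τ) x t = tens π (tens (tens ρ σ) τ)
      (Algebra.TensorProduct.map (AlgHom.id K H) (Algebra.TensorProduct.map Δ (AlgHom.id K H)) x)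
        t := fun x t => by
    rw [← tens_map_right]
    congr 3
    exact AlgHom.ext fun y => tens_map_left _ _ _ _
  have e4 : ∀ x t, tens π (tens ρ (tensorRep σ τ)) x t = tens π (tens ρ (tens σ τ))
      (Algebra.TensorProduct.map (AlgHom.id K H) (Algebra.TensorProduct.map (AlgHom.id K H) Δ) x)
        t := fun x t => by
    rw [← tens_map_right]
    congr 3
    exact AlgHom.ext fun y => tens_map_right _ _ _ _
  have e5 : ∀ x t, tens (tensorRep π ρ) (tens σ τ) x t = tens (tens π ρ) (tens σ τ)
      (Algebra.TensorProduct.map Δ (AlgHom.id K _) x) t := fun x t => by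
    rw [← tens_map_left]; rfl
  rw [e1, e2, assocHom_apply, assocHom_apply π ρ, assocHom_apply (tensorRep π ρ), e3, e4, e5,
    tens_assoc_apply, tens_assoc_apply, map_id_assoc_tens, map_id_assoc_tens, tens_mul_apply,
    tens_mul_apply, tens_mul_apply, QuasiBialgebra.pentagon]
  congr 1
  · congr 2
    congr 1
    rw [← AlgHom.comp_apply, ← Algebra.TensorProduct.map_id_comp]
  · induction t with
    | zero => simp
    | add x y hx hy => simp only [map_add, hx, hy]
    | tmul t z =>
      induction t with
      | zero => simp
      | add x y hx hy => simp only [TensorProduct.add_tmul, map_add, hx, hy]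
      | tmul t w =>
        induction t with
        | zero => simp
        | add x y hx hy => simp only [TensorProduct.add_tmul, map_add, hx, hy]
        | tmul t w => rfl

theorem lid_rep (a : H) (t : K ⊗[K] V) :
    TensorProduct.lid K V (tensorRep (unitRep K H) ρ a t) = ρ a (TensorProduct.lid K V t) := by
  have key : ∀ (x : H ⊗[K] H) t, TensorProduct.lid K V (tens (unitRep K H) ρ x t) =
      ρ (Algebra.TensorProduct.lid K H (Algebra.TensorProduct.map ε (AlgHom.id K H) x))
        (TensorProduct.lid K V t) := fun x t => by
    induction x with
    | zero => simp
    | add x y hx hy => simp only [map_add, LinearMap.add_apply, hx, hy]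
    | tmul a b =>
      induction t with
      | zero => simp
      | add x y hx hy => simp only [map_add, hx, hy]
      | tmul c v => simp [tens_tmul, unitRep, mul_smul, smul_comm c]
  conv_rhs => rw [← counit_left (K := K) a]
  exact key _ t

theorem rid_rep (a : H) (t : V ⊗[K] K) :
    TensorProduct.rid K V (tensorRep ρ (unitRep K H) a t) = ρ a (TensorProduct.rid K V t) := by
  have key : ∀ (x : H ⊗[K] H) t, TensorProduct.rid K V (tens ρ (unitRep K H) x t) =
      ρ (Algebra.TensorProduct.rid K K H (Algebra.TensorProduct.map (AlgHom.id K H) ε x))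
        (TensorProduct.rid K V t) := fun x t => by
    induction x with
    | zero => simp
    | add x y hx hy => simp only [map_add, LinearMap.add_apply, hx, hy]
    | tmul a b =>
      induction t with
      | zero => simp
      | add x y hx hy => simp only [map_add, hx, hy]
      | tmul c v => simp [tens_tmul, unitRep, mul_smul, smul_comm v]
  conv_rhs => rw [← counit_right (K := K) a]
  exact key _ t

theorem rep_triangle (t : (V ⊗[K] K) ⊗[K] W) :
    TensorProduct.map LinearMap.id (TensorProduct.lid K W).toLinearMap
      (assocHom ρ (unitRep K H) σ t) =
    TensorProduct.map (TensorProduct.rid K V).toLinearMap LinearMap.id t := by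
  have key : ∀ (x : H ⊗[K] (H ⊗[K] H)) t,
      TensorProduct.map LinearMap.id (TensorProduct.lid K W).toLinearMap
        (tens ρ (tens (unitRep K H) σ) x t) = tens ρ σ (Algebra.TensorProduct.map (AlgHom.id K H)
          ((Algebra.TensorProduct.lid K H).toAlgHom.comp
            (Algebra.TensorProduct.map ε (AlgHom.id K H))) x)
        (TensorProduct.map LinearMap.id (TensorProduct.lid K W).toLinearMap t) := fun x t => by
    induction x with
    | zero => simp
    | add x y hx hy => simp only [map_add, LinearMap.add_apply, hx, hy]
    | tmul a b =>
      induction b with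
      | zero => simp
      | add x y hx hy => simp only [TensorProduct.tmul_add, map_add, LinearMap.add_apply, hx, hy]
      | tmul b c =>
        induction t with
        | zero => simp
        | add x y hx hy => simp only [map_add, hx, hy]
        | tmul v t =>
          induction t with
          | zero => simp
          | add x y hx hy => simp only [TensorProduct.tmul_add, map_add, hx, hy]
          | tmul d w => simp [tens_tmul, unitRep, mul_smul, smul_comm d]
  rw [assocHom_apply, key, counit_mid, map_one]
  induction t with
  | zero => simp
  | add x y hx hy => simp only [map_add, hx, hy]
  | tmul t w =>
    induction t with
    | zero => simp
    | add x y hx hy => simp only [TensorProduct.add_tmul, map_add, hx, hy]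
    | tmul v k => simp [TensorProduct.smul_tmul']

end Bialgebra

variable [QuasiTriangularQuasiHopf K H]

/-- The braiding `v ⊗ w ↦ τ (R (v ⊗ w))`, with `τ` the flip. -/
noncomputable def braid : V ⊗[K] W →ₗ[K] W ⊗[K] V :=
  (TensorProduct.comm K V W).toLinearMap ∘ₗ tens ρ σ (R (K := K) (H := H)).val

/-- The inverse of the braiding. -/
noncomputable def braidInv : W ⊗[K] V →ₗ[K] V ⊗[K] W :=
  tens ρ σ (R (K := K) (H := H))⁻¹.val ∘ₗ (TensorProduct.comm K W V).toLinearMap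

theorem braid_apply (t : V ⊗[K] W) : braid ρ σ t =
    TensorProduct.comm K V W (tens ρ σ (R (K := K) (H := H)).val t) := rfl

theorem braidInv_apply (t : W ⊗[K] V) : braidInv ρ σ t =
    tens ρ σ (R (K := K) (H := H))⁻¹.val (TensorProduct.comm K W V t) := rfl

theorem comm_comm (t : V ⊗[K] W) :
    TensorProduct.comm K W V (TensorProduct.comm K V W t) = t :=
  (TensorProduct.comm K V W).symm_apply_apply t

theorem braidInv_comp : braidInv ρ σ ∘ₗ braid ρ σ = LinearMap.id :=
  LinearMap.ext fun t => by
    rw [LinearMap.comp_apply, braidInv_apply, braid_apply, comm_comm, tens_mul_apply,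
      Units.inv_mul, map_one]
    simp

theorem braid_comp : braid ρ σ ∘ₗ braidInv ρ σ = LinearMap.id :=
  LinearMap.ext fun t => by
    rw [LinearMap.comp_apply, braidInv_apply, braid_apply, tens_mul_apply,
      Units.mul_inv, map_one]
    exact comm_comm t

theorem braid_rep (a : H) (t : V ⊗[K] W) :
    braid ρ σ (tensorRep ρ σ a t) = tensorRep σ ρ a (braid ρ σ t) := by
  simp only [tensorRep, AlgHom.comp_apply, braid_apply, tens_mul_apply]
  rw [← R_comm, ← tens_mul_apply, tens_comm_apply]
  congr 2
  exact (Algebra.TensorProduct.comm K H H).symm_apply_apply (Δ a)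

theorem leftComm_leftComm (x : H ⊗[K] (H ⊗[K] H)) :
    Algebra.TensorProduct.leftComm K H H H (Algebra.TensorProduct.leftComm K H H H x) = x := by
  induction x with
  | zero => simp
  | add x y hx hy => simp only [map_add, hx, hy]
  | tmul a b =>
    induction b with
    | zero => simp
    | add x y hx hy => simp only [TensorProduct.tmul_add, map_add, hx, hy]
    | tmul b c => rfl

theorem map_comm_comm (x : H ⊗[K] (H ⊗[K] H)) :
    Algebra.TensorProduct.map (AlgHom.id K H) (Algebra.TensorProduct.comm K H H).toAlgHom
      (Algebra.TensorProduct.map (AlgHom.id K H) (Algebra.TensorProduct.comm K H H).toAlgHom x) =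
    x := by
  induction x with
  | zero => simp
  | add x y hx hy => simp only [map_add, hx, hy]
  | tmul a b =>
    induction b with
    | zero => simp
    | add x y hx hy => simp only [TensorProduct.tmul_add, map_add, hx, hy]
    | tmul b c => rfl

theorem map_comm_leftComm (x : H ⊗[K] H) :
    Algebra.TensorProduct.map (AlgHom.id K H) (Algebra.TensorProduct.comm K H H).toAlgHom
      (Algebra.TensorProduct.leftComm K H H H ((1 : H) ⊗ₜ x)) =
    Algebra.TensorProduct.assoc K K K H H H (x ⊗ₜ (1 : H)) := by
  induction x with
  | zero => simp
  | add x y hx hy =>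
    simp only [TensorProduct.tmul_add, TensorProduct.add_tmul, map_add, hx, hy]
  | tmul a b => rfl

theorem map_id_braid (t : U ⊗[K] (V ⊗[K] W)) :
    TensorProduct.map LinearMap.id (braid ρ σ) t =
      TensorProduct.map LinearMap.id (TensorProduct.comm K V W).toLinearMap
        (tens π (tens ρ σ) ((1 : H) ⊗ₜ (R (K := K) (H := H)).val) t) := by
  rw [← map_id_tens, ← LinearMap.comp_apply, ← TensorProduct.map_comp]; rfl

theorem map_braid_id (t : (U ⊗[K] V) ⊗[K] W) :
    TensorProduct.map (braid π ρ) LinearMap.id t =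
      TensorProduct.map (TensorProduct.comm K U V).toLinearMap LinearMap.id
        (tens (tens π ρ) σ ((R (K := K) (H := H)).val ⊗ₜ (1 : H)) t) := by
  rw [← map_tens_id, ← LinearMap.comp_apply, ← TensorProduct.map_comp]; rfl

theorem assoc_comm (t : U ⊗[K] (V ⊗[K] W)) :
    TensorProduct.assoc K V W U (TensorProduct.comm K U (V ⊗[K] W) t) =
      TensorProduct.map LinearMap.id (TensorProduct.comm K U W).toLinearMap
        (TensorProduct.leftComm K U V W t) := by
  induction t with
  | zero => simp
  | add x y hx hy => simp only [map_add, hx, hy]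
  | tmul a b =>
    induction b with
    | zero => simp
    | add x y hx hy => simp only [TensorProduct.tmul_add, map_add, hx, hy]
    | tmul b c => rfl

theorem comm_assoc_symm (t : U ⊗[K] (V ⊗[K] W)) :
    TensorProduct.comm K (U ⊗[K] V) W ((TensorProduct.assoc K U V W).symm t) =
      TensorProduct.leftComm K U W V
        (TensorProduct.map LinearMap.id (TensorProduct.comm K V W).toLinearMap t) := by
  induction t with
  | zero => simp
  | add x y hx hy => simp only [map_add, hx, hy]
  | tmul a b =>
    induction b with
    | zero => simp
    | add x y hx hy => simp only [TensorProduct.tmul_add, map_add, hx, hy]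
    | tmul b c => rfl

theorem assoc_map_comm (t : (U ⊗[K] V) ⊗[K] W) :
    TensorProduct.assoc K V U W
        (TensorProduct.map (TensorProduct.comm K U V).toLinearMap LinearMap.id t) =
      TensorProduct.leftComm K U V W (TensorProduct.assoc K U V W t) := by
  induction t with
  | zero => simp
  | add x y hx hy => simp only [map_add, hx, hy]
  | tmul a b =>
    induction a with
    | zero => simp
    | add x y hx hy => simp only [TensorProduct.add_tmul, map_add, hx, hy]
    | tmul b c => rfl

theorem rep_hexagon_forward (t : (U ⊗[K] V) ⊗[K] W) :
    assocHom ρ σ π (braid π (tensorRep ρ σ) (assocHom π ρ σ t)) =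
      TensorProduct.map LinearMap.id (braid π σ)
        (assocHom ρ π σ (TensorProduct.map (braid π ρ) LinearMap.id t)) := by
  rw [assocHom_apply, braid_apply, tensorRep, tens_map_right, assocHom_apply, assoc_comm,
    tens_mul_apply, tens_leftComm_apply, map_id_comm_tens, tens_mul_apply,
    map_id_braid ρ, map_braid_id π ρ σ, assocHom_apply, assoc_map_comm, tens_assoc_apply,
    tens_leftComm_apply, tens_mul_apply, tens_mul_apply, map_id_comm_tens, hexagon₂]
  congr 2
  simp only [map_mul, leftComm_leftComm, map_comm_comm]
  simp only [mul_assoc]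
  have h := Units.inv_mul (Φ (K := K) (H := H))
  rw [Units.mul_inv_cancel_left]
  congr 2
  simp only [← map_mul, h, map_one, mul_one]

theorem rep_hexagon_reverse (t : U ⊗[K] (V ⊗[K] W)) :
    assocInv σ π ρ (braid (tensorRep π ρ) σ (assocInv π ρ σ t)) =
      TensorProduct.map (braid π σ) LinearMap.id
        (assocInv π σ ρ (TensorProduct.map LinearMap.id (braid ρ σ) t)) := by
  rw [assocInv_apply σ, LinearEquiv.symm_apply_eq, map_braid_id π σ ρ, assoc_map_comm,
    tens_assoc_apply, assocInv_apply π σ, LinearEquiv.apply_symm_apply, map_id_braid π,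
    braid_apply, tensorRep, tens_map_left, assocInv_apply, tens_assoc_symm_apply,
    comm_assoc_symm, tens_mul_apply, map_id_comm_tens, tens_leftComm_apply, tens_mul_apply,
    map_id_comm_tens, tens_mul_apply, tens_mul_apply, tens_leftComm_apply, hexagon₁]
  congr 2
  simp only [map_mul, leftComm_leftComm, map_comm_comm, map_comm_leftComm]
  simp only [mul_assoc]
  have h := Units.mul_inv (Φ (K := K) (H := H))
  rw [Units.inv_mul_cancel_left]
  congr 2
  simp only [← map_mul, h, map_one, mul_one]

end Str

end QuasiHopf

/-- Finite dimensional (left) modules over the `K`-algebra `H`. -/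
structure QHMod (K : Type u) [Field K] (H : Type w) [Ring H] [Algebra K H] where
  carrier : Type u
  [addCommGroup : AddCommGroup carrier]
  [module : Module K carrier]
  [finite : FiniteDimensional K carrier]
  /-- the action of `H` -/
  ρ : H →ₐ[K] Module.End K carrier

namespace QHMod

open QuasiHopf

attribute [instance] addCommGroup module finite

section

variable {K : Type u} [Field K] {H : Type w} [Ring H] [Algebra K H]

/-- `H`-linear maps. -/
def homs (V W : QHMod K H) : Submodule K (V.carrier →ₗ[K] W.carrier) where
  carrier := {f | ∀ a v, f (V.ρ a v) = W.ρ a (f v)}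
  add_mem' hf hg x v := by
    simp only [Set.mem_ofPred_eq] at hf hg
    simp [hf x v, hg x v]
  zero_mem' x v := by simp
  smul_mem' a f hf x v := by
    simp only [Set.mem_ofPred_eq] at hf
    simp [hf x v]

instance : Category (QHMod K H) where
  Hom V W := homs V W
  id V := ⟨LinearMap.id, fun _ _ => rfl⟩
  comp f g := ⟨g.1 ∘ₗ f.1, fun x v => by
    rw [LinearMap.comp_apply, f.2, g.2]; rfl⟩

/-- The linear map underlying a morphism. -/
def lin {V W : QHMod K H} (f : V ⟶ W) : V.carrier →ₗ[K] W.carrier := Subtype.val f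

theorem hom_ext {V W : QHMod K H} {f g : V ⟶ W} (h : lin f = lin g) : f = g :=
  Subtype.ext h

theorem lin_ρ {V W : QHMod K H} (f : V ⟶ W) (a : H) (v : V.carrier) :
    lin f (V.ρ a v) = W.ρ a (lin f v) := f.2 a v

instance : Preadditive (QHMod K H) where
  homGroup V W := inferInstanceAs (AddCommGroup (homs V W))
  add_comp _ _ _ f f' g := hom_ext (LinearMap.comp_add (lin f) (lin f') (lin g))
  comp_add _ _ _ f g g' := hom_ext (LinearMap.add_comp (lin f) (lin g') (lin g))

instance : Linear K (QHMod K H) where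
  homModule V W := inferInstanceAs (Module K (homs V W))
  smul_comp _ _ _ a f g := hom_ext (LinearMap.comp_smul (lin g) a (lin f))
  comp_smul _ _ _ f a g := hom_ext (LinearMap.smul_comp a (lin g) (lin f))

/-- Mutually inverse `H`-linear maps as an isomorphism. -/
def mkIso {V W : QHMod K H} (f : V ⟶ W) (g : W.carrier →ₗ[K] V.carrier)
    (h₁ : g ∘ₗ lin f = LinearMap.id) (h₂ : lin f ∘ₗ g = LinearMap.id) : V ≅ W where
  hom := f
  inv := ⟨g, fun x w => by
    have h1 : ∀ v, g (lin f v) = v := LinearMap.congr_fun h₁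
    have h2 : ∀ w, lin f (g w) = w := LinearMap.congr_fun h₂
    rw [← h1 (V.ρ x (g w)), lin_ρ, h2]⟩
  hom_inv_id := hom_ext h₁
  inv_hom_id := hom_ext h₂

end

section

variable {K : Type u} [Field K] {H : Type w} [Ring H] [Algebra K H] [QuasiBialgebra K H]

/-- The tensor product of two modules: `H` acts via `Δ`. -/
noncomputable def tensorObj (V W : QHMod K H) : QHMod K H where
  carrier := V.carrier ⊗[K] W.carrier
  ρ := tensorRep V.ρ W.ρ

variable (K H) in
/-- The trivial module: the ground field, on which `H` acts via `ε`. -/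
noncomputable def unit : QHMod K H where
  carrier := K
  ρ := unitRep K H

theorem map_tens_of_hom {V V' W W' : QHMod K H} (f : V ⟶ V') (g : W ⟶ W') (x : H ⊗[K] H)
    (t : V.carrier ⊗[K] W.carrier) :
    TensorProduct.map (lin f) (lin g) (tens V.ρ W.ρ x t) =
      tens V'.ρ W'.ρ x (TensorProduct.map (lin f) (lin g) t) := by
  induction x with
  | zero => simp
  | add x y hx hy => simp only [map_add, LinearMap.add_apply, hx, hy]
  | tmul a b =>
    induction t with
    | zero => simp
    | add x y hx hy => simp only [map_add, hx, hy]
    | tmul v w => simp [tens_tmul, lin_ρ]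

theorem map_tens₃_of_hom {U U' V V' W W' : QHMod K H} (e : U ⟶ U') (f : V ⟶ V') (g : W ⟶ W')
    (x : H ⊗[K] (H ⊗[K] H)) (t : U.carrier ⊗[K] (V.carrier ⊗[K] W.carrier)) :
    TensorProduct.map (lin e) (TensorProduct.map (lin f) (lin g)) (tens U.ρ (tens V.ρ W.ρ) x t) =
      tens U'.ρ (tens V'.ρ W'.ρ) x
        (TensorProduct.map (lin e) (TensorProduct.map (lin f) (lin g)) t) := by
  induction x with
  | zero => simp
  | add x y hx hy => simp only [map_add, LinearMap.add_apply, hx, hy]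
  | tmul a b =>
    induction t with
    | zero => simp
    | add x y hx hy => simp only [map_add, hx, hy]
    | tmul v w => simp [tens_tmul, lin_ρ, map_tens_of_hom f g]

theorem assocHom_natural {U U' V V' W W' : QHMod K H} (e : U ⟶ U') (f : V ⟶ V') (g : W ⟶ W') :
    assocHom U'.ρ V'.ρ W'.ρ ∘ₗ
        TensorProduct.map (TensorProduct.map (lin e) (lin f)) (lin g) =
      TensorProduct.map (lin e) (TensorProduct.map (lin f) (lin g)) ∘ₗ
        assocHom U.ρ V.ρ W.ρ :=
  LinearMap.ext fun t => by
    rw [LinearMap.comp_apply, LinearMap.comp_apply, assocHom_apply, assocHom_apply,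
      map_tens₃_of_hom]
    congr 1
    induction t with
    | zero => simp
    | add x y hx hy => simp only [map_add, hx, hy]
    | tmul t z =>
      induction t with
      | zero => simp
      | add x y hx hy => simp only [TensorProduct.add_tmul, map_add, hx, hy]
      | tmul t w => rfl

/-- The tensor product of morphisms. -/
noncomputable def tensorHom {V V' W W' : QHMod K H} (f : V ⟶ V') (g : W ⟶ W') :
    tensorObj V W ⟶ tensorObj V' W' :=
  ⟨TensorProduct.map (lin f) (lin g), fun _ => map_tens_of_hom f g _⟩

/-- The tensor category of modules over a quasi-bialgebra: the associator is given by the action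
of `Φ`. -/
noncomputable instance : MonoidalCategoryStruct (QHMod K H) where
  tensorObj := tensorObj
  tensorHom := tensorHom
  whiskerLeft V _ _ f := tensorHom (𝟙 V) f
  whiskerRight f V := tensorHom f (𝟙 V)
  tensorUnit := unit K H
  associator U V W :=
    mkIso (V := tensorObj (tensorObj U V) W) (W := tensorObj U (tensorObj V W))
      ⟨assocHom U.ρ V.ρ W.ρ, assocHom_rep U.ρ V.ρ W.ρ⟩ (assocInv U.ρ V.ρ W.ρ)
      (assocInv_comp U.ρ V.ρ W.ρ) (assocHom_comp U.ρ V.ρ W.ρ)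
  leftUnitor V := mkIso (V := tensorObj (unit K H) V)
    ⟨(TensorProduct.lid K V.carrier).toLinearMap, lid_rep V.ρ⟩
    (TensorProduct.lid K V.carrier).symm.toLinearMap
    (TensorProduct.lid K V.carrier).symm_comp (TensorProduct.lid K V.carrier).comp_symm
  rightUnitor V := mkIso (V := tensorObj V (unit K H))
    ⟨(TensorProduct.rid K V.carrier).toLinearMap, rid_rep V.ρ⟩
    (TensorProduct.rid K V.carrier).symm.toLinearMap
    (TensorProduct.rid K V.carrier).symm_comp (TensorProduct.rid K V.carrier).comp_symm

noncomputable instance : MonoidalCategory (QHMod K H) :=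
  MonoidalCategory.ofTensorHom
    (id_tensorHom_id := fun _ _ => hom_ext TensorProduct.map_id)
    (id_tensorHom := fun _ _ _ _ => rfl)
    (tensorHom_id := fun _ _ => rfl)
    (tensorHom_comp_tensorHom := fun f₁ f₂ g₁ g₂ =>
      hom_ext (TensorProduct.map_comp (lin g₁) (lin g₂) (lin f₁) (lin f₂)).symm)
    (associator_naturality := fun f g h => hom_ext <| assocHom_natural f g h)
    (leftUnitor_naturality := fun f => hom_ext <|
      TensorProduct.ext' fun (a : K) v => ((lin f).map_smul a v).symm)
    (rightUnitor_naturality := fun f => hom_ext <|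
      TensorProduct.ext' fun v (a : K) => ((lin f).map_smul a v).symm)
    (pentagon := fun S U V W => hom_ext <| LinearMap.ext <| rep_pentagon S.ρ U.ρ V.ρ W.ρ)
    (triangle := fun V W => hom_ext <| LinearMap.ext <| rep_triangle V.ρ W.ρ)

instance : MonoidalPreadditive (QHMod K H) where
  whiskerLeft_zero := hom_ext (TensorProduct.map_zero_right _)
  zero_whiskerRight := hom_ext (TensorProduct.map_zero_left _)
  whiskerLeft_add f g := hom_ext (TensorProduct.map_add_right _ (lin f) (lin g))
  add_whiskerRight f g := hom_ext (TensorProduct.map_add_left (lin f) (lin g) _)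

instance : MonoidalLinear K (QHMod K H) where
  whiskerLeft_smul _ _ _ r f := hom_ext (TensorProduct.map_smul_right r _ (lin f))
  smul_whiskerRight r _ _ f _ := hom_ext (TensorProduct.map_smul_left r (lin f) _)

end

variable {K : Type u} [Field K] {H : Type w} [Ring H] [Algebra K H]
  [QuasiTriangularQuasiHopf K H]

theorem braid_natural {V V' W W' : QHMod K H} (f : V ⟶ V') (g : W ⟶ W') :
    braid V'.ρ W'.ρ ∘ₗ TensorProduct.map (lin f) (lin g) =
      TensorProduct.map (lin g) (lin f) ∘ₗ braid V.ρ W.ρ :=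
  LinearMap.ext fun t => by
    rw [LinearMap.comp_apply, LinearMap.comp_apply, braid_apply, braid_apply,
      ← map_tens_of_hom f g]
    generalize tens V.ρ W.ρ _ t = t
    induction t with
    | zero => simp
    | add x y hx hy => simp only [map_add, hx, hy]
    | tmul t z => rfl

/-- The braiding of `H`-modules is given by the action of `R`, followed by the flip. -/
noncomputable instance : BraidedCategory (QHMod K H) where
  braiding V W := mkIso (V := tensorObj V W) (W := tensorObj W V)
    ⟨braid V.ρ W.ρ, braid_rep V.ρ W.ρ⟩ (braidInv V.ρ W.ρ) (braidInv_comp V.ρ W.ρ)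
    (braid_comp V.ρ W.ρ)
  braiding_naturality_right U _ _ f := hom_ext <| braid_natural (𝟙 U) f
  braiding_naturality_left f W := hom_ext <| braid_natural f (𝟙 W)
  hexagon_forward U V W := hom_ext <| LinearMap.ext <| rep_hexagon_forward U.ρ V.ρ W.ρ
  hexagon_reverse U V W := hom_ext <| LinearMap.ext <| rep_hexagon_reverse U.ρ V.ρ W.ρ

end QHMod

/-! ### The quasi-triangular quasi-Hopf algebra `H(ξ)` -/

section QHAlg

variable {K : Type u} [Field K] {X : Type v} {G : Type w} [Group X] [Group G]
  [MulDistribMulAction G X] {M : CrossedModule X G}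

/-- The vector space `H(ξ)` with basis `t_x g`, for `(x, g) ∈ X × G`. -/
def QHAlg (_ξ : NormalizedCocycle K M) := (X × G) →₀ K

namespace QHAlg

variable {ξ : NormalizedCocycle K M}

section Construction

@[reducible] noncomputable def addCommGroup : AddCommGroup (QHAlg ξ) :=
  inferInstanceAs (AddCommGroup ((X × G) →₀ K))

attribute [local instance] addCommGroup

@[reducible] noncomputable def module : Module K (QHAlg ξ) :=
  inferInstanceAs (Module K ((X × G) →₀ K))

attribute [local instance] module

variable (ξ) in
/-- The basis vector `t_x g`. -/
noncomputable def t (x : X) (g : G) : QHAlg ξ := Finsupp.single (x, g) (1 : K)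

/-- The linear map with prescribed values on the basis. -/
noncomputable def liftAux {P : Type*} [AddCommGroup P] [Module K P] (f : X → G → P) :
    QHAlg ξ →ₗ[K] P :=
  Finsupp.linearCombination K fun p : X × G => f p.1 p.2

@[simp] theorem liftAux_t {P : Type*} [AddCommGroup P] [Module K P] (f : X → G → P) (x : X)
    (g : G) : liftAux f (t ξ x g) = f x g :=
  (Finsupp.linearCombination_single K (1 : K) (x, g)).trans (one_smul K _)

theorem induction_aux {p : QHAlg ξ → Prop} (zero : p 0) (add : ∀ a b, p a → p b → p (a + b))
    (smul : ∀ (k : K) a, p a → p (k • a)) (single : ∀ x g, p (t ξ x g)) (a : QHAlg ξ) : p a := by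
  refine Finsupp.induction_linear (motive := p) a zero (fun a b => add a b) fun q k => ?_
  have : Finsupp.single q k = k • t ξ q.1 q.2 :=
    (Finsupp.smul_single_one q k).symm
  rw [this]
  exact smul k _ (single _ _)

variable [Fintype X] [DecidableEq X]

/-- The product `(t_x g) (t_y h) = δ_{x, h • y} γ_{g,h}(y)⁻¹ t_y (gh)`, as a bilinear map. -/
noncomputable def mulHom : QHAlg ξ →ₗ[K] QHAlg ξ →ₗ[K] QHAlg ξ :=
  liftAux fun x g => liftAux fun y h =>
    if x = h • y then (((ξ.γ g h y)⁻¹ : Kˣ) : K) • t ξ y (g * h) else 0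

noncomputable instance : Mul (QHAlg ξ) := ⟨fun a b => mulHom a b⟩

noncomputable instance : One (QHAlg ξ) := ⟨∑ x, t ξ x 1⟩

theorem mul_def (a b : QHAlg ξ) : a * b = mulHom a b := rfl

theorem t_mul_t_aux (x y : X) (g h : G) : t ξ x g * t ξ y h =
    if x = h • y then (((ξ.γ g h y)⁻¹ : Kˣ) : K) • t ξ y (g * h) else 0 := by
  simp [mul_def, mulHom]

theorem one_mul_aux (a : QHAlg ξ) : 1 * a = a := by
  simp only [mul_def]
  induction a using induction_aux with
  | zero => simp only [map_zero]
  | add a b ha hb => rw [map_add, ha, hb]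
  | smul k a ha => rw [map_smul, ha]
  | single x g =>
    rw [show (1 : QHAlg ξ) = ∑ x, t ξ x 1 from rfl, map_sum, LinearMap.sum_apply]
    simp [← mul_def, t_mul_t_aux, ξ.γ_one₁]

theorem mul_one_aux (a : QHAlg ξ) : a * 1 = a := by
  simp only [mul_def]
  induction a using induction_aux with
  | zero => simp only [map_zero, LinearMap.zero_apply]
  | add a b ha hb => rw [map_add, LinearMap.add_apply, ha, hb]
  | smul k a ha => rw [map_smul, LinearMap.smul_apply, ha]
  | single x g =>
    rw [show (1 : QHAlg ξ) = ∑ x, t ξ x 1 from rfl, map_sum]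
    simp [← mul_def, t_mul_t_aux, ξ.γ_one₂]

theorem mul_assoc_aux (a b c : QHAlg ξ) : a * b * c = a * (b * c) := by
  simp only [mul_def]
  induction a using induction_aux with
  | zero => simp
  | add a a' h h' => simp only [map_add, LinearMap.add_apply, h, h']
  | smul k a h => simp only [map_smul, LinearMap.smul_apply, h]
  | single x g =>
  induction b using induction_aux with
  | zero => simp
  | add a a' h h' => simp only [map_add, LinearMap.add_apply, h, h']
  | smul k a h => simp only [map_smul, LinearMap.smul_apply, h]
  | single y h =>
  induction c using induction_aux with
  | zero => simp
  | add a a' h h' => simp only [map_add, h, h']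
  | smul k a h => simp only [map_smul, h]
  | single z k =>
  simp only [← mul_def, t_mul_t_aux]
  by_cases hy : y = k • z
  · subst hy
    by_cases hx : x = h • k • z
    · subst hx
      rw [if_pos rfl, if_pos rfl, mul_def, mul_def, map_smul, map_smul, LinearMap.smul_apply,
        ← mul_def, ← mul_def, t_mul_t_aux, t_mul_t_aux, if_pos rfl, if_pos (smul_smul h k z),
        smul_smul, smul_smul, mul_assoc g h k, ← Units.val_mul, ← Units.val_mul, ← mul_inv,
        ← mul_inv, ξ.γ_cocycle, mul_comm (ξ.γ g h _)]
    · rw [if_neg hx, if_pos rfl, mul_def, mul_def, map_smul, map_zero, LinearMap.zero_apply,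
        ← mul_def, t_mul_t_aux, if_neg (by rwa [mul_smul]), smul_zero]
  · rw [if_neg hy, mul_def, mul_def, map_zero]
    split_ifs
    · rw [map_smul, LinearMap.smul_apply, ← mul_def, t_mul_t_aux, if_neg hy, smul_zero]
    · simp

noncomputable instance : Ring (QHAlg ξ) :=
  { (inferInstance : AddCommGroup (QHAlg ξ)), (inferInstance : Mul (QHAlg ξ)),
    (inferInstance : One (QHAlg ξ)) with
    one_mul := one_mul_aux
    mul_one := mul_one_aux
    mul_assoc := mul_assoc_aux
    zero_mul := fun a => LinearMap.congr_fun (map_zero mulHom) a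
    mul_zero := fun a => map_zero (mulHom a)
    left_distrib := fun a b c => map_add (mulHom a) b c
    right_distrib := fun a b c => LinearMap.congr_fun (map_add mulHom a b) c }

noncomputable instance : Algebra K (QHAlg ξ) :=
  Algebra.ofModule (fun k a b => LinearMap.congr_fun (map_smul mulHom k a) b)
    (fun k a b => map_smul (mulHom a) k b)

theorem finite_aux [Finite G] : Module.Finite K (QHAlg ξ) :=
  inferInstanceAs (Module.Finite K ((X × G) →₀ K))

end Construction

variable [Fintype X] [DecidableEq X]

theorem t_mul_t (x y : X) (g h : G) : t ξ x g * t ξ y h =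
    if x = h • y then (((ξ.γ g h y)⁻¹ : Kˣ) : K) • t ξ y (g * h) else 0 :=
  t_mul_t_aux x y g h

theorem one_def : (1 : QHAlg ξ) = ∑ x, t ξ x 1 := rfl

theorem induction {p : QHAlg ξ → Prop} (zero : p 0) (add : ∀ a b, p a → p b → p (a + b))
    (smul : ∀ (k : K) a, p a → p (k • a)) (single : ∀ x g, p (t ξ x g)) (a : QHAlg ξ) : p a :=
  induction_aux zero add smul single a

/-- The linear map with prescribed values on the basis. -/
noncomputable def lift {P : Type*} [AddCommGroup P] [Module K P] (f : X → G → P) :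
    QHAlg ξ →ₗ[K] P := liftAux f

@[simp] theorem lift_t {P : Type*} [AddCommGroup P] [Module K P] (f : X → G → P) (x : X)
    (g : G) : lift f (t ξ x g) = f x g := liftAux_t f x g

theorem finite [Finite G] : Module.Finite K (QHAlg ξ) := finite_aux

variable (ξ) in
/-- The element `∑ f(x,y) (t_x g) ⊗ (t_y h)`, where `g`, `h` may depend on `x`, `y`. -/
noncomputable def E₂ (f : X → X → K) (g h : X → X → G) : QHAlg ξ ⊗[K] QHAlg ξ :=
  ∑ x, ∑ y, f x y • (t ξ x (g x y) ⊗ₜ[K] t ξ y (h x y))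

variable (ξ) in
/-- The element `∑ f(x,y,z) (t_x g) ⊗ (t_y h) ⊗ (t_z k)`, where `g`, `h` and `k` may depend on
`x`, `y`, `z`. -/
noncomputable def E₃ (f : X → X → X → K) (g h k : X → X → X → G) :
    QHAlg ξ ⊗[K] (QHAlg ξ ⊗[K] QHAlg ξ) :=
  ∑ x, ∑ y, ∑ z, f x y z • (t ξ x (g x y z) ⊗ₜ[K] (t ξ y (h x y z) ⊗ₜ[K] t ξ z (k x y z)))

variable (ξ) in
/-- The element `∑ f(x,y,z,w) (t_x 1) ⊗ (t_y 1) ⊗ (t_z 1) ⊗ (t_w 1)`. -/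
noncomputable def E₄ (f : X → X → X → X → K) :
    QHAlg ξ ⊗[K] (QHAlg ξ ⊗[K] (QHAlg ξ ⊗[K] QHAlg ξ)) :=
  ∑ x, t ξ x 1 ⊗ₜ[K] E₃ ξ (f x) (fun _ _ _ => 1) (fun _ _ _ => 1) (fun _ _ _ => 1)

theorem E₂_mul (f f' : X → X → K) (g h g' h' : X → X → G) :
    E₂ ξ f g h * E₂ ξ f' g' h' = E₂ ξ
      (fun x y => f (g' x y • x) (h' x y • y) * f' x y *
        (((ξ.γ (g (g' x y • x) (h' x y • y)) (g' x y) x)⁻¹ *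
          (ξ.γ (h (g' x y • x) (h' x y • y)) (h' x y) y)⁻¹ : Kˣ) : K))
      (fun x y => g (g' x y • x) (h' x y • y) * g' x y)
      (fun x y => h (g' x y • x) (h' x y • y) * h' x y) := by
  simp only [E₂, Finset.mul_sum]
  refine Finset.sum_congr rfl fun x _ => Finset.sum_congr rfl fun y _ => ?_
  simp only [Finset.sum_mul]
  rw [Finset.sum_eq_single (g' x y • x), Finset.sum_eq_single (h' x y • y)]
  · simp only [smul_mul_smul_comm, Algebra.TensorProduct.tmul_mul_tmul, t_mul_t, if_true,
      TensorProduct.smul_tmul_smul, smul_smul, Units.val_mul]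
  · intro b _ hb
    simp only [smul_mul_smul_comm, Algebra.TensorProduct.tmul_mul_tmul, t_mul_t, if_neg hb,
      TensorProduct.tmul_zero, smul_zero]
  · simp
  · intro b _ hb
    simp only [smul_mul_smul_comm, Algebra.TensorProduct.tmul_mul_tmul, t_mul_t, if_neg hb,
      TensorProduct.zero_tmul, smul_zero, Finset.sum_const_zero]
  · simp

theorem E₃_mul (f f' : X → X → X → K) (g h k g' h' k' : X → X → X → G) :
    E₃ ξ f g h k * E₃ ξ f' g' h' k' = E₃ ξ
      (fun x y z => f (g' x y z • x) (h' x y z • y) (k' x y z • z) * f' x y z *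
        (((ξ.γ (g (g' x y z • x) (h' x y z • y) (k' x y z • z)) (g' x y z) x)⁻¹ *
          ((ξ.γ (h (g' x y z • x) (h' x y z • y) (k' x y z • z)) (h' x y z) y)⁻¹ *
          (ξ.γ (k (g' x y z • x) (h' x y z • y) (k' x y z • z)) (k' x y z) z)⁻¹) : Kˣ) : K))
      (fun x y z => g (g' x y z • x) (h' x y z • y) (k' x y z • z) * g' x y z)
      (fun x y z => h (g' x y z • x) (h' x y z • y) (k' x y z • z) * h' x y z)
      (fun x y z => k (g' x y z • x) (h' x y z • y) (k' x y z • z) * k' x y z) := by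
  simp only [E₃, Finset.mul_sum]
  refine Finset.sum_congr rfl fun x _ => Finset.sum_congr rfl fun y _ =>
    Finset.sum_congr rfl fun z _ => ?_
  simp only [Finset.sum_mul]
  rw [Finset.sum_eq_single (g' x y z • x), Finset.sum_eq_single (h' x y z • y),
    Finset.sum_eq_single (k' x y z • z)]
  · simp only [smul_mul_smul_comm, Algebra.TensorProduct.tmul_mul_tmul, t_mul_t, if_true,
      TensorProduct.smul_tmul_smul, smul_smul, Units.val_mul]
  · intro b _ hb
    simp only [smul_mul_smul_comm, Algebra.TensorProduct.tmul_mul_tmul, t_mul_t, if_neg hb,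
      TensorProduct.tmul_zero, smul_zero]
  · simp
  · intro b _ hb
    simp only [smul_mul_smul_comm, Algebra.TensorProduct.tmul_mul_tmul, t_mul_t, if_neg hb,
      TensorProduct.zero_tmul, TensorProduct.tmul_zero, smul_zero, Finset.sum_const_zero]
  · simp
  · intro b _ hb
    simp only [smul_mul_smul_comm, Algebra.TensorProduct.tmul_mul_tmul, t_mul_t, if_neg hb,
      TensorProduct.zero_tmul, smul_zero, Finset.sum_const_zero]
  · simp

theorem orthogonal_mul {H A : Type*} [Ring H] [Algebra K H] [Ring A] [Algebra K A] {e : X → H}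
    (he : ∀ x y, e x * e y = if x = y then e y else 0) (f f' : X → A) :
    (∑ x, e x ⊗ₜ[K] f x) * (∑ x, e x ⊗ₜ[K] f' x) = ∑ x, e x ⊗ₜ[K] (f x * f' x) := by
  simp only [Finset.mul_sum]
  refine Finset.sum_congr rfl fun x _ => ?_
  simp only [Finset.sum_mul]
  rw [Finset.sum_eq_single x]
  · simp only [Algebra.TensorProduct.tmul_mul_tmul, he, if_true]
  · intro b _ hb
    simp only [Algebra.TensorProduct.tmul_mul_tmul, he, if_neg hb, TensorProduct.zero_tmul]
  · simp

theorem E₄_mul (f f' : X → X → X → X → K) :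
    E₄ ξ f * E₄ ξ f' = E₄ ξ fun x y z w => f x y z w * f' x y z w := by
  refine (orthogonal_mul (fun x y => by
    rw [t_mul_t, one_smul, ξ.γ_one₁, inv_one, Units.val_one, one_smul, mul_one]) _ _).trans ?_
  simp only [E₃_mul, one_smul, ξ.γ_one₁, inv_one, Units.val_one, mul_one]
  rfl

theorem one₂ : (1 : QHAlg ξ ⊗[K] QHAlg ξ) = E₂ ξ (fun _ _ => 1) (fun _ _ => 1) fun _ _ => 1 := by
  rw [Algebra.TensorProduct.one_def, one_def, TensorProduct.sum_tmul]
  simp only [TensorProduct.tmul_sum, E₂, one_smul]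

theorem one₃ : (1 : QHAlg ξ ⊗[K] (QHAlg ξ ⊗[K] QHAlg ξ)) =
    E₃ ξ (fun _ _ _ => 1) (fun _ _ _ => 1) (fun _ _ _ => 1) fun _ _ _ => 1 := by
  rw [Algebra.TensorProduct.one_def, one₂, one_def, TensorProduct.sum_tmul]
  simp only [TensorProduct.tmul_sum, E₂, E₃, one_smul]

theorem E₂_congr {f f' : X → X → K} {g h g' h' : X → X → G} (h₁ : ∀ x y, f x y = f' x y)
    (h₂ : ∀ x y, g x y = g' x y) (h₃ : ∀ x y, h x y = h' x y) :
    E₂ ξ f g h = E₂ ξ f' g' h' := by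
  rw [funext₂ h₁, funext₂ h₂, funext₂ h₃]

theorem E₃_congr {f f' : X → X → X → K} {g h k g' h' k' : X → X → X → G}
    (h₁ : ∀ x y z, f x y z = f' x y z) (h₂ : ∀ x y z, g x y z = g' x y z)
    (h₃ : ∀ x y z, h x y z = h' x y z) (h₄ : ∀ x y z, k x y z = k' x y z) :
    E₃ ξ f g h k = E₃ ξ f' g' h' k' := by
  rw [funext₃ h₁, funext₃ h₂, funext₃ h₃, funext₃ h₄]

end QHAlg

end QHAlg

namespace QHAlg

variable {K : Type u} [Field K] {X : Type v} {G : Type w} [Group X] [Group G]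
  [MulDistribMulAction G X] {M : CrossedModule X G} {ξ : NormalizedCocycle K M}
  [Fintype X] [DecidableEq X]

/-- The coproduct `Δ(t_x g) = ∑_{ab = x} μ_g(a,b) (t_a g) ⊗ (t_b g)`, as a linear map. -/
noncomputable def comulLin : QHAlg ξ →ₗ[K] QHAlg ξ ⊗[K] QHAlg ξ :=
  lift fun x g => ∑ a, ∑ b, if a * b = x then (ξ.μ g a b : K) • (t ξ a g ⊗ₜ[K] t ξ b g) else 0

/-- The counit `ε(t_x g) = δ_{x,1}`, as a linear map. -/
noncomputable def counitLin : QHAlg ξ →ₗ[K] K := lift fun x _ => if x = 1 then 1 else 0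

theorem comulLin_t (x : X) (g : G) : comulLin (t ξ x g) =
    E₂ ξ (fun a b => if a * b = x then (ξ.μ g a b : K) else 0) (fun _ _ => g) fun _ _ => g := by
  simp only [comulLin, lift_t, E₂, ite_smul, zero_smul]

theorem smul_E₂ (k : K) (f : X → X → K) (g h : X → X → G) :
    k • E₂ ξ f g h = E₂ ξ (fun x y => k * f x y) g h := by
  simp only [E₂, Finset.smul_sum, smul_smul]

theorem E₂_zero (g h : X → X → G) : E₂ ξ (fun _ _ => 0) g h = 0 := by simp [E₂]

theorem sum_split {P : Type*} [AddCommMonoid P] (F : X → X → X → P) :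
    (∑ x, ∑ a, ∑ b, if a * b = x then F x a b else 0) = ∑ a, ∑ b, F (a * b) a b := by
  rw [Finset.sum_comm]
  refine Finset.sum_congr rfl fun a _ => ?_
  rw [Finset.sum_comm]
  refine Finset.sum_congr rfl fun b _ => ?_
  simp

/-- The coproduct. -/
noncomputable def comul : QHAlg ξ →ₐ[K] QHAlg ξ ⊗[K] QHAlg ξ :=
  AlgHom.ofLinearMap comulLin
    (by
      simp only [one_def, map_sum, comulLin_t, one₂, E₂, ite_smul, zero_smul, ξ.μ_one₁,
        Units.val_one]
      exact sum_split fun _ a b => (1 : K) • (t ξ a 1 ⊗ₜ[K] t ξ b 1))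
    (fun a b => by
      induction a using induction with
      | zero => simp only [zero_mul, map_zero]
      | add a a' h h' => simp only [add_mul, map_add, h, h']
      | smul k a h => simp only [smul_mul_assoc, map_smul, h]
      | single x g =>
      induction b using induction with
      | zero => simp only [mul_zero, map_zero]
      | add a a' h h' => simp only [mul_add, map_add, h, h']
      | smul k a h => simp only [mul_smul_comm, map_smul, h]
      | single y h =>
      rw [t_mul_t, comulLin_t, comulLin_t, E₂_mul]
      have key : ∀ a b : X, h • a * h • b = h • (a * b) := fun a b => (smul_mul' h a b).symm
      split_ifs with hx
      · rw [map_smul, comulLin_t, smul_E₂]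
        refine E₂_congr (fun a b => ?_) (fun _ _ => rfl) (fun _ _ => rfl)
        by_cases hy : a * b = y
        · rw [if_pos hy, if_pos hy, if_pos (by rw [key, hy, hx]), ← Units.val_mul,
            ← Units.val_mul, ← Units.val_mul]
          congr 1
          have := ξ.γ_μ g h a b
          rw [hy, div_eq_iff_eq_mul, div_mul_eq_mul_div, eq_div_iff_mul_eq'] at this
          apply Additive.ofMul.injective
          have := congrArg Additive.ofMul this
          simp only [ofMul_mul, ofMul_inv] at this ⊢
          rw [← sub_eq_zero] at this ⊢
          rw [← this]
          abel
        · rw [if_neg hy, if_neg hy, mul_zero, mul_zero, zero_mul]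
      · rw [map_zero, ← E₂_zero (fun _ _ => g * h) fun _ _ => g * h]
        refine E₂_congr (fun a b => ?_) (fun _ _ => rfl) (fun _ _ => rfl)
        by_cases hy : a * b = y
        · rw [if_neg (by rw [key, hy]; exact fun h => hx h.symm), zero_mul, zero_mul]
        · rw [if_neg hy, mul_zero, zero_mul])

theorem comul_t (x : X) (g : G) : comul (t ξ x g) =
    E₂ ξ (fun a b => if a * b = x then (ξ.μ g a b : K) else 0) (fun _ _ => g) fun _ _ => g :=
  comulLin_t x g

/-- The counit. -/
noncomputable def counit : QHAlg ξ →ₐ[K] K :=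
  AlgHom.ofLinearMap counitLin
    (by simp [one_def, counitLin])
    (fun a b => by
      induction a using induction with
      | zero => simp only [zero_mul, map_zero]
      | add a a' h h' => simp only [add_mul, map_add, h, h']
      | smul k a h => simp only [smul_mul_assoc, map_smul, h]
      | single x g =>
      induction b using induction with
      | zero => simp only [mul_zero, map_zero]
      | add a a' h h' => simp only [mul_add, map_add, h, h']
      | smul k a h => simp only [mul_smul_comm, map_smul, h]
      | single y h =>
      rw [t_mul_t]
      by_cases hy : y = 1
      · subst hy
        by_cases hx : x = 1
        · simp [counitLin, hx, ξ.γ_one₃]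
        · simp [counitLin, hx]
      · split_ifs <;> simp [counitLin, hy])

theorem counit_t (x : X) (g : G) : counit (t ξ x g) = if x = 1 then 1 else 0 := by
  simp [counit, counitLin]

open Algebra.TensorProduct (map)

theorem assoc_map_comul (f : X → X → K) (g h : X → X → G) :
    Algebra.TensorProduct.assoc K K K (QHAlg ξ) (QHAlg ξ) (QHAlg ξ)
        (map comul (AlgHom.id K (QHAlg ξ)) (E₂ ξ f g h)) =
      E₃ ξ (fun a b y => f (a * b) y * ξ.μ (g (a * b) y) a b) (fun a b y => g (a * b) y)
        (fun a b y => g (a * b) y) fun a b y => h (a * b) y := by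
  have : ∀ y, (∑ x, f x y • Algebra.TensorProduct.assoc K K K (QHAlg ξ) (QHAlg ξ) (QHAlg ξ)
        (comul (t ξ x (g x y)) ⊗ₜ t ξ y (h x y))) =
      ∑ a, ∑ b, (f (a * b) y * ξ.μ (g (a * b) y) a b) • (t ξ a (g (a * b) y) ⊗ₜ[K]
        (t ξ b (g (a * b) y) ⊗ₜ[K] t ξ y (h (a * b) y))) := fun y => by
    rw [← sum_split fun x a b => (f x y * ξ.μ (g x y) a b) • (t ξ a (g x y) ⊗ₜ[K]
        (t ξ b (g x y) ⊗ₜ[K] t ξ y (h x y)))]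
    refine Finset.sum_congr rfl fun x _ => ?_
    simp only [comul_t, E₂, TensorProduct.sum_tmul, map_sum, Finset.smul_sum,
      ← TensorProduct.smul_tmul', map_smul, smul_smul, Algebra.TensorProduct.assoc_tmul]
    refine Finset.sum_congr rfl fun a _ => Finset.sum_congr rfl fun b _ => ?_
    split_ifs <;> simp
  simp only [E₂, map_sum, map_smul, Algebra.TensorProduct.map_tmul, AlgHom.id_apply]
  rw [Finset.sum_comm, Finset.sum_congr rfl fun y _ => this y, Finset.sum_comm]
  exact Finset.sum_congr rfl fun a _ => Finset.sum_comm

theorem map_id_comul (f : X → X → K) (g h : X → X → G) :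
    map (AlgHom.id K (QHAlg ξ)) comul (E₂ ξ f g h) =
      E₃ ξ (fun x a b => f x (a * b) * ξ.μ (h x (a * b)) a b) (fun x a b => g x (a * b))
        (fun x a b => h x (a * b)) fun x a b => h x (a * b) := by
  simp only [E₂, map_sum, map_smul, Algebra.TensorProduct.map_tmul, AlgHom.id_apply]
  refine Finset.sum_congr rfl fun x _ => ?_
  rw [← sum_split fun y a b => (f x y * ξ.μ (h x y) a b) • (t ξ x (g x y) ⊗ₜ[K]
        (t ξ a (h x y) ⊗ₜ[K] t ξ b (h x y)))]
  refine Finset.sum_congr rfl fun y _ => ?_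
  simp only [comul_t, E₂, TensorProduct.tmul_sum, Finset.smul_sum,
    TensorProduct.tmul_smul, smul_smul]
  refine Finset.sum_congr rfl fun a _ => Finset.sum_congr rfl fun b _ => ?_
  split_ifs <;> simp

theorem comm_E₂ (f : X → X → K) (g h : X → X → G) :
    Algebra.TensorProduct.comm K (QHAlg ξ) (QHAlg ξ) (E₂ ξ f g h) =
      E₂ ξ (fun x y => f y x) (fun x y => h y x) fun x y => g y x := by
  simp only [E₂, map_sum, map_smul, Algebra.TensorProduct.comm_tmul]
  exact Finset.sum_comm

theorem map_comm_E₃ (f : X → X → X → K) (g h k : X → X → X → G) :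
    map (AlgHom.id K (QHAlg ξ)) (Algebra.TensorProduct.comm K (QHAlg ξ) (QHAlg ξ)).toAlgHom
        (E₃ ξ f g h k) =
      E₃ ξ (fun x y z => f x z y) (fun x y z => g x z y) (fun x y z => k x z y)
        fun x y z => h x z y := by
  simp only [E₃, map_sum, map_smul, Algebra.TensorProduct.map_tmul, AlgHom.id_apply]
  exact Finset.sum_congr rfl fun x _ => Finset.sum_comm

theorem leftComm_E₃ (f : X → X → X → K) (g h k : X → X → X → G) :
    Algebra.TensorProduct.leftComm K (QHAlg ξ) (QHAlg ξ) (QHAlg ξ) (E₃ ξ f g h k) =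
      E₃ ξ (fun x y z => f y x z) (fun x y z => h y x z) (fun x y z => g y x z)
        fun x y z => k y x z := by
  simp only [E₃, map_sum, map_smul, Algebra.TensorProduct.leftComm_tmul]
  exact Finset.sum_comm

theorem one_tmul_E₂ (f : X → X → K) (g h : X → X → G) :
    (1 : QHAlg ξ) ⊗ₜ[K] E₂ ξ f g h =
      E₃ ξ (fun _ y z => f y z) (fun _ _ _ => 1) (fun _ y z => g y z) fun _ y z => h y z := by
  simp only [one_def, E₃, TensorProduct.sum_tmul]
  refine Finset.sum_congr rfl fun x _ => ?_
  simp only [E₂, TensorProduct.tmul_sum, TensorProduct.tmul_smul]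

theorem assoc_tmul_one (f : X → X → K) (g h : X → X → G) :
    Algebra.TensorProduct.assoc K K K (QHAlg ξ) (QHAlg ξ) (QHAlg ξ)
        (E₂ ξ f g h ⊗ₜ[K] (1 : QHAlg ξ)) =
      E₃ ξ (fun x y _ => f x y) (fun x y _ => g x y) (fun x y _ => h x y) fun _ _ _ => 1 := by
  simp only [one_def, E₂, E₃, TensorProduct.sum_tmul, TensorProduct.tmul_sum,
    ← TensorProduct.smul_tmul', map_sum, map_smul, Algebra.TensorProduct.assoc_tmul]
  rw [Finset.sum_comm]
  exact Finset.sum_congr rfl fun x _ => Finset.sum_comm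

variable (ξ) in
/-- The element `∑ f(x,y,z) (t_x 1) ⊗ (t_y 1) ⊗ (t_z 1)`. -/
noncomputable abbrev D₃ (f : X → X → X → K) : QHAlg ξ ⊗[K] (QHAlg ξ ⊗[K] QHAlg ξ) :=
  E₃ ξ f (fun _ _ _ => 1) (fun _ _ _ => 1) fun _ _ _ => 1

theorem D₃_eq (f : X → X → X → K) :
    D₃ ξ f = ∑ x, t ξ x 1 ⊗ₜ[K] E₂ ξ (f x) (fun _ _ => 1) fun _ _ => 1 := by
  simp only [E₃, E₂, TensorProduct.tmul_sum, TensorProduct.tmul_smul]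

theorem D₃_mul_D₃ (f f' : X → X → X → K) :
    D₃ ξ f * D₃ ξ f' = D₃ ξ fun x y z => f x y z * f' x y z := by
  rw [D₃, D₃, E₃_mul]
  simp [ξ.γ_one₁]

theorem one_tmul_D₃ (f : X → X → X → K) :
    (1 : QHAlg ξ) ⊗ₜ[K] D₃ ξ f = E₄ ξ fun _ y z w => f y z w := by
  simp only [one_def, E₄, TensorProduct.sum_tmul]

theorem map_id_map_id_comul (f : X → X → X → K) :
    map (AlgHom.id K (QHAlg ξ)) (map (AlgHom.id K (QHAlg ξ)) comul) (D₃ ξ f) =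
      E₄ ξ fun x y z w => f x y (z * w) := by
  simp only [D₃_eq, map_sum, Algebra.TensorProduct.map_tmul, AlgHom.id_apply, map_id_comul,
    ξ.μ_one₁, Units.val_one, mul_one, E₄]

theorem map_id_assoc_comul (f : X → X → X → K) :
    map (AlgHom.id K (QHAlg ξ)) ((Algebra.TensorProduct.assoc K K K (QHAlg ξ) (QHAlg ξ)
        (QHAlg ξ)).toAlgHom.comp (map comul (AlgHom.id K (QHAlg ξ)))) (D₃ ξ f) =
      E₄ ξ fun x y z w => f x (y * z) w := by
  have := fun x => assoc_map_comul (ξ := ξ) (f x) (fun _ _ => 1) fun _ _ => 1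
  simp only [D₃_eq, map_sum, Algebra.TensorProduct.map_tmul, AlgHom.id_apply]
  refine Finset.sum_congr rfl fun x _ => congrArg (t ξ x 1 ⊗ₜ[K] ·) ((this x).trans ?_)
  simp only [ξ.μ_one₁, Units.val_one, mul_one]

theorem assoc_map_comul₃ (f : X → X → X → K) :
    Algebra.TensorProduct.assoc K K K (QHAlg ξ) (QHAlg ξ) (QHAlg ξ ⊗[K] QHAlg ξ)
        (map comul (AlgHom.id K (QHAlg ξ ⊗[K] QHAlg ξ)) (D₃ ξ f)) =
      E₄ ξ fun x y z w => f (x * y) z w := by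
  simp only [D₃_eq, map_sum, Algebra.TensorProduct.map_tmul, AlgHom.id_apply, comul_t, E₄]
  rw [Finset.sum_congr rfl fun x _ => TensorProduct.tmul_sum _ _ _,
    ← sum_split fun x a b => t ξ a 1 ⊗ₜ[K] (t ξ b 1 ⊗ₜ[K]
      E₂ ξ (f x) (fun _ _ => 1) fun _ _ => 1)]
  refine Finset.sum_congr rfl fun x _ => ?_
  rw [E₂]
  simp only [TensorProduct.sum_tmul, map_sum]
  refine Finset.sum_congr rfl fun a _ => Finset.sum_congr rfl fun b _ => ?_
  split_ifs <;> simp [ξ.μ_one₁]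

theorem map_assoc_tmul_one (f : X → X → X → K) :
    map (AlgHom.id K (QHAlg ξ)) (Algebra.TensorProduct.assoc K K K (QHAlg ξ) (QHAlg ξ)
      (QHAlg ξ)).toAlgHom (Algebra.TensorProduct.assoc K K K (QHAlg ξ) (QHAlg ξ ⊗[K] QHAlg ξ)
        (QHAlg ξ) (D₃ ξ f ⊗ₜ[K] (1 : QHAlg ξ))) = E₄ ξ fun x y z _ => f x y z := by
  have := fun x => assoc_tmul_one (ξ := ξ) (f x) (fun _ _ => 1) fun _ _ => 1
  simp only [D₃_eq, map_sum, TensorProduct.sum_tmul, Algebra.TensorProduct.map_tmul,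
    AlgHom.id_apply, Algebra.TensorProduct.assoc_tmul]
  exact Finset.sum_congr rfl fun x _ => congrArg (t ξ x 1 ⊗ₜ[K] ·) (this x)

end QHAlg

namespace QHAlg

variable {K : Type u} [Field K] {X : Type v} {G : Type w} [Group X] [Group G]
  [MulDistribMulAction G X] {M : CrossedModule X G} {ξ : NormalizedCocycle K M}
  [Fintype X] [DecidableEq X]

variable (ξ) in
/-- The Drinfeld associator `Φ = ∑ ω(x,y,z) (t_x 1) ⊗ (t_y 1) ⊗ (t_z 1)`. -/
noncomputable def associator : (QHAlg ξ ⊗[K] (QHAlg ξ ⊗[K] QHAlg ξ))ˣ where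
  val := ∑ x, ∑ y, ∑ z, (ξ.ω x y z : K) • (t ξ x 1 ⊗ₜ[K] (t ξ y 1 ⊗ₜ[K] t ξ z 1))
  inv := ∑ x, ∑ y, ∑ z, ((ξ.ω x y z)⁻¹ : Kˣ).val • (t ξ x 1 ⊗ₜ[K] (t ξ y 1 ⊗ₜ[K] t ξ z 1))
  val_inv := by
    refine (D₃_mul_D₃ _ _).trans ?_
    simp only [Units.mul_inv, one₃]
  inv_val := by
    refine (D₃_mul_D₃ _ _).trans ?_
    simp only [Units.inv_mul, one₃]

theorem associator_val : (associator ξ).val = D₃ ξ fun x y z => ξ.ω x y z := rfl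

theorem associator_inv : (associator ξ)⁻¹.val = D₃ ξ fun x y z => ((ξ.ω x y z)⁻¹ : Kˣ).val := rfl

theorem γ_inv (g : G) (x : X) : ξ.γ g g⁻¹ (g • x) = ξ.γ g⁻¹ g x := by
  have := ξ.γ_cocycle g g⁻¹ g x
  rw [inv_mul_cancel, mul_inv_cancel, ξ.γ_one₂, ξ.γ_one₁, mul_one, one_mul] at this
  exact this.symm

variable (ξ) in
/-- The universal `R`-matrix `R = ∑ c(x,y) (t_x 1) ⊗ (t_y ∂(x))`. -/
noncomputable def rMatrix : (QHAlg ξ ⊗[K] QHAlg ξ)ˣ where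
  val := ∑ x, ∑ y, (ξ.c x y : K) • (t ξ x 1 ⊗ₜ[K] t ξ y (M.bd x))
  inv := E₂ ξ (fun x y => ((ξ.c x (x⁻¹ * y * x))⁻¹ * ξ.γ (M.bd x) (M.bd x)⁻¹ y : Kˣ).val)
    (fun _ _ => 1) fun x _ => (M.bd x)⁻¹
  val_inv := by
    refine (E₂_mul (ξ := ξ) (fun x y => (ξ.c x y : K)) _ (fun _ _ => 1) (fun x _ => M.bd x)
      _ _).trans ?_
    rw [one₂]
    refine E₂_congr (fun x y => ?_) (fun x y => ?_) (fun x y => ?_)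
    · have : (M.bd x)⁻¹ • y = x⁻¹ * y * x := by rw [← map_inv, M.bd_smul, inv_inv]
      rw [one_smul, this, ξ.γ_one₁, ← Units.val_mul, ← Units.val_mul, inv_one, one_mul,
        mul_inv_cancel_left, mul_inv_cancel, Units.val_one]
    · rw [mul_one]
    · rw [one_smul, mul_inv_cancel]
  inv_val := by
    refine (E₂_mul (ξ := ξ) _ (fun x y => (ξ.c x y : K)) _ _ (fun _ _ => 1)
      (fun x _ => M.bd x)).trans ?_
    rw [one₂]
    refine E₂_congr (fun x y => ?_) (fun x y => ?_) (fun x y => ?_)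
    · have : x⁻¹ * (x * y * x⁻¹) * x = y := by group
      rw [one_smul, γ_inv, M.bd_smul, this, ξ.γ_one₁, ← Units.val_mul, ← Units.val_mul, inv_one,
        one_mul, mul_right_comm, mul_inv_cancel_right, inv_mul_cancel, Units.val_one]
    · rw [mul_one]
    · rw [one_smul, inv_mul_cancel]

theorem rMatrix_val : (rMatrix ξ).val =
    E₂ ξ (fun x y => ξ.c x y) (fun _ _ => 1) fun x _ => M.bd x := rfl

open Algebra.TensorProduct (map)

theorem quasi_coassoc (a : QHAlg ξ) :
    map (AlgHom.id K (QHAlg ξ)) comul (comul a) * (associator ξ).val =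
      (associator ξ).val * Algebra.TensorProduct.assoc K K K (QHAlg ξ) (QHAlg ξ) (QHAlg ξ)
        (map comul (AlgHom.id K (QHAlg ξ)) (comul a)) := by
  induction a using induction with
  | zero => simp only [mul_zero, zero_mul, map_zero]
  | add a a' h h' => simp only [mul_add, add_mul, map_add, h, h']
  | smul k a h => simp only [mul_smul_comm, smul_mul_assoc, map_smul, h]
  | single x g =>
  rw [comul_t, map_id_comul, assoc_map_comul, associator_val, E₃_mul, E₃_mul]
  refine E₃_congr (fun p q r => ?_) (fun _ _ _ => ?_) (fun _ _ _ => ?_) (fun _ _ _ => ?_)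
  · simp only [one_smul, ξ.γ_one₁, ξ.γ_one₂, inv_one, mul_one, Units.val_one, mul_assoc p q r]
    split_ifs
    · simp only [← Units.val_mul]
      congr 1
      have h := ξ.μ_ω g p q r
      rw [div_eq_div_iff_mul_eq_mul] at h
      rw [mul_comm (ξ.μ g p _), h, mul_comm (ξ.μ g (p * q) r)]
    · simp only [zero_mul, mul_zero]
  · rw [mul_one, one_mul]
  · rw [mul_one, one_mul]
  · rw [mul_one, one_mul]

theorem pentagon :
    map (AlgHom.id K (QHAlg ξ)) (map (AlgHom.id K (QHAlg ξ)) comul) (associator ξ).val *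
        Algebra.TensorProduct.assoc K K K (QHAlg ξ) (QHAlg ξ) (QHAlg ξ ⊗[K] QHAlg ξ)
          (map comul (AlgHom.id K (QHAlg ξ ⊗[K] QHAlg ξ)) (associator ξ).val) =
      (1 : QHAlg ξ) ⊗ₜ[K] (associator ξ).val *
        map (AlgHom.id K (QHAlg ξ)) ((Algebra.TensorProduct.assoc K K K (QHAlg ξ) (QHAlg ξ)
          (QHAlg ξ)).toAlgHom.comp (map comul (AlgHom.id K (QHAlg ξ)))) (associator ξ).val *
        map (AlgHom.id K (QHAlg ξ)) (Algebra.TensorProduct.assoc K K K (QHAlg ξ) (QHAlg ξ)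
          (QHAlg ξ)).toAlgHom (Algebra.TensorProduct.assoc K K K (QHAlg ξ)
            (QHAlg ξ ⊗[K] QHAlg ξ) (QHAlg ξ) ((associator ξ).val ⊗ₜ[K] (1 : QHAlg ξ))) := by
  rw [associator_val, map_id_map_id_comul, assoc_map_comul₃, one_tmul_D₃, map_id_assoc_comul,
    map_assoc_tmul_one, E₄_mul, E₄_mul, E₄_mul]
  congr 1
  funext x y z w
  simp only [← Units.val_mul]
  rw [ξ.ω_cocycle]

theorem comul_t' (x : X) (g : G) : comul (t ξ x g) =
    ∑ a, (ξ.μ g a (a⁻¹ * x) : K) • (t ξ a g ⊗ₜ[K] t ξ (a⁻¹ * x) g) := by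
  rw [comul_t, E₂]
  refine Finset.sum_congr rfl fun a _ => ?_
  rw [Finset.sum_eq_single (a⁻¹ * x)]
  · rw [if_pos (mul_inv_cancel_left a x)]
  · intro b _ hb
    rw [if_neg (fun h => hb (by rw [← h, inv_mul_cancel_left])), zero_smul]
  · simp

theorem counit_left (a : QHAlg ξ) :
    Algebra.TensorProduct.lid K (QHAlg ξ) (map counit (AlgHom.id K (QHAlg ξ)) (comul a)) = a := by
  induction a using induction with
  | zero => simp only [map_zero]
  | add a a' h h' => simp only [map_add, h, h']
  | smul k a h => simp only [map_smul, h]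
  | single x g => simp [comul_t', counit_t, ξ.μ_one₂]

theorem counit_right (a : QHAlg ξ) :
    Algebra.TensorProduct.rid K K (QHAlg ξ) (map (AlgHom.id K (QHAlg ξ)) counit (comul a)) = a := by
  induction a using induction with
  | zero => simp only [map_zero]
  | add a a' h h' => simp only [map_add, h, h']
  | smul k a h => simp only [map_smul, h]
  | single x g => simp [comul_t', counit_t, inv_mul_eq_one, ξ.μ_one₃]

theorem counit_mid : map (AlgHom.id K (QHAlg ξ))
    ((Algebra.TensorProduct.lid K (QHAlg ξ)).toAlgHom.comp
      (map counit (AlgHom.id K (QHAlg ξ)))) (associator ξ).val = 1 := by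
  rw [one₂, associator_val]
  rw [D₃, E₃, E₂, map_sum]
  refine Finset.sum_congr rfl fun x _ => ?_
  rw [map_sum, Finset.sum_eq_single 1]
  · simp [counit_t, ξ.ω_one₂]
  · intro y _ hy
    simp [counit_t, hy]
  · simp

/-- `H(ξ)` as a quasi-bialgebra. -/
noncomputable instance : QuasiBialgebra K (QHAlg ξ) where
  Δ := comul
  ε := counit
  Φ := associator ξ
  quasi_coassoc := quasi_coassoc
  pentagon := pentagon
  counit_left := counit_left
  counit_right := counit_right
  counit_mid := counit_mid

theorem R_comm (a : QHAlg ξ) :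
    Algebra.TensorProduct.comm K (QHAlg ξ) (QHAlg ξ) (comul a) * (rMatrix ξ).val =
      (rMatrix ξ).val * comul a := by
  induction a using induction with
  | zero => simp only [mul_zero, zero_mul, map_zero]
  | add a a' h h' => simp only [mul_add, add_mul, map_add, h, h']
  | smul k a h => simp only [mul_smul_comm, smul_mul_assoc, map_smul, h]
  | single x g =>
  rw [comul_t, comm_E₂, rMatrix_val, E₂_mul, E₂_mul]
  refine E₂_congr (fun p q => ?_) (fun _ _ => ?_) (fun p _ => ?_)
  · simp only [one_smul, ξ.γ_one₁, ξ.γ_one₂, inv_one, one_mul, M.bd_smul, M.smul_bd,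
      inv_mul_cancel_right]
    split_ifs
    · simp only [← Units.val_mul]
      congr 1
      have h := congrArg Additive.ofMul (ξ.c_inv g p q)
      apply Additive.ofMul.injective
      simp only [ofMul_mul, ofMul_inv, ofMul_div] at h ⊢
      linear_combination (norm := abel) -h
    · simp only [zero_mul, mul_zero]
  · rw [mul_one, one_mul]
  · rw [M.smul_bd, inv_mul_cancel_right]

theorem hexagon₁ : Algebra.TensorProduct.assoc K K K (QHAlg ξ) (QHAlg ξ) (QHAlg ξ)
      (map comul (AlgHom.id K (QHAlg ξ)) (rMatrix ξ).val) =
    map (AlgHom.id K (QHAlg ξ)) (Algebra.TensorProduct.comm K (QHAlg ξ) (QHAlg ξ)).toAlgHom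
        (Algebra.TensorProduct.leftComm K (QHAlg ξ) (QHAlg ξ) (QHAlg ξ) (associator ξ).val) *
      Algebra.TensorProduct.leftComm K (QHAlg ξ) (QHAlg ξ) (QHAlg ξ)
        ((1 : QHAlg ξ) ⊗ₜ (rMatrix ξ).val) *
      map (AlgHom.id K (QHAlg ξ)) (Algebra.TensorProduct.comm K (QHAlg ξ) (QHAlg ξ)).toAlgHom
        (associator ξ)⁻¹.val *
      (1 : QHAlg ξ) ⊗ₜ (rMatrix ξ).val * (associator ξ).val := by
  rw [rMatrix_val, associator_val, associator_inv, assoc_map_comul, leftComm_E₃, map_comm_E₃,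
    map_comm_E₃, one_tmul_E₂, leftComm_E₃, E₃_mul, E₃_mul, E₃_mul, E₃_mul]
  refine E₃_congr (fun x y z => ?_) (fun _ _ _ => ?_) (fun _ _ _ => ?_) (fun x y z => ?_)
  · simp only [one_smul, ξ.γ_one₁, ξ.γ_one₂, inv_one, one_mul, mul_one, M.bd_smul, ξ.μ_one₁,
      Units.val_one]
    simp only [← Units.val_mul]
    congr 1
    rw [ξ.c_mul_left]
    have : x * (y * z * y⁻¹) * x⁻¹ = x * y * z * (x * y)⁻¹ := by group
    rw [this]
    apply Additive.ofMul.injective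
    simp only [ofMul_mul, ofMul_inv, ofMul_div]
    abel
  · simp only [mul_one]
  · simp only [mul_one]
  · simp only [mul_one, one_mul, one_smul, map_mul]

theorem hexagon₂ : map (AlgHom.id K (QHAlg ξ)) comul (rMatrix ξ).val =
    Algebra.TensorProduct.leftComm K (QHAlg ξ) (QHAlg ξ) (QHAlg ξ)
        (map (AlgHom.id K (QHAlg ξ)) (Algebra.TensorProduct.comm K (QHAlg ξ) (QHAlg ξ)).toAlgHom
          (associator ξ)⁻¹.val) *
      Algebra.TensorProduct.leftComm K (QHAlg ξ) (QHAlg ξ) (QHAlg ξ)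
        ((1 : QHAlg ξ) ⊗ₜ (rMatrix ξ).val) *
      Algebra.TensorProduct.leftComm K (QHAlg ξ) (QHAlg ξ) (QHAlg ξ) (associator ξ).val *
      Algebra.TensorProduct.assoc K K K (QHAlg ξ) (QHAlg ξ) (QHAlg ξ)
        ((rMatrix ξ).val ⊗ₜ (1 : QHAlg ξ)) * (associator ξ)⁻¹.val := by
  rw [rMatrix_val, associator_val, associator_inv, map_id_comul, map_comm_E₃, leftComm_E₃,
    leftComm_E₃, one_tmul_E₂, leftComm_E₃, assoc_tmul_one, E₃_mul, E₃_mul, E₃_mul, E₃_mul]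
  refine E₃_congr (fun x y z => ?_) (fun _ _ _ => ?_) (fun _ _ _ => ?_) (fun x y z => ?_)
  · simp only [one_smul, ξ.γ_one₁, ξ.γ_one₂, inv_one, one_mul, mul_one, M.bd_smul,
      Units.val_one]
    simp only [← Units.val_mul]
    congr 1
    rw [ξ.c_mul_right]
    apply Additive.ofMul.injective
    simp only [ofMul_mul, ofMul_inv, ofMul_div]
    abel
  · simp only [mul_one]
  · simp only [mul_one, one_mul, one_smul]
  · simp only [mul_one, one_mul, one_smul]

/-- The antipode `S(t_x g) = γ_{g⁻¹,g}(x⁻¹) / μ_g(x,x⁻¹) t_{g • x⁻¹} g⁻¹`. -/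
noncomputable def antipode : QHAlg ξ →ₗ[K] QHAlg ξ :=
  lift fun x g => (ξ.γ g⁻¹ g x⁻¹ / ξ.μ g x x⁻¹ : Kˣ).val • t ξ (g • x⁻¹) g⁻¹

theorem antipode_t (x : X) (g : G) : antipode (t ξ x g) =
    (ξ.γ g⁻¹ g x⁻¹ / ξ.μ g x x⁻¹ : Kˣ).val • t ξ (g • x⁻¹) g⁻¹ := lift_t _ _ _

theorem antipode_t_one (x : X) : antipode (t ξ x 1) = t ξ x⁻¹ 1 := by
  rw [antipode_t, inv_one, ξ.γ_one₁, ξ.μ_one₁, div_one, Units.val_one, one_smul, one_smul]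

/-- The element `β = ∑ ω(x⁻¹,x,x⁻¹) (t_x 1)`. -/
noncomputable def beta : QHAlg ξ := ∑ x, (ξ.ω x⁻¹ x x⁻¹ : K) • t ξ x 1

theorem t_mul_beta (x : X) (g : G) : t ξ x g * beta = (ξ.ω x⁻¹ x x⁻¹ : K) • t ξ x g := by
  rw [beta, Finset.mul_sum, Finset.sum_eq_single x]
  · rw [mul_smul_comm, t_mul_t, if_pos (one_smul G x).symm, ξ.γ_one₂, inv_one, Units.val_one,
      one_smul, mul_one]
  · intro y _ hy
    rw [mul_smul_comm, t_mul_t, if_neg (by rw [one_smul]; exact hy.symm), smul_zero]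
  · simp

theorem antipode_bijective [Finite G] : Function.Bijective (antipode (ξ := ξ)) := by
  have hs : Function.Surjective (antipode (ξ := ξ)) := by
    rw [← LinearMap.range_eq_top, eq_top_iff]
    intro a _
    induction a using induction with
    | zero => exact zero_mem _
    | add a b ha hb => exact add_mem (ha trivial) (hb trivial)
    | smul k a ha => exact Submodule.smul_mem _ k (ha trivial)
    | single x g =>
      refine ⟨(ξ.γ (g⁻¹)⁻¹ g⁻¹ (g • x⁻¹)⁻¹ / ξ.μ g⁻¹ (g • x⁻¹) (g • x⁻¹)⁻¹ : Kˣ)⁻¹.val •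
        t ξ (g • x⁻¹) g⁻¹, ?_⟩
      rw [map_smul, antipode_t, smul_smul, ← Units.val_mul, inv_mul_cancel, Units.val_one,
        one_smul, smul_inv', inv_inv, inv_smul_smul, inv_inv]
  have : FiniteDimensional K (QHAlg ξ) := finite
  exact ⟨LinearMap.injective_iff_surjective.2 hs, hs⟩

theorem antipode_one : antipode (1 : QHAlg ξ) = 1 := by
  rw [one_def, map_sum]
  simp only [antipode_t_one]
  exact Equiv.sum_comp (Equiv.inv X) fun x => t ξ x 1

theorem antipode_mul (a b : QHAlg ξ) : antipode (a * b) = antipode b * antipode a := by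
  induction a using induction with
  | zero => simp only [mul_zero, zero_mul, map_zero]
  | add a a' h h' => simp only [mul_add, add_mul, map_add, h, h']
  | smul k a h => simp only [mul_smul_comm, smul_mul_assoc, map_smul, h]
  | single x g =>
  induction b using induction with
  | zero => simp only [mul_zero, zero_mul, map_zero]
  | add a a' h h' => simp only [mul_add, add_mul, map_add, h, h']
  | smul k a h => simp only [mul_smul_comm, smul_mul_assoc, map_smul, h]
  | single y h =>
  rw [t_mul_t, antipode_t, antipode_t, smul_mul_smul_comm, t_mul_t, inv_smul_smul]
  by_cases hx : x = h • y
  · rw [if_pos hx, if_pos (by rw [hx, smul_inv']), map_smul, antipode_t, smul_smul, smul_smul,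
      ← mul_inv_rev, mul_smul g h, hx, ← smul_inv' h y, ← Units.val_mul, ← Units.val_mul,
      ← Units.val_mul]
    congr 2
    have h1 := ξ.γ_μ g h y y⁻¹
    have h2 := ξ.γ_cocycle (h⁻¹ * g⁻¹) g h y⁻¹
    have h3 := ξ.γ_cocycle h⁻¹ g⁻¹ g (h • y⁻¹)
    rw [mul_inv_cancel, ξ.γ_one₃, div_one] at h1
    rw [inv_mul_cancel_right] at h2
    rw [inv_mul_cancel, ξ.γ_one₂, mul_one] at h3
    replace h1 := congrArg Additive.ofMul h1
    replace h2 := congrArg Additive.ofMul h2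
    replace h3 := congrArg Additive.ofMul h3
    apply Additive.ofMul.injective
    simp only [ofMul_mul, ofMul_inv, ofMul_div, mul_inv_rev, smul_inv'] at h1 h2 h3 ⊢
    linear_combination (norm := abel) h2 - h1 - h3
  · rw [if_neg hx, if_neg, map_zero, smul_zero]
    rw [smul_inv', inv_inj]
    exact fun h' => hx h'.symm

theorem antipode_left (a : QHAlg ξ) : LinearMap.mul' K (QHAlg ξ)
    (TensorProduct.map (LinearMap.mulRight K 1 ∘ₗ antipode) LinearMap.id (comul a)) =
      counit a • 1 := by
  induction a using induction with
  | zero => simp only [zero_smul, map_zero]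
  | add a a' h h' => simp only [map_add, add_smul, h, h']
  | smul k a h => rw [map_smul, map_smul, map_smul, map_smul, h, smul_assoc]
  | single x g =>
  rw [comul_t', counit_t]
  simp only [map_sum, map_smul, TensorProduct.map_tmul, LinearMap.comp_apply,
    LinearMap.mulRight_apply, mul_one, LinearMap.mul'_apply, LinearMap.id_apply, antipode_t,
    smul_mul_assoc, t_mul_t, smul_left_cancel_iff]
  by_cases hx : x = 1
  · subst hx
    rw [if_pos rfl, one_smul, one_def, ← Equiv.sum_comp (Equiv.inv X)]
    refine Finset.sum_congr rfl fun a _ => ?_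
    rw [Equiv.inv_apply, if_pos (mul_one a⁻¹⁻¹).symm, smul_smul, smul_smul, mul_one, inv_mul_cancel,
      ← Units.val_mul, ← Units.val_mul, mul_div_cancel, mul_inv_cancel, Units.val_one,
      one_smul, inv_inv]
  · rw [if_neg hx, zero_smul]
    refine Finset.sum_eq_zero fun a _ => ?_
    rw [if_neg (by simpa using hx), smul_zero, smul_zero]

theorem antipode_right (a : QHAlg ξ) : LinearMap.mul' K (QHAlg ξ)
    (TensorProduct.map (LinearMap.mulRight K beta) antipode (comul a)) = counit a • beta := by
  induction a using induction with
  | zero => simp only [zero_smul, map_zero]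
  | add a a' h h' => simp only [map_add, add_smul, h, h']
  | smul k a h => rw [map_smul, map_smul, map_smul, map_smul, h, smul_assoc]
  | single x g =>
  rw [comul_t', counit_t]
  simp only [map_sum, map_smul, TensorProduct.map_tmul, LinearMap.mulRight_apply,
    LinearMap.mul'_apply, antipode_t, t_mul_beta, smul_mul_smul_comm, t_mul_t, inv_smul_smul]
  by_cases hx : x = 1
  · subst hx
    rw [if_pos rfl, one_smul, beta]
    refine (Finset.sum_congr rfl fun a _ => ?_).trans (Equiv.sum_comp (MulAction.toPerm g)
      fun x => (ξ.ω x⁻¹ x x⁻¹ : K) • t ξ x 1)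
    rw [mul_one, inv_inv, if_pos rfl, smul_smul, smul_smul, mul_inv_cancel, γ_inv,
      MulAction.toPerm_apply, ← Units.val_mul, ← Units.val_mul, ← Units.val_mul, ← smul_inv']
    congr 2
    have h := ξ.μ_ω g a⁻¹ a a⁻¹
    rw [inv_mul_cancel, mul_inv_cancel, ξ.μ_one₂, ξ.μ_one₃, mul_one, one_mul] at h
    replace h := congrArg Additive.ofMul h
    apply Additive.ofMul.injective
    simp only [ofMul_mul, ofMul_inv, ofMul_div] at h ⊢
    linear_combination (norm := abel) h
  · rw [if_neg hx, zero_smul]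
    refine Finset.sum_eq_zero fun a _ => ?_
    rw [if_neg, smul_zero, smul_zero]
    intro h
    rw [mul_inv_rev, inv_inv, eq_comm, mul_eq_right, inv_eq_one] at h
    exact hx h

theorem t_one_mul_t_one (x y : X) : t ξ x 1 * t ξ y 1 = if x = y then t ξ y 1 else 0 := by
  rw [t_mul_t, one_smul, ξ.γ_one₁, inv_one, Units.val_one, one_smul, mul_one]

theorem antipode_associator : LinearMap.mul' K (QHAlg ξ)
    (TensorProduct.map (LinearMap.mulRight K beta) (LinearMap.mul' K (QHAlg ξ) ∘ₗ
      TensorProduct.map (LinearMap.mulRight K 1 ∘ₗ antipode) LinearMap.id)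
        (associator ξ).val) = 1 := by
  rw [associator_val, D₃, E₃]
  simp only [map_sum, map_smul, TensorProduct.map_tmul, LinearMap.comp_apply,
    LinearMap.mulRight_apply, mul_one, LinearMap.mul'_apply, LinearMap.id_apply, antipode_t_one,
    t_mul_beta, t_one_mul_t_one, smul_mul_assoc]
  rw [one_def]
  refine Finset.sum_congr rfl fun x _ => ?_
  rw [Finset.sum_eq_single x⁻¹, Finset.sum_eq_single x]
  · rw [inv_inv, if_pos rfl, t_one_mul_t_one, if_pos rfl, smul_smul, ← Units.val_mul]
    have h := ξ.ω_cocycle x x⁻¹ x x⁻¹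
    rw [inv_mul_cancel, mul_inv_cancel, ξ.ω_one₁, ξ.ω_one₂, ξ.ω_one₃, one_mul, mul_one] at h
    rw [mul_comm, h, Units.val_one, one_smul]
  · intro z _ hz
    rw [inv_inv, if_neg hz.symm, mul_zero, smul_zero, smul_zero]
  · simp
  · intro y _ hy
    refine Finset.sum_eq_zero fun z _ => ?_
    split_ifs with h
    · rw [t_one_mul_t_one, if_neg, smul_zero, smul_zero]
      intro h'
      exact hy (by rw [h', ← h, inv_inv])
    · rw [mul_zero, smul_zero, smul_zero]
  · simp

theorem antipode_associator_inv : LinearMap.mul' K (QHAlg ξ)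
    (TensorProduct.map (LinearMap.mulRight K 1 ∘ₗ antipode) (LinearMap.mul' K (QHAlg ξ) ∘ₗ
      TensorProduct.map (LinearMap.mulRight K beta) antipode) (associator ξ)⁻¹.val) = 1 := by
  rw [associator_inv, D₃, E₃]
  simp only [map_sum, map_smul, TensorProduct.map_tmul, LinearMap.comp_apply,
    LinearMap.mulRight_apply, mul_one, LinearMap.mul'_apply, antipode_t_one,
    t_mul_beta, t_one_mul_t_one, smul_mul_assoc]
  rw [one_def, ← Equiv.sum_comp (Equiv.inv X) fun x => t ξ x 1]
  refine Finset.sum_congr rfl fun x _ => ?_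
  rw [Finset.sum_eq_single x⁻¹, Finset.sum_eq_single x]
  · rw [if_pos rfl, mul_smul_comm, t_one_mul_t_one, if_pos rfl, smul_smul, ← Units.val_mul,
      inv_inv, inv_mul_cancel, Units.val_one, one_smul]
    rfl
  · intro z _ hz
    rw [if_neg (fun h => hz (inv_injective h).symm), smul_zero, mul_zero, smul_zero]
  · simp
  · intro y _ hy
    refine Finset.sum_eq_zero fun z _ => ?_
    split_ifs with h
    · rw [mul_smul_comm, t_one_mul_t_one, if_neg, smul_zero, smul_zero]
      intro h'
      exact hy (by rw [h, h'])
    · rw [smul_zero, mul_zero, smul_zero]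
  · simp

/-- `H(ξ)` as a quasi-triangular quasi-Hopf algebra. -/
noncomputable instance [Finite G] : QuasiTriangularQuasiHopf K (QHAlg ξ) where
  R := rMatrix ξ
  R_comm := R_comm
  hexagon₁ := hexagon₁
  hexagon₂ := hexagon₂
  S := antipode
  S_bijective := antipode_bijective
  α := 1
  β := beta
  S_one := antipode_one
  S_mul := antipode_mul
  S_left := antipode_left
  S_right := antipode_right
  S_Φ := antipode_associator
  S_Φ_inv := antipode_associator_inv

end QHAlg

/-! ### Fusion categories -/

/-- A fusion category over an (algebraically closed) field `K`: a `K`-linear rigid tensor category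
which is abelian and semisimple, with finitely many isomorphism classes of simple objects, finite
dimensional spaces of morphisms and simple unit object. -/
structure IsFusionCategory (K : Type*) [Field K] (C : Type*) [Category C] [Preadditive C]
    [Linear K C] [MonoidalCategory C] [MonoidalPreadditive C] [MonoidalLinear K C] : Prop where
  [hasFiniteBiproducts : Limits.HasFiniteBiproducts C]
  hasKernels : Limits.HasKernels C
  hasCokernels : Limits.HasCokernels C
  normalMono : IsNormalMonoCategory C
  normalEpi : IsNormalEpiCategory C
  finite_hom : ∀ V W : C, FiniteDimensional K (V ⟶ W)
  semisimple : ∀ V : C, ∃ (n : ℕ) (S : Fin n → C), (∀ i, Simple (S i)) ∧ Nonempty (V ≅ ⨁ S)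
  finite_simple : ∃ (n : ℕ) (S : Fin n → C), ∀ V : C, Simple V → ∃ i, Nonempty (V ≅ S i)
  simple_unit : Simple (𝟙_ C)
  rigid : Nonempty (RigidCategory C)

/-!
The equivalence is built on identities of underlying spaces. In `H(ξ)` the elements `t_x 1` are
complete orthogonal idempotents, so they grade every module by `X`. Setting `s_g = ∑_x t_x g`, one
has `t_x g = s_g (t_x 1) = (t_{g • x} 1) s_g`; thus `s_g` acts as a map `g ▷` that carries degree
`x` to degree `g • x`, and the multiplication rule of the basis says exactly that
`gh ▷ v = γ_{g,h}(x) (g ▷ (h ▷ v))` in degree `x`. Conversely a graded space with such an action is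
a module in which `t_x g` acts as the projection to degree `x` followed by `g ▷`
(`QHAlg.repOfAction`), and a linear map is `H(ξ)`-linear if and only if it preserves degrees and
commutes with all `g ▷` (`QHAlg.commutes_of_graded`). So `QHMod.equivariantFunctor` is an
equivalence. The formulas for `Δ`, `Φ` and `R` evaluated on homogeneous vectors are those for the
tensor product, the associator and the braiding of equivariant objects (`QHAlg.isTensor_shift`,
`QHAlg.assocHom_eq`, `QHAlg.isBraid_braid`), so the identity maps of tensor products make the
functor braided monoidal.

That `H(ξ)`-modules form a fusion category comes from three facts.

* Finite-dimensional modules over any algebra form an abelian category, whose simple objects are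
  the simple modules; there are finitely many of them if the algebra is semisimple
  (`QHMod.exists_fin_simple`).
* `H(ξ)` is semisimple, by Maschke's argument (`QHAlg.isSemisimpleModule`): although the elements
  `t_x g` do not form a group, each of them has the partial inverse `γ_{g⁻¹,g}(x) t_{g • x} g⁻¹`,
  and the sum over all `x` and `g` of the conjugates of a linear projection is `H(ξ)`-linear, by the
  cocycle identity for `γ`.
* Over any quasi-triangular quasi-Hopf algebra the linear dual, with the action through the
  antipode, is a right dual. The axioms for `S`, `α` and `β` are the linearity of evaluation and
  coevaluation and the triangle identities. Left duals are obtained from the braiding.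

All the properties of a fusion category are invariant under linear monoidal equivalence
(`IsFusionCategory.of_equivalence`), so the category of equivariant objects is a fusion category
as well.
-/

/-! ### The abelian category of finite-dimensional modules over an algebra -/

namespace QHMod

section Abelian

variable {K : Type u} [Field K] {H : Type w} [Ring H] [Algebra K H]

open Limits

/-- The carrier of an object of `QHMod K H` as a module over the ring `H`. -/
noncomputable instance instModuleCarrier (V : QHMod K H) : Module H V.carrier :=
  Module.compHom V.carrier V.ρ.toRingHom

theorem smul_def (V : QHMod K H) (a : H) (v : V.carrier) : a • v = V.ρ a v := rfl

instance instIsScalarTowerCarrier (V : QHMod K H) : IsScalarTower K H V.carrier :=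
  ⟨fun k a v => by rw [smul_def, smul_def, map_smul, LinearMap.smul_apply]⟩

/-- A finite-dimensional `H`-module as an object of `QHMod K H`. -/
noncomputable def of (N : Type u) [AddCommGroup N] [Module K N] [Module H N]
    [IsScalarTower K H N] [FiniteDimensional K N] : QHMod K H where
  carrier := N
  ρ := Algebra.lsmul K K N

/-- An `H`-linear map as a morphism of `QHMod K H`. -/
noncomputable def homMk {V W : QHMod K H} (f : V.carrier →ₗ[H] W.carrier) : V ⟶ W :=
  (⟨f.restrictScalars K, f.map_smul⟩ : homs V W)

/-- A morphism of `QHMod K H` as an `H`-linear map. -/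
noncomputable def toLin {V W : QHMod K H} (f : V ⟶ W) : V.carrier →ₗ[H] W.carrier where
  toFun := lin f
  map_add' := map_add _
  map_smul' a v := lin_ρ f a v

theorem toLin_injective {V W : QHMod K H} {f g : V ⟶ W} (h : toLin f = toLin g) : f = g :=
  hom_ext <| LinearMap.ext fun v => LinearMap.congr_fun h v

theorem toLin_zero {V W : QHMod K H} : toLin (0 : V ⟶ W) = 0 := rfl

theorem toLin_sum {ι : Type*} {V W : QHMod K H} (s : Finset ι) (f : ι → (V ⟶ W)) :
    toLin (∑ i ∈ s, f i) = ∑ i ∈ s, toLin (f i) := by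
  classical
  induction s using Finset.induction_on with
  | empty => rfl
  | insert i s hi h => rw [Finset.sum_insert hi, Finset.sum_insert hi, ← h]; rfl

/-- A linear equivalence as an isomorphism of `QHMod K H`. -/
noncomputable def isoMk {V W : QHMod K H} (e : V.carrier ≃ₗ[H] W.carrier) : V ≅ W where
  hom := homMk e.toLinearMap
  inv := homMk e.symm.toLinearMap
  hom_inv_id := toLin_injective e.symm_comp
  inv_hom_id := toLin_injective e.comp_symm

/-- An isomorphism of `QHMod K H` as a linear equivalence. -/
noncomputable def isoToEquiv {V W : QHMod K H} (e : V ≅ W) : V.carrier ≃ₗ[H] W.carrier :=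
  LinearEquiv.ofLinearMap (toLin e.hom) (toLin e.inv) (congrArg toLin e.inv_hom_id)
    (congrArg toLin e.hom_inv_id)

theorem isIso_iff_bijective {V W : QHMod K H} (f : V ⟶ W) :
    IsIso f ↔ Function.Bijective (toLin f) :=
  ⟨fun _ => (isoToEquiv (asIso f)).bijective,
    fun h => (isoMk (LinearEquiv.ofBijective (toLin f) h)).isIso_hom⟩

instance (V W : QHMod K H) : FiniteDimensional K (V ⟶ W) :=
  inferInstanceAs (FiniteDimensional K (homs V W))

instance (V : QHMod K H) (N : Submodule H V.carrier) : FiniteDimensional K N :=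
  inferInstanceAs (FiniteDimensional K (N.restrictScalars K))

instance (V : QHMod K H) (N : Submodule H V.carrier) : FiniteDimensional K (V.carrier ⧸ N) :=
  inferInstanceAs (FiniteDimensional K (V.carrier ⧸ N.restrictScalars K))

/-- The submodule `N` of `V` as an object. -/
noncomputable abbrev sub (V : QHMod K H) (N : Submodule H V.carrier) : QHMod K H := of N

/-- The inclusion of a submodule. -/
noncomputable def subι (V : QHMod K H) (N : Submodule H V.carrier) : sub V N ⟶ V :=
  homMk (V := sub V N) N.subtype

/-- The quotient of `V` by a submodule as an object. -/
noncomputable abbrev quot (V : QHMod K H) (N : Submodule H V.carrier) : QHMod K H :=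
  of (V.carrier ⧸ N)

/-- The projection onto a quotient module. -/
noncomputable def quotπ (V : QHMod K H) (N : Submodule H V.carrier) : V ⟶ quot V N :=
  homMk (W := quot V N) N.mkQ

theorem comp_eq_zero_iff {U V W : QHMod K H} (f : U ⟶ V) (g : V ⟶ W) :
    f ≫ g = 0 ↔ LinearMap.range (toLin f) ≤ LinearMap.ker (toLin g) := by
  rw [LinearMap.range_le_ker_iff]
  exact ⟨fun h => congrArg toLin h, fun h => toLin_injective h⟩

theorem mono_iff_injective {V W : QHMod K H} (f : V ⟶ W) :
    Mono f ↔ Function.Injective (toLin f) := by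
  refine ⟨fun _ => ?_, fun h => ⟨fun g g' e => ?_⟩⟩
  · rw [← LinearMap.ker_eq_bot, eq_bot_iff]
    have h0 : subι V (LinearMap.ker (toLin f)) = 0 := by
      rw [← cancel_mono f, zero_comp]
      exact toLin_injective <| LinearMap.ext fun v => v.2
    intro v hv
    exact LinearMap.congr_fun (congrArg toLin h0) ⟨v, hv⟩
  · exact toLin_injective <| LinearMap.ext fun v => h (LinearMap.congr_fun (congrArg toLin e) v)

theorem epi_iff_surjective {V W : QHMod K H} (f : V ⟶ W) :
    Epi f ↔ Function.Surjective (toLin f) := by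
  refine ⟨fun _ => ?_, fun h => ⟨fun g g' e => ?_⟩⟩
  · rw [← LinearMap.range_eq_top, eq_top_iff]
    have h0 : quotπ W (LinearMap.range (toLin f)) = 0 := by
      rw [← cancel_epi f, comp_zero]
      exact toLin_injective <| LinearMap.ext fun v =>
        (Submodule.Quotient.mk_eq_zero _).2 (LinearMap.mem_range_self (toLin f) v)
    intro w _
    exact (Submodule.Quotient.mk_eq_zero _).1 (LinearMap.congr_fun (congrArg toLin h0) w)
  · refine toLin_injective <| LinearMap.ext fun w => ?_
    obtain ⟨v, rfl⟩ := h w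
    exact LinearMap.congr_fun (congrArg toLin e) v

/-- An injective map whose range is the kernel of `g` is a kernel of `g`. -/
noncomputable def isLimitOfExact {U V W : QHMod K H} (f : U ⟶ V) (g : V ⟶ W)
    (hf : Function.Injective (toLin f))
    (h : LinearMap.range (toLin f) = LinearMap.ker (toLin g)) :
    IsLimit (KernelFork.ofι f ((comp_eq_zero_iff f g).2 h.le)) :=
  have : Mono f := (mono_iff_injective f).2 hf
  KernelFork.IsLimit.ofι' f _ fun {A} k hk =>
    ⟨homMk ((LinearEquiv.ofInjective (toLin f) hf).symm.toLinearMap ∘ₗ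
      (toLin k).codRestrict _ fun a => by
        rw [h]; exact LinearMap.congr_fun (congrArg toLin hk) a),
      toLin_injective <| LinearMap.ext fun a =>
        congrArg Subtype.val (LinearEquiv.apply_symm_apply (LinearEquiv.ofInjective (toLin f) hf)
          ⟨toLin k a, by rw [h]; exact LinearMap.congr_fun (congrArg toLin hk) a⟩)⟩

/-- A surjective map whose kernel is the range of `f` is a cokernel of `f`. -/
noncomputable def isColimitOfExact {U V W : QHMod K H} (f : U ⟶ V) (g : V ⟶ W)
    (hg : Function.Surjective (toLin g))
    (h : LinearMap.range (toLin f) = LinearMap.ker (toLin g)) :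
    IsColimit (CokernelCofork.ofπ g ((comp_eq_zero_iff f g).2 h.le)) :=
  have : Epi g := (epi_iff_surjective g).2 hg
  CokernelCofork.IsColimit.ofπ' g _ fun {A} k hk =>
    ⟨homMk ((LinearMap.ker (toLin g)).liftQ (toLin k)
        (h.symm.le.trans ((comp_eq_zero_iff f k).1 hk)) ∘ₗ
      ((toLin g).quotKerEquivOfSurjective hg).symm.toLinearMap),
      toLin_injective <| LinearMap.ext fun a => by
        change (LinearMap.ker (toLin g)).liftQ (toLin k)
          (h.symm.le.trans ((comp_eq_zero_iff f k).1 hk))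
            (((toLin g).quotKerEquivOfSurjective hg).symm (toLin g a)) = _
        have : (toLin g).quotKerEquivOfSurjective hg (Submodule.Quotient.mk a) = toLin g a := rfl
        rw [← this, LinearEquiv.symm_apply_apply]
        exact Submodule.liftQ_apply _ _ a⟩

theorem subι_injective (V : QHMod K H) (N : Submodule H V.carrier) :
    Function.Injective (toLin (subι V N)) := Subtype.val_injective

theorem range_subι (V : QHMod K H) (N : Submodule H V.carrier) :
    LinearMap.range (toLin (subι V N)) = N := Submodule.range_subtype N

theorem quotπ_surjective (V : QHMod K H) (N : Submodule H V.carrier) :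
    Function.Surjective (toLin (quotπ V N)) := Submodule.mkQ_surjective N

theorem ker_quotπ (V : QHMod K H) (N : Submodule H V.carrier) :
    LinearMap.ker (toLin (quotπ V N)) = N := Submodule.ker_mkQ N

instance : HasKernels (QHMod K H) where
  has_limit f := ⟨⟨_, isLimitOfExact (subι _ (LinearMap.ker (toLin f))) f (subι_injective _ _)
    (range_subι _ _)⟩⟩

instance : HasCokernels (QHMod K H) where
  has_colimit f := ⟨⟨_, isColimitOfExact f (quotπ _ (LinearMap.range (toLin f)))
    (quotπ_surjective _ _) (ker_quotπ _ _).symm⟩⟩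

instance : IsNormalMonoCategory (QHMod K H) where
  normalMonoOfMono f hf := ⟨{
    Z := _
    g := quotπ _ (LinearMap.range (toLin f))
    w := _
    isLimit := isLimitOfExact f _ ((mono_iff_injective f).1 hf) (ker_quotπ _ _).symm }⟩

instance : IsNormalEpiCategory (QHMod K H) where
  normalEpiOfEpi f hf := ⟨{
    W := _
    g := subι _ (LinearMap.ker (toLin f))
    w := _
    isColimit := isColimitOfExact _ f ((epi_iff_surjective f).1 hf) (range_subι _ _) }⟩

/-- The direct sum of a finite family of modules, as a bicone. -/
noncomputable def piBicone {J : Type} [Fintype J] [DecidableEq J] (V : J → QHMod K H) :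
    Bicone V where
  pt := of (∀ j, (V j).carrier)
  π j := homMk (V := of (∀ j, (V j).carrier)) (LinearMap.proj j)
  ι j := homMk (W := of (∀ j, (V j).carrier)) (LinearMap.single H (fun j => (V j).carrier) j)
  ι_π i j := by
    split_ifs with h
    · subst h
      exact toLin_injective (LinearMap.proj_comp_single_same H (fun j => (V j).carrier) i)
    · exact toLin_injective (LinearMap.proj_comp_single_ne H (fun j => (V j).carrier) j i
        (Ne.symm h))

/-- The direct sum of modules is a biproduct. -/
noncomputable def isBilimitPiBicone {J : Type} [Fintype J] [DecidableEq J] (V : J → QHMod K H) :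
    (piBicone V).IsBilimit :=
  isBilimitOfTotal _ <| toLin_injective <| by
    rw [toLin_sum]
    refine LinearMap.ext fun v => ?_
    rw [LinearMap.sum_apply]
    exact LinearMap.sum_single_apply (fun j => (V j).carrier) v

instance : HasFiniteBiproducts (QHMod K H) :=
  ⟨fun _ => ⟨fun V => ⟨⟨_, isBilimitPiBicone V⟩⟩⟩⟩

theorem simple_iff_isSimpleModule (V : QHMod K H) : Simple V ↔ IsSimpleModule H V.carrier := by
  constructor
  · intro hV
    rw [isSimpleModule_iff, isSimpleOrder_iff]
    refine ⟨?_, fun N => ?_⟩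
    · rw [Submodule.nontrivial_iff]
      by_contra h
      rw [not_nontrivial_iff_subsingleton] at h
      refine id_nonzero V (toLin_injective <| LinearMap.ext fun v => h.elim _ _)
    · have : Mono (subι V N) := (mono_iff_injective _).2 (subι_injective V N)
      by_cases h : subι V N = 0
      · left
        rw [← range_subι V N, h, toLin_zero, LinearMap.range_zero]
      · right
        have := (isIso_iff_bijective _).1 (isIso_of_mono_of_nonzero h)
        rw [← range_subι V N, LinearMap.range_eq_top]
        exact this.2
  · intro hV
    refine ⟨fun {U} f hf => ?_⟩
    rw [mono_iff_injective] at hf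
    rw [isIso_iff_bijective]
    have := IsSimpleModule.nontrivial H V.carrier
    constructor
    · rintro h rfl
      obtain ⟨v, hv⟩ := exists_ne (0 : V.carrier)
      obtain ⟨u, rfl⟩ := h.2 v
      exact hv rfl
    · intro h
      refine ⟨hf, ?_⟩
      rw [← LinearMap.range_eq_top]
      refine (eq_bot_or_eq_top (LinearMap.range (toLin f))).resolve_left fun h0 => h ?_
      exact toLin_injective (LinearMap.range_eq_bot.1 h0)

theorem simple_of_finrank_eq_one {V : QHMod K H} (h : Module.finrank K V.carrier = 1) :
    Simple V := by
  rw [simple_iff_isSimpleModule, isSimpleModule_iff, isSimpleOrder_iff]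
  refine ⟨?_, fun N => ?_⟩
  · rw [Submodule.nontrivial_iff]
    exact Module.nontrivial_of_finrank_pos (R := K) (by rw [h]; exact one_pos)
  · have hs : IsSimpleModule K V.carrier := isSimpleModule_iff_finrank_eq_one.2 h
    refine (eq_bot_or_eq_top (N.restrictScalars K)).imp ?_ ?_
    · exact (Submodule.restrictScalars_eq_bot_iff _ _ _).1
    · exact (Submodule.restrictScalars_eq_top_iff _ _ _).1

end Abelian

section Semisimple

variable {K : Type u} [Field K] {H : Type w} [Ring H] [Algebra K H]

open Limits

theorem exists_iso_biproduct_simple (V : QHMod K H) [IsSemisimpleModule H V.carrier] :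
    ∃ (n : ℕ) (S : Fin n → QHMod K H), (∀ i, Simple (S i)) ∧ Nonempty (V ≅ ⨁ S) := by
  have : Module.Finite H V.carrier := Module.Finite.of_restrictScalars_finite K H V.carrier
  obtain ⟨n, N, e, hN⟩ := IsSemisimpleModule.exists_linearEquiv_fin_dfinsupp H V.carrier
  refine ⟨n, fun i => sub V (N i), fun i => (simple_iff_isSimpleModule _).2 (hN i), ⟨?_⟩⟩
  refine isoMk (W := (piBicone fun i => sub V (N i)).pt)
    (e.trans (DFinsupp.linearEquivFunOnFintype (R := H) (M := fun i => N i))) ≪≫ ?_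
  exact biproduct.uniqueUpToIso _ (isBilimitPiBicone fun i => sub V (N i))

/-- Simple modules over a semisimple ring `H` are classified by the isotypic components of the
regular module, of which there are finitely many. -/
theorem exists_fin_simple [IsSemisimpleRing H] :
    ∃ (n : ℕ) (S : Fin n → QHMod K H), ∀ V : QHMod K H, Simple V → ∃ i, Nonempty (V ≅ S i) := by
  have key : ∀ V : QHMod K H, Simple V → ∃ I : Ideal H, IsSimpleModule H I ∧
      Nonempty (V.carrier ≃ₗ[H] I) := fun V hV => by
    have := (simple_iff_isSimpleModule V).1 hV
    obtain ⟨I, ⟨e⟩⟩ := IsSemisimpleRing.exists_linearEquiv_ideal_of_isSimpleModule H V.carrier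
    exact ⟨I, IsSimpleModule.congr e.symm, ⟨e⟩⟩
  let T := {V : QHMod K H // Simple V}
  -- Assign to `V` the isotypic component of its type in the regular module.
  let comp : T → isotypicComponents H H := fun V => ⟨isotypicComponent H H V.1.carrier, by
    obtain ⟨I, hI, ⟨e⟩⟩ := key V.1 V.2
    exact ⟨I, hI, e.isotypicComponent_eq⟩⟩
  have hcomp : ∀ V W : T, comp V = comp W → Nonempty (V.1 ≅ W.1) := fun V W h => by
    obtain ⟨I, hI, ⟨e⟩⟩ := key V.1 V.2
    obtain ⟨J, hJ, ⟨f⟩⟩ := key W.1 W.2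
    have h' : isotypicComponent H H I = isotypicComponent H H J := by
      rw [← e.isotypicComponent_eq, ← f.isotypicComponent_eq]
      exact congrArg Subtype.val h
    obtain ⟨g⟩ := isIsotypicOfType_submodule_iff.mp (.isotypicComponent H H J) I
      ((Submodule.le_isotypicComponent I).trans h'.le)
    exact ⟨isoMk (e.trans (g.trans f.symm))⟩
  obtain ⟨n, ⟨E⟩⟩ := Finite.exists_equiv_fin (Set.range comp)
  refine ⟨n, fun i => (Classical.choose (E.symm i).2).1, fun V hV =>
    ⟨E ⟨comp ⟨V, hV⟩, _, rfl⟩, hcomp ⟨V, hV⟩ _ ?_⟩⟩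
  rw [Classical.choose_spec (E.symm _).2, Equiv.symm_apply_apply]

end Semisimple

end QHMod

/-! ### Semisimplicity of `H(ξ)` -/

namespace QHAlg

variable {K : Type u} [Field K] {X : Type v} {G : Type w} [Group X] [Group G]
  [MulDistribMulAction G X] {M : CrossedModule X G} {ξ : NormalizedCocycle K M}
  [Fintype X] [DecidableEq X]

variable (ξ) in
/-- The element `γ_{g⁻¹,g}(x) t_{g • x} g⁻¹`, which is inverse to `t_x g` in the sense that
`tInv x g * t x g = t x 1`. -/
noncomputable def tInv (x : X) (g : G) : QHAlg ξ := (ξ.γ g⁻¹ g x : K) • t ξ (g • x) g⁻¹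

theorem tInv_mul_t (x : X) (g : G) : tInv ξ x g * t ξ x g = t ξ x 1 := by
  rw [tInv, smul_mul_assoc, t_mul_t, if_pos rfl, smul_smul, Units.mul_inv, one_smul,
    inv_mul_cancel]

/-- Left multiplication by `t_y h` turns the inverse of `t_x (g h)` into a multiple of the inverse
of a basis element `t_{x'} g`; this makes the sum of conjugates in `conjSum` invariant. -/
theorem t_mul_tInv (x y : X) (g h : G) : t ξ y h * tInv ξ x (g * h) =
    if x = y then (((ξ.γ g h y)⁻¹ : Kˣ) : K) • tInv ξ (h • y) g else 0 := by
  rw [tInv, mul_smul_comm, t_mul_t, inv_smul_smul]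
  by_cases hx : x = y
  · subst hx
    rw [if_pos rfl, if_pos rfl, tInv, smul_smul, smul_smul, ← Units.val_mul, ← Units.val_mul,
      mul_smul, mul_inv_rev, mul_inv_cancel_left]
    congr 2
    have h1 := ξ.γ_cocycle g⁻¹ g h x
    have h2 := ξ.γ_cocycle h (g * h)⁻¹ (g * h) x
    rw [inv_mul_cancel, ξ.γ_one₁, one_mul] at h1
    rw [inv_mul_cancel, ξ.γ_one₂, mul_one, mul_inv_rev, mul_inv_cancel_left, mul_smul] at h2
    rw [h2, ← h1]
    rw [mul_inv_cancel_right, inv_mul_cancel_left]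
  · rw [if_neg hx, if_neg (Ne.symm hx), smul_zero]

section Average

variable {N : Type*} [AddCommGroup N] [Module K N] [Module (QHAlg ξ) N]
  [IsScalarTower K (QHAlg ξ) N] [Fintype G]

variable (ξ) in
/-- The sum `∑ s_{x,g} ∘ π ∘ (t_x g)` of the conjugates of `π`, where `s_{x,g}` is the inverse of
`t_x g`. -/
noncomputable def conjSum (π : N →ₗ[K] N) : N →ₗ[K] N :=
  ∑ g : G, ∑ x : X, Algebra.lsmul K K N (tInv ξ x g) ∘ₗ π ∘ₗ Algebra.lsmul K K N (t ξ x g)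

theorem conjSum_apply (π : N →ₗ[K] N) (v : N) :
    conjSum ξ π v = ∑ g : G, ∑ x : X, tInv ξ x g • π (t ξ x g • v) := by
  simp [conjSum]

theorem conjSum_smul (π : N →ₗ[K] N) (a : QHAlg ξ) (v : N) :
    conjSum ξ π (a • v) = a • conjSum ξ π v := by
  induction a using induction with
  | zero => simp only [zero_smul, map_zero]
  | add a a' h h' => simp only [add_smul, map_add, h, h']
  | smul k a h => simp only [smul_assoc, map_smul, h]
  | single y h =>
    rw [conjSum_apply, conjSum_apply, ← Equiv.sum_comp (Equiv.mulRight h)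
      (fun g => ∑ x : X, tInv ξ x g • π (t ξ x g • v)), Finset.smul_sum]
    refine Finset.sum_congr rfl fun g _ => ?_
    rw [Finset.smul_sum, Finset.sum_eq_single (h • y), Finset.sum_eq_single y]
    · rw [Equiv.coe_mulRight, smul_smul, smul_smul, t_mul_t, if_pos rfl, t_mul_tInv, if_pos rfl,
        smul_assoc, smul_assoc, map_smul, smul_comm]
    · intro x _ hx
      rw [Equiv.coe_mulRight, smul_smul, t_mul_tInv, if_neg hx, zero_smul]
    · simp
    · intro x _ hx
      rw [smul_smul, t_mul_t, if_neg hx, zero_smul, map_zero, smul_zero]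
    · simp

/-- Maschke's theorem for `H(ξ)`: a linear projection onto a submodule becomes `H(ξ)`-linear upon
averaging its conjugates by the elements `t_x g`. -/
theorem isSemisimpleModule [CharZero K] : IsSemisimpleModule (QHAlg ξ) N := by
  refine (isSemisimpleModule_iff _ _).2 ⟨fun P => ?_⟩
  obtain ⟨π, hπ⟩ := (P.restrictScalars K).subtype.exists_leftInverse_of_injective
    (LinearMap.ker_eq_bot.2 Subtype.val_injective)
  have hG : (Fintype.card G : K) ≠ 0 := Nat.cast_ne_zero.2 Fintype.card_ne_zero
  let π' : N →ₗ[K] N := (P.restrictScalars K).subtype ∘ₗ π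
  have hmem : ∀ v, π' v ∈ P := fun v => (π v).2
  have hid : ∀ v ∈ P, π' v = v := fun v hv =>
    congrArg Subtype.val (LinearMap.congr_fun hπ ⟨v, hv⟩)
  let f : N →ₗ[QHAlg ξ] P :=
    { toFun := fun v => ⟨(Fintype.card G : K)⁻¹ • conjSum ξ π' v, by
        rw [conjSum_apply]
        exact Submodule.smul_of_tower_mem P _ (Submodule.sum_mem _ fun g _ =>
          Submodule.sum_mem _ fun x _ => P.smul_mem _ (hmem _))⟩
      map_add' := fun v v' => Subtype.ext (by
        simp only [map_add, smul_add, Submodule.coe_add])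
      map_smul' := fun a v => Subtype.ext (by
        simp only [conjSum_smul, RingHom.id_apply, Submodule.coe_smul]
        rw [smul_comm]) }
  refine ⟨LinearMap.ker f, LinearMap.isCompl_of_proj (f := f) fun v => Subtype.ext ?_⟩
  change (Fintype.card G : K)⁻¹ • conjSum ξ π' (v : N) = v
  have : ∀ g : G, ∑ x : X, tInv ξ x g • π' (t ξ x g • (v : N)) = v := fun g => by
    simp_rw [hid _ (P.smul_mem _ v.2), smul_smul, tInv_mul_t, ← Finset.sum_smul, ← one_def,
      one_smul]
  rw [conjSum_apply, Finset.sum_congr rfl fun g _ => this g, Finset.sum_const, Finset.card_univ,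
    ← Nat.cast_smul_eq_nsmul K, smul_smul, inv_mul_cancel₀ hG, one_smul]

instance [CharZero K] : IsSemisimpleRing (QHAlg ξ) := isSemisimpleModule (N := QHAlg ξ)

end Average

end QHAlg

/-! ### Duals of modules over a quasi-triangular quasi-Hopf algebra -/

namespace QuasiHopf

section Dual

variable {K : Type*} [Field K] {H : Type*} [Ring H] [Algebra K H] [QuasiTriangularQuasiHopf K H]
  {V : Type*} [AddCommGroup V] [Module K V] (ρ : H →ₐ[K] Module.End K V)

open QuasiBialgebra QuasiTriangularQuasiHopf Module

/-- The dual of a module: `(a f)(v) = f (S(a) v)`. -/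
noncomputable def dualRep : H →ₐ[K] Module.End K (Dual K V) :=
  AlgHom.ofLinearMap (Module.Dual.transpose (R := K) ∘ₗ ρ.toLinearMap ∘ₗ S (K := K))
    (by
      refine LinearMap.ext fun f => LinearMap.ext fun v => ?_
      change f (ρ (S (K := K) 1) v) = f v
      rw [S_one, map_one, Module.End.one_apply])
    (fun a b => by
      refine LinearMap.ext fun f => LinearMap.ext fun v => ?_
      change f (ρ (S (K := K) (a * b)) v) = f (ρ (S (K := K) b) (ρ (S (K := K) a) v))
      rw [S_mul, map_mul, Module.End.mul_apply])

@[simp] theorem dualRep_apply (a : H) (f : Dual K V) (v : V) :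
    dualRep ρ a f v = f (ρ (S (K := K) a) v) := rfl

/-- The evaluation `f ⊗ v ↦ f (α v)`. -/
noncomputable def ev : Dual K V ⊗[K] V →ₗ[K] K :=
  contractLeft K V ∘ₗ TensorProduct.map LinearMap.id (ρ (α (K := K)))

@[simp] theorem ev_tmul (f : Dual K V) (v : V) : ev ρ (f ⊗ₜ v) = f (ρ (α (K := K)) v) := rfl

theorem ev_tens (x : H ⊗[K] H) (f : Dual K V) (v : V) :
    ev ρ (tens (dualRep ρ) ρ x (f ⊗ₜ v)) = f (ρ (LinearMap.mul' K H
      (TensorProduct.map (LinearMap.mulRight K (α (K := K)) ∘ₗ S (K := K)) LinearMap.id x)) v) := by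
  induction x with
  | zero => simp
  | add x y hx hy => simp only [map_add, LinearMap.add_apply, hx, hy]
  | tmul a b => simp [tens_tmul]

/-- The evaluation is `H`-linear because `∑ S(a₁) α a₂ = ε(a) α`. -/
theorem ev_rep (a : H) (t : Dual K V ⊗[K] V) :
    ev ρ (tensorRep (dualRep ρ) ρ a t) = unitRep K H a (ev ρ t) := by
  induction t with
  | zero => simp
  | add x y hx hy => simp only [map_add, hx, hy]
  | tmul f v =>
    rw [tensorRep, AlgHom.comp_apply, ev_tens, S_left]
    simp [unitRep]

variable [FiniteDimensional K V]

/-- The coevaluation `1 ↦ ∑ β e_i ⊗ e^i`, for dual bases `e_i` and `e^i`. -/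
noncomputable def coev : K →ₗ[K] V ⊗[K] Dual K V :=
  TensorProduct.map (ρ (β (K := K))) LinearMap.id ∘ₗ coevaluation K V

theorem coev_apply (k : K) : coev ρ k = k • coev ρ 1 := by
  rw [← map_smul, smul_eq_mul, mul_one]

theorem coev_one : coev ρ 1 = ∑ i, ρ (β (K := K)) (Basis.ofVectorSpace K V i) ⊗ₜ[K]
    (Basis.ofVectorSpace K V).coord i := by
  rw [coev, LinearMap.comp_apply, coevaluation_apply_one, map_sum]
  rfl

theorem sum_coord_smul {ι W : Type*} [Fintype ι] [AddCommGroup W] [Module K W] (b : Basis ι K V)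
    (f : V →ₗ[K] W) (v : V) : ∑ i, b.coord i v • f (b i) = f v := by
  simp_rw [← map_smul, ← map_sum, Basis.coord_apply, b.sum_repr]

/-- In `V ⊗ V* = End V`, the image of the coevaluation under `a ⊗ b` is `a β S(b)`. -/
theorem dualTensorHom_coev (x : H ⊗[K] H) :
    dualTensorHom K V V (TensorProduct.comm K _ _ (tens ρ (dualRep ρ) x (coev ρ 1))) =
      ρ (LinearMap.mul' K H
        (TensorProduct.map (LinearMap.mulRight K (β (K := K))) (S (K := K)) x)) := by
  induction x with
  | zero => simp
  | add x y hx hy => simp only [map_add, LinearMap.add_apply, hx, hy]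
  | tmul a b =>
    refine LinearMap.ext fun w => ?_
    simp only [coev_one, tens_tmul, map_sum, TensorProduct.map_tmul, TensorProduct.comm_tmul,
      LinearMap.sum_apply, dualTensorHom_apply, dualRep_apply, LinearMap.mul'_apply,
      LinearMap.mulRight_apply, map_mul, Module.End.mul_apply]
    exact sum_coord_smul (Basis.ofVectorSpace K V) (ρ a ∘ₗ ρ (β (K := K))) _

/-- The coevaluation is `H`-linear because `∑ a₁ β S(a₂) = ε(a) β`. -/
theorem coev_rep_one (a : H) :
    tensorRep ρ (dualRep ρ) a (coev ρ 1) = ε (K := K) a • coev ρ 1 := by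
  refine (TensorProduct.comm K V (Dual K V)).injective
    ((dualTensorHomEquiv K V V).injective ?_)
  have h1 := dualTensorHom_coev ρ (1 : H ⊗[K] H)
  rw [map_one, Module.End.one_apply] at h1
  change dualTensorHom K V V _ = dualTensorHom K V V _
  rw [map_smul, map_smul, h1, tensorRep, AlgHom.comp_apply, dualTensorHom_coev, S_right,
    map_smul, Algebra.TensorProduct.one_def]
  simp [S_one]

theorem coev_rep (a : H) (k : K) :
    coev ρ (unitRep K H a k) = tensorRep ρ (dualRep ρ) a (coev ρ k) := by
  have hk' : unitRep K H a k = ε (K := K) a • k := rfl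
  rw [hk', map_smul, coev_apply ρ k, map_smul, coev_rep_one, smul_comm]

/-- The composite `V → (V ⊗ V*) ⊗ V → V ⊗ (V* ⊗ V) → V` of coevaluation, `a ⊗ b ⊗ c` and evaluation
is the action of `a β S(b) α c`. -/
theorem rid_map_ev (x : H ⊗[K] (H ⊗[K] H)) (v : V) :
    TensorProduct.rid K V (TensorProduct.map LinearMap.id (ev ρ)
      (tens ρ (tens (dualRep ρ) ρ) x (TensorProduct.assoc K _ _ _ (coev ρ 1 ⊗ₜ v)))) =
    ρ (LinearMap.mul' K H (TensorProduct.map (LinearMap.mulRight K (β (K := K)))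
      (LinearMap.mul' K H ∘ₗ TensorProduct.map (LinearMap.mulRight K (α (K := K)) ∘ₗ S (K := K))
        LinearMap.id) x)) v := by
  induction x with
  | zero => simp
  | add x y hx hy => simp only [map_add, LinearMap.add_apply, hx, hy]
  | tmul a y =>
    induction y with
    | zero => simp
    | add x y hx hy => simp only [TensorProduct.tmul_add, map_add, LinearMap.add_apply, hx, hy]
    | tmul b c =>
      simp only [coev_one, tens_tmul, TensorProduct.sum_tmul, map_sum, TensorProduct.assoc_tmul,
        TensorProduct.map_tmul, ev_tmul, dualRep_apply, TensorProduct.rid_tmul,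
        LinearMap.id_apply, LinearMap.comp_apply, LinearMap.mul'_apply,
        LinearMap.mulRight_apply, map_mul, Module.End.mul_apply]
      exact sum_coord_smul (Basis.ofVectorSpace K V) (ρ a ∘ₗ ρ (β (K := K))) _

/-- The composite `V* → V* ⊗ (V ⊗ V*) → (V* ⊗ V) ⊗ V* → V*` of coevaluation, `a ⊗ b ⊗ c` and
evaluation is the transpose of the action of `S(a) α b β S(c)`. -/
theorem lid_map_ev (x : H ⊗[K] (H ⊗[K] H)) (f : Dual K V) (v : V) :
    TensorProduct.lid K (Dual K V) (TensorProduct.map (ev ρ) LinearMap.id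
      ((TensorProduct.assoc K _ _ _).symm
        (tens (dualRep ρ) (tens ρ (dualRep ρ)) x (f ⊗ₜ coev ρ 1)))) v =
    f (ρ (LinearMap.mul' K H (TensorProduct.map (LinearMap.mulRight K (α (K := K)) ∘ₗ S (K := K))
      (LinearMap.mul' K H ∘ₗ TensorProduct.map (LinearMap.mulRight K (β (K := K)))
        (S (K := K))) x)) v) := by
  induction x with
  | zero => simp
  | add x y hx hy => simp only [map_add, LinearMap.add_apply, hx, hy]
  | tmul a y =>
    induction y with
    | zero => simp
    | add x y hx hy => simp only [TensorProduct.tmul_add, map_add, LinearMap.add_apply, hx, hy]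
    | tmul b c =>
      simp only [coev_one, tens_tmul, TensorProduct.tmul_sum, map_sum,
        TensorProduct.assoc_symm_tmul, TensorProduct.map_tmul, ev_tmul, dualRep_apply,
        TensorProduct.lid_tmul, LinearMap.id_apply, LinearMap.comp_apply, LinearMap.mul'_apply,
        LinearMap.mulRight_apply, map_mul, Module.End.mul_apply, LinearMap.sum_apply,
        LinearMap.smul_apply]
      refine Eq.trans (Finset.sum_congr rfl fun i _ => ?_) (sum_coord_smul
        (Basis.ofVectorSpace K V) (f ∘ₗ ρ (S (K := K) a) ∘ₗ ρ (α (K := K)) ∘ₗ ρ b ∘ₗ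
          ρ (β (K := K))) (ρ (S (K := K) c) v))
      rw [smul_eq_mul, smul_eq_mul, mul_comm]
      rfl

theorem ev_coev (f : Dual K V) (k : K) :
    TensorProduct.map (ev ρ) LinearMap.id (assocInv (dualRep ρ) ρ (dualRep ρ) (f ⊗ₜ coev ρ k)) =
      (TensorProduct.lid K _).symm (TensorProduct.rid K _ (f ⊗ₜ k)) := by
  rw [LinearEquiv.eq_symm_apply, assocInv_apply, coev_apply, TensorProduct.tmul_smul, map_smul,
    map_smul, map_smul, map_smul, TensorProduct.rid_tmul]
  congr 1
  refine LinearMap.ext fun v => ?_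
  rw [lid_map_ev, S_Φ_inv, map_one, Module.End.one_apply]

theorem coev_ev (k : K) (v : V) :
    TensorProduct.map LinearMap.id (ev ρ) (assocHom ρ (dualRep ρ) ρ (coev ρ k ⊗ₜ v)) =
      (TensorProduct.rid K _).symm (TensorProduct.lid K _ (k ⊗ₜ v)) := by
  rw [LinearEquiv.eq_symm_apply, assocHom_apply, coev_apply, ← TensorProduct.smul_tmul', map_smul,
    map_smul, map_smul, map_smul, TensorProduct.lid_tmul, rid_map_ev, S_Φ, map_one,
    Module.End.one_apply]

end Dual

end QuasiHopf

namespace QHMod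

open QuasiHopf QuasiBialgebra QuasiTriangularQuasiHopf

variable {K : Type u} [Field K] {H : Type w} [Ring H] [Algebra K H]
  [QuasiTriangularQuasiHopf K H]

/-- The dual module, with the action `(a f)(v) = f (S(a) v)`. -/
noncomputable def dual (V : QHMod K H) : QHMod K H where
  carrier := Module.Dual K V.carrier
  ρ := dualRep V.ρ

/-- The two triangle identities are the axioms `∑ X β S(Y) α Z = 1` and
`∑ S(P) α Q β S(T) = 1` for `Φ = ∑ X ⊗ Y ⊗ Z` and `Φ⁻¹ = ∑ P ⊗ Q ⊗ T`. -/
noncomputable instance (V : QHMod K H) : ExactPairing V (dual V) where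
  coevaluation' := (⟨coev V.ρ, coev_rep V.ρ⟩ : homs (unit K H) (tensorObj V (dual V)))
  evaluation' := (⟨ev V.ρ, ev_rep V.ρ⟩ : homs (tensorObj (dual V) V) (unit K H))
  coevaluation_evaluation' := hom_ext <| TensorProduct.ext' (ev_coev V.ρ)
  evaluation_coevaluation' := hom_ext <| TensorProduct.ext' (coev_ev V.ρ)

noncomputable instance : RightRigidCategory (QHMod K H) where
  rightDual V := { rightDual := dual V }

end QHMod

/-! ### Representations of `H(ξ)` as graded spaces with a twisted action -/

namespace QHAlg

variable {K : Type u} [Field K] {X : Type v} {G : Type w} [Group X] [Group G]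
  [MulDistribMulAction G X] {M : CrossedModule X G} {ξ : NormalizedCocycle K M}
  [Fintype X] [DecidableEq X]

theorem t_mul_t_one (x y : X) (g : G) : t ξ x g * t ξ y 1 = if x = y then t ξ y g else 0 := by
  rw [t_mul_t, one_smul, ξ.γ_one₂, inv_one, Units.val_one, one_smul, mul_one]

theorem t_one_mul_t (x y : X) (g : G) :
    t ξ x 1 * t ξ y g = if x = g • y then t ξ y g else 0 := by
  rw [t_mul_t, ξ.γ_one₁, inv_one, Units.val_one, one_smul, one_mul]

variable (ξ) in
theorem completeOrthogonalIdempotents_t_one :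
    CompleteOrthogonalIdempotents fun x => t ξ x (1 : G) where
  idem x := by
    change _ * _ = _
    rw [t_one_mul_t_one, if_pos rfl]
  ortho x y h := by
    change _ * _ = _
    rw [t_one_mul_t_one, if_neg h]
  complete := rfl

variable (ξ) in
/-- The element `∑ t_x g`; on a module it is the operator `g ▷` of the twisted action. -/
noncomputable def shift (g : G) : QHAlg ξ := ∑ x, t ξ x g

variable (ξ) in
/-- The inverse of `shift`. -/
noncomputable def shiftInv (g : G) : QHAlg ξ := ∑ x, tInv ξ x g

theorem shift_mul_t_one (x : X) (g : G) : shift ξ g * t ξ x 1 = t ξ x g := by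
  rw [shift, Finset.sum_mul]
  simp [t_mul_t_one]

theorem t_one_mul_shift (x : X) (g : G) : t ξ (g • x) 1 * shift ξ g = t ξ x g := by
  rw [shift, Finset.mul_sum]
  simp [t_one_mul_t]

theorem shiftInv_mul_shift (g : G) : shiftInv ξ g * shift ξ g = 1 := by
  rw [shiftInv, shift, Finset.sum_mul, one_def]
  refine Finset.sum_congr rfl fun x _ => ?_
  rw [Finset.mul_sum, Finset.sum_eq_single x, tInv_mul_t]
  · intro y _ hy
    rw [tInv, smul_mul_assoc, t_mul_t, if_neg (fun h => hy (smul_left_cancel g h).symm),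
      smul_zero]
  · simp

section Rep

open QuasiHopf Grading CrossedPointed

variable {V W Z : Type*} [AddCommGroup V] [Module K V] [AddCommGroup W] [Module K W]
  [AddCommGroup Z] [Module K Z]
  (ρ : QHAlg ξ →ₐ[K] Module.End K V) (σ : QHAlg ξ →ₐ[K] Module.End K W)
  (τ : QHAlg ξ →ₐ[K] Module.End K Z)

/-- The grading of a representation of `H(ξ)`: the component of degree `x` is `(t_x 1) V`. -/
noncomputable def grading (x : X) : Module.End K V := ρ (t ξ x 1)

theorem isGrading_grading : CompleteOrthogonalIdempotents (grading ρ) :=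
  (completeOrthogonalIdempotents_t_one ξ).map ρ.toRingHom

variable {ρ σ τ} {x y z : X} {v : V} {w : W} {u : Z}

theorem rep_t_apply (hv : grading ρ x v = v) (a : X) (g : G) :
    ρ (t ξ a g) v = if a = x then ρ (t ξ x g) v else 0 := by
  conv_lhs => rw [← hv, grading, ← Module.End.mul_apply, ← map_mul, t_mul_t_one]
  split_ifs
  · rfl
  · rw [map_zero, LinearMap.zero_apply]

theorem rep_shift_apply (hv : grading ρ x v = v) (g : G) :
    ρ (shift ξ g) v = ρ (t ξ x g) v := by
  conv_lhs => rw [← hv, grading, ← Module.End.mul_apply, ← map_mul, shift_mul_t_one]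

variable (ρ) in
theorem rep_shift_graded (g : G) (x : X) (v : V) :
    ρ (shift ξ g) (twist g (grading ρ) x v) = grading ρ x (ρ (shift ξ g) v) := by
  rw [twist, grading, grading, ← Module.End.mul_apply, ← Module.End.mul_apply, ← map_mul,
    ← map_mul, shift_mul_t_one, ← t_one_mul_shift, smul_inv_smul]

variable (ρ) in
theorem isShift_shift : IsShift (grading ρ) fun g => ρ (shift ξ g) := fun g x v hv => by
  rw [← rep_shift_graded, twist_hom g hv]

variable (ρ) in
theorem isTwisted_shift : IsTwisted ξ (grading ρ) fun g => ρ (shift ξ g) :=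
  fun g h x v hv => by
    rw [rep_shift_apply (isShift_shift ρ h x v hv), rep_shift_apply hv, rep_shift_apply hv,
      ← Module.End.mul_apply, ← map_mul, t_mul_t, if_pos rfl, map_smul, LinearMap.smul_apply,
      smul_smul, Units.mul_inv, one_smul]

theorem tens_E₂ (hv : grading ρ x v = v) (hw : grading σ y w = w) (f : X → X → K)
    (g h : X → X → G) : tens ρ σ (E₂ ξ f g h) (v ⊗ₜ w) =
      f x y • (ρ (t ξ x (g x y)) v ⊗ₜ σ (t ξ y (h x y)) w) := by
  rw [E₂, map_sum, LinearMap.sum_apply]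
  simp only [map_sum, map_smul, LinearMap.sum_apply, LinearMap.smul_apply]
  simp only [tens_tmul, TensorProduct.map_tmul]
  rw [Finset.sum_eq_single x, Finset.sum_eq_single y]
  · intro b _ hb
    rw [rep_t_apply hw, if_neg hb, TensorProduct.tmul_zero, smul_zero]
  · simp
  · intro a _ ha
    refine Finset.sum_eq_zero fun b _ => ?_
    rw [rep_t_apply hv, if_neg ha, TensorProduct.zero_tmul, smul_zero]
  · simp

theorem tens_D₃ (hv : grading ρ x v = v) (hw : grading σ y w = w) (hu : grading τ z u = u)
    (f : X → X → X → K) :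
    tens ρ (tens σ τ) (D₃ ξ f) (v ⊗ₜ (w ⊗ₜ u)) = f x y z • (v ⊗ₜ (w ⊗ₜ u)) := by
  rw [D₃_eq, map_sum, LinearMap.sum_apply, Finset.sum_eq_single x]
  · rw [tens_tmul, TensorProduct.map_tmul, tens_E₂ hw hu]
    change grading ρ x v ⊗ₜ (f x y z • (grading σ y w ⊗ₜ grading τ z u)) = _
    rw [hv, hw, hu, TensorProduct.tmul_smul]
  · intro a _ ha
    rw [tens_tmul, TensorProduct.map_tmul, rep_t_apply hv, if_neg ha, TensorProduct.zero_tmul]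
  · simp

theorem tensorRep_t_apply (hv : grading ρ x v = v) (hw : grading σ y w = w) (d : X) (g : G) :
    tensorRep ρ σ (t ξ d g) (v ⊗ₜ w) =
      if x * y = d then (ξ.μ g x y : K) • (ρ (t ξ x g) v ⊗ₜ[K] σ (t ξ y g) w) else 0 := by
  have h : tensorRep ρ σ (t ξ d g) = tens ρ σ (comul (t ξ d g)) := rfl
  rw [h, comul_t, tens_E₂ hv hw, ite_smul, zero_smul]

variable (ρ σ) in
/-- The grading of a tensor product of representations is the tensor product of the gradings. -/
theorem grading_tensorRep : grading (tensorRep ρ σ) = tensor (grading ρ) (grading σ) :=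
  funext fun d => ext₂ (isGrading_grading ρ) (isGrading_grading σ) fun x y v w hv hw => by
    rw [grading, tensorRep_t_apply hv hw,
      tensor_apply (isGrading_grading ρ) (isGrading_grading σ) hv hw, ξ.μ_one₁, Units.val_one,
      one_smul]
    change (if x * y = d then grading ρ x v ⊗ₜ[K] grading σ y w else 0) = _
    rw [hv, hw]

variable (ρ σ) in
theorem isTensor_shift : IsTensor ξ (grading ρ) (grading σ) (fun g => ρ (shift ξ g))
    (fun g => σ (shift ξ g)) fun g => tensorRep ρ σ (shift ξ g) := fun g x y v w hv hw => by
  have h : grading (tensorRep ρ σ) (x * y) (v ⊗ₜ w) = v ⊗ₜ w := by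
    rw [grading_tensorRep, tensor_hom (isGrading_grading ρ) (isGrading_grading σ) hv hw]
  rw [rep_shift_apply h, tensorRep_t_apply hv hw, if_pos rfl, rep_shift_apply hv,
    rep_shift_apply hw]

variable (K) in
theorem grading_unitRep : grading (unitRep K (QHAlg ξ)) = Grading.unit K X :=
  funext fun x => LinearMap.ext_ring (by
    change counit (t ξ x (1 : G)) * (1 : K) = Grading.unit K X x 1
    rw [counit_t, Grading.unit]
    split_ifs <;> simp)

variable (ξ) in
theorem unitRep_shift (g : G) : unitRep K (QHAlg ξ) (shift ξ g) = LinearMap.id :=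
  LinearMap.ext_ring (by
    change counit (shift ξ g) * (1 : K) = 1
    rw [shift, map_sum]
    simp [counit_t])

variable (ρ σ τ) in
theorem assocHom_eq : QuasiHopf.assocHom ρ σ τ =
    Grading.assocHom (grading ρ) (grading σ) (grading τ) ξ.ω :=
  ext₃ (isGrading_grading ρ) (isGrading_grading σ) (isGrading_grading τ)
    fun x y z v w u hv hw hu => by
      rw [Grading.assocHom_apply (isGrading_grading ρ) (isGrading_grading σ)
        (isGrading_grading τ) ξ.ω hv hw hu]
      exact tens_D₃ hv hw hu _

variable (ρ σ) in
theorem isBraid_braid [Finite G] : IsBraid ξ (grading ρ) (grading σ) (fun g => σ (shift ξ g))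
    (braid ρ σ) := fun x y v w hv hw => by
  have h : braid ρ σ (v ⊗ₜ w) = TensorProduct.comm K V W (tens ρ σ (E₂ ξ (fun x y => (ξ.c x y : K))
    (fun _ _ => 1) fun x _ => M.bd x) (v ⊗ₜ w)) := rfl
  rw [h, tens_E₂ hv hw, map_smul, TensorProduct.comm_tmul, rep_shift_apply hw]
  change _ • (_ ⊗ₜ[K] grading ρ x v) = _
  rw [hv]

/-- A linear map is `H(ξ)`-linear if it preserves the grading and commutes with the twisted
actions, as `t_x g` is the product of `shift g` and `t_x 1`. -/
theorem commutes_of_graded {f : V →ₗ[K] W} (h : ∀ x v, f (grading ρ x v) = grading σ x (f v))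
    (h' : ∀ g v, f (ρ (shift ξ g) v) = σ (shift ξ g) (f v)) (a : QHAlg ξ) (v : V) :
    f (ρ a v) = σ a (f v) := by
  induction a using QHAlg.induction with
  | zero => simp only [map_zero, LinearMap.zero_apply]
  | add a b ha hb => simp only [map_add, LinearMap.add_apply, ha, hb]
  | smul k a ha => simp only [map_smul, LinearMap.smul_apply, ha]
  | single x g =>
    rw [← shift_mul_t_one, map_mul, map_mul, Module.End.mul_apply, Module.End.mul_apply, h']
    exact congrArg (σ (shift ξ g)) (h x v)

end Rep

section OfAction

open Grading CrossedPointed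

variable {V : Type*} [AddCommGroup V] [Module K V] {p : X → Module.End K V} {A : G → V →ₗ[K] V}

/-- The representation of `H(ξ)` on a graded space with a twisted action, in which `t_x g` acts as
the projection to the component of degree `x` followed by `g ▷`. -/
noncomputable def repOfAction (hp : CompleteOrthogonalIdempotents p) (hA : IsShift p A)
    (hA' : IsTwisted ξ p A) (hA₁ : A 1 = LinearMap.id) : QHAlg ξ →ₐ[K] Module.End K V :=
  AlgHom.ofLinearMap (lift fun x g => A g ∘ₗ p x)
    (by
      rw [one_def, map_sum]
      simp only [lift_t, hA₁]
      exact hp.complete)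
    (fun a b => by
      induction a using induction with
      | zero => simp only [zero_mul, map_zero]
      | add a a' h h' => simp only [add_mul, map_add, h, h']
      | smul k a h => simp only [smul_mul_assoc, map_smul, h]
      | single x g =>
      induction b using induction with
      | zero => simp only [mul_zero, map_zero]
      | add a a' h h' => simp only [mul_add, map_add, h, h']
      | smul k a h => simp only [mul_smul_comm, map_smul, h]
      | single y h =>
      refine ext₁ hp fun z v hv => ?_
      rw [t_mul_t, Module.End.mul_apply, lift_t, lift_t]
      simp only [LinearMap.comp_apply]
      rw [apply_hom hp hv y]
      by_cases hz : z = y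
      · subst hz
        rw [if_pos rfl, apply_hom hp (hA h z v hv)]
        by_cases hx : x = h • z
        · rw [if_pos hx, if_pos hx.symm, map_smul, lift_t, LinearMap.smul_apply,
            LinearMap.comp_apply, hv, hA' g h z v hv, smul_smul, Units.inv_mul, one_smul]
        · rw [if_neg hx, if_neg (Ne.symm hx), map_zero, map_zero, LinearMap.zero_apply]
      · rw [if_neg hz, map_zero, map_zero, map_zero]
        split_ifs
        · rw [map_smul, lift_t, LinearMap.smul_apply, LinearMap.comp_apply, apply_hom hp hv,
            if_neg hz, map_zero, smul_zero]
        · rw [map_zero, LinearMap.zero_apply])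

theorem repOfAction_t (hp : CompleteOrthogonalIdempotents p) (hA : IsShift p A)
    (hA' : IsTwisted ξ p A) (hA₁ : A 1 = LinearMap.id) (x : X) (g : G) :
    repOfAction hp hA hA' hA₁ (t ξ x g) = A g ∘ₗ p x :=
  lift_t (fun x g => A g ∘ₗ p x) x g

theorem grading_repOfAction (hp : CompleteOrthogonalIdempotents p) (hA : IsShift p A)
    (hA' : IsTwisted ξ p A) (hA₁ : A 1 = LinearMap.id) (x : X) :
    grading (repOfAction hp hA hA' hA₁) x = p x := by
  rw [grading, repOfAction_t, hA₁, LinearMap.id_comp]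

theorem repOfAction_shift (hp : CompleteOrthogonalIdempotents p) (hA : IsShift p A)
    (hA' : IsTwisted ξ p A) (hA₁ : A 1 = LinearMap.id) (g : G) :
    repOfAction hp hA hA' hA₁ (shift ξ g) = A g := by
  rw [shift, map_sum]
  simp only [repOfAction_t]
  have := hp.complete
  refine LinearMap.ext fun v => ?_
  rw [LinearMap.sum_apply]
  simp only [LinearMap.comp_apply]
  rw [← map_sum, ← LinearMap.sum_apply, this, Module.End.one_apply]

end OfAction

end QHAlg

/-! ### The equivalence of braided tensor categories -/

namespace QHMod

variable {K : Type u} [Field K] {X : Type v} {G : Type w} [Group X] [Group G]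
  [MulDistribMulAction G X] {M : CrossedModule X G} {ξ : NormalizedCocycle K M}
  [Fintype X] [DecidableEq X]

open QHAlg Equivariantization

/-- The graded vector space underlying an `H(ξ)`-module. -/
noncomputable def toCrossedPointed (V : QHMod K (QHAlg ξ)) : CrossedPointed ξ where
  carrier := V.carrier
  proj := grading V.ρ
  isGrading := isGrading_grading V.ρ

/-- The equivariant structure on the graded vector space underlying an `H(ξ)`-module. -/
noncomputable def shiftIso (V : QHMod K (QHAlg ξ)) (g : G) :
    CrossedPointed.twistObj g V.toCrossedPointed ≅ V.toCrossedPointed :=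
  have h : V.ρ (shiftInv ξ g) ∘ₗ V.ρ (shift ξ g) = LinearMap.id := by
    rw [← Module.End.mul_eq_comp, ← map_mul, shiftInv_mul_shift, map_one]; rfl
  CrossedPointed.mkIso (V := CrossedPointed.twistObj g V.toCrossedPointed)
    (W := V.toCrossedPointed) ⟨V.ρ (shift ξ g), rep_shift_graded V.ρ g⟩ (V.ρ (shiftInv ξ g)) h
    (mul_eq_one_comm.1 h)

/-- The equivariant object underlying an `H(ξ)`-module. -/
noncomputable def toEquivariant (V : QHMod K (QHAlg ξ)) : EquivariantCategory ξ where
  obj := V.toCrossedPointed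
  u g := shiftIso V g
  u_mul g h := CrossedPointed.hom_ext <| Grading.ext₁ (isGrading_grading V.ρ) fun x v hv => by
    refine (isTwisted_shift V.ρ g h x v hv).trans ?_
    change _ = V.ρ (shift ξ g) (V.ρ (shift ξ h)
      (Grading.diag₁ (grading V.ρ) (fun x => (ξ.γ g h x : K)) v))
    rw [Grading.diag₁_apply (isGrading_grading V.ρ) _ hv, map_smul, map_smul]

variable (ξ) in
/-- The functor from `H(ξ)`-modules to equivariant objects that is the identity on underlying
vector spaces and on morphisms. -/
noncomputable def equivariantFunctor : QHMod K (QHAlg ξ) ⥤ EquivariantCategory ξ where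
  obj := toEquivariant
  map {V W} f := (⟨(⟨lin f, fun x v => lin_ρ f (t ξ x 1) v⟩ :
      CrossedPointed.homs V.toCrossedPointed W.toCrossedPointed),
    fun g => CrossedPointed.hom_ext <| LinearMap.ext fun v => (lin_ρ f (shift ξ g) v).symm⟩ :
      Equivariantization.homs V.toEquivariant W.toEquivariant)

/-- A degree-preserving linear equivalence commuting with the twisted actions, as an isomorphism
of equivariant objects. -/
noncomputable def equivariantIso {V W : EquivariantCategory ξ} (e : V.carrier ≃ₗ[K] W.carrier)
    (h : ∀ x v, e (V.proj x v) = W.proj x (e v)) (h' : ∀ g v, e (V.act g v) = W.act g (e v)) :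
    V ≅ W :=
  Equivariantization.mkIso (CrossedPointed.mkIso (V := V.obj) (W := W.obj) ⟨e.toLinearMap, h⟩
    e.symm.toLinearMap e.symm_comp e.comp_symm) fun g =>
      CrossedPointed.hom_ext <| LinearMap.ext fun v => (h' g v).symm

/-- The identity map of `V ⊗ W` as an isomorphism of equivariant objects. -/
noncomputable def μIso (V W : QHMod K (QHAlg ξ)) :
    V.toEquivariant ⊗ W.toEquivariant ≅ (V ⊗ W).toEquivariant :=
  equivariantIso (V := V.toEquivariant ⊗ W.toEquivariant) (W := (V ⊗ W).toEquivariant)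
    (LinearEquiv.refl K (V.carrier ⊗[K] W.carrier))
    (fun x v => LinearMap.congr_fun (congrFun (grading_tensorRep V.ρ W.ρ) x).symm v)
    fun g => LinearMap.congr_fun <|
      Grading.ext₂ (isGrading_grading V.ρ) (isGrading_grading W.ρ) fun x y v w hv hw =>
        (EquivariantCategory.act_tensor V.toEquivariant W.toEquivariant g x y v w hv hw).trans
          (isTensor_shift V.ρ W.ρ g x y v w hv hw).symm

variable (ξ) in
/-- The identity map of the ground field as an isomorphism of equivariant objects. -/
noncomputable def εIso : 𝟙_ (EquivariantCategory ξ) ≅ (𝟙_ (QHMod K (QHAlg ξ))).toEquivariant :=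
  equivariantIso (V := 𝟙_ (EquivariantCategory ξ)) (W := (𝟙_ (QHMod K (QHAlg ξ))).toEquivariant)
    (LinearEquiv.refl K K)
    (fun x v => LinearMap.congr_fun (congrFun (grading_unitRep (ξ := ξ) K) x).symm v)
    fun g v => (LinearMap.congr_fun (unitRep_shift ξ g) v).symm

theorem equivariant_hom_ext {V W : EquivariantCategory ξ} {f f' : V ⟶ W}
    (h : ∀ v, CrossedPointed.lin (und f) v = CrossedPointed.lin (und f') v) : f = f' :=
  Equivariantization.hom_ext <| CrossedPointed.hom_ext <| LinearMap.ext h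

/-- The identity maps of tensor products are a monoidal structure on `equivariantFunctor`: the
associators agree because `Φ` acts on vectors of degrees `x`, `y`, `z` as `ω(x,y,z)`. -/
noncomputable def coreMonoidal : (equivariantFunctor ξ).CoreMonoidal where
  εIso := εIso ξ
  μIso := μIso
  μIso_hom_natural_left f W := rfl
  μIso_hom_natural_right V f := rfl
  associativity U V W := equivariant_hom_ext fun t => by
    change QuasiHopf.assocHom U.ρ V.ρ W.ρ (TensorProduct.map LinearMap.id LinearMap.id t) =
      TensorProduct.map LinearMap.id LinearMap.id
        (Grading.assocHom (grading U.ρ) (grading V.ρ) (grading W.ρ) ξ.ω t)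
    rw [assocHom_eq, TensorProduct.map_id, TensorProduct.map_id]
    rfl
  left_unitality V := equivariant_hom_ext fun t =>
    congrArg (TensorProduct.lid K V.carrier) (LinearMap.congr_fun TensorProduct.map_id t).symm
  right_unitality V := equivariant_hom_ext fun t =>
    congrArg (TensorProduct.rid K V.carrier) (LinearMap.congr_fun TensorProduct.map_id t).symm

noncomputable instance : (equivariantFunctor ξ).Monoidal := coreMonoidal.toMonoidal

noncomputable instance [Fintype G] [DecidableEq G] : (equivariantFunctor ξ).Braided where
  braided V W := equivariant_hom_ext <| LinearMap.congr_fun <|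
    Grading.ext₂ (isGrading_grading V.ρ) (isGrading_grading W.ρ) fun x y v w hv hw =>
      (isBraid_braid V.ρ W.ρ x y v w hv hw).trans
        (EquivariantCategory.isBraid_braidingHom V.toEquivariant W.toEquivariant
          x y v w hv hw).symm

instance : (equivariantFunctor ξ).Additive where
  map_add := rfl

instance : (equivariantFunctor ξ).Linear K where
  map_smul _ _ := rfl

instance : (equivariantFunctor ξ).Faithful where
  map_injective h := hom_ext (congrArg (fun f => CrossedPointed.lin (und f)) h)

instance : (equivariantFunctor ξ).Full where
  map_surjective {V W} f := ⟨(⟨CrossedPointed.lin (und f),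
    commutes_of_graded (CrossedPointed.lin_proj (und f)) fun g v =>
      (LinearMap.congr_fun (EquivariantCategory.act_comm f g) v).symm⟩ : homs V W), rfl⟩

theorem act_one (V : EquivariantCategory ξ) : V.act 1 = LinearMap.id := by
  refine Grading.ext₁ V.isGrading fun x v hv => ?_
  have h := V.act_twisted 1 1 x v hv
  rw [mul_one, ξ.γ_one₁, Units.val_one, one_smul] at h
  have h' := congrArg (V.actInv 1) h
  rw [V.actInv_act, V.actInv_act] at h'
  exact h'.symm

/-- The `H(ξ)`-module on the vector space underlying an equivariant object. -/
noncomputable def ofEquivariant (V : EquivariantCategory ξ) : QHMod K (QHAlg ξ) where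
  carrier := V.carrier
  ρ := repOfAction V.isGrading V.act_shift V.act_twisted (act_one V)

instance : (equivariantFunctor ξ).EssSurj where
  mem_essImage V := ⟨ofEquivariant V,
    ⟨equivariantIso (V := (ofEquivariant V).toEquivariant) (W := V)
      (LinearEquiv.refl K V.carrier)
      (fun x v => LinearMap.congr_fun
        (grading_repOfAction V.isGrading V.act_shift V.act_twisted (act_one V) x) v)
      fun g v => LinearMap.congr_fun
        (repOfAction_shift V.isGrading V.act_shift V.act_twisted (act_one V) g) v⟩⟩

instance : (equivariantFunctor ξ).IsEquivalence where

end QHMod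

/-! ### Fusion categories -/

section Transfer

open Limits

variable {K : Type*} [Field K] {C : Type*} [Category C] [Preadditive C] [Linear K C]
  [MonoidalCategory C] [MonoidalPreadditive C] [MonoidalLinear K C]
  {D : Type*} [Category D] [Preadditive D] [Linear K D]
  [MonoidalCategory D] [MonoidalPreadditive D] [MonoidalLinear K D]

theorem IsFusionCategory.of_equivalence (F : C ⥤ D) [F.Monoidal] [F.Additive] [F.Linear K]
    [F.IsEquivalence] (h : IsFusionCategory K C) : IsFusionCategory K D := by
  have := h.hasFiniteBiproducts
  let _ : Abelian C :=
    { has_finite_products := inferInstance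
      has_kernels := h.hasKernels
      has_cokernels := h.hasCokernels
      toIsNormalMonoCategory := h.normalMono
      toIsNormalEpiCategory := h.normalEpi }
  have : HasFiniteProducts D :=
    ⟨fun _ => Adjunction.hasLimitsOfShape_of_equivalence F.inv⟩
  have : F.asEquivalence.functor.Additive := inferInstanceAs F.Additive
  have : F.inv.Additive := inferInstanceAs F.asEquivalence.inverse.Additive
  let _ : Abelian D := abelianOfEquivalence F.inv
  have : HasFiniteBiproducts D := .of_hasFiniteProducts
  let e (V : D) : F.obj (F.inv.obj V) ≅ V := F.asEquivalence.counitIso.app V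
  exact
    { hasFiniteBiproducts := inferInstance
      hasKernels := inferInstance
      hasCokernels := inferInstance
      normalMono := inferInstance
      normalEpi := inferInstance
      finite_hom := fun V W => by
        -- `F` maps the Hom space between the preimages of `V` and `W` onto the one from `V` to `W`.
        have := h.finite_hom (F.inv.obj V) (F.inv.obj W)
        let φ : (F.inv.obj V ⟶ F.inv.obj W) →ₗ[K] (V ⟶ W) :=
          { toFun := fun f => (e V).inv ≫ F.map f ≫ (e W).hom
            map_add' := fun f g => by simp [F.map_add]
            map_smul' := fun k f => by simp [F.map_smul] }
        refine Module.Finite.of_surjective φ fun f => ?_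
        refine ⟨F.preimage ((e V).hom ≫ f ≫ (e W).inv), ?_⟩
        change (e V).inv ≫ F.map (F.preimage _) ≫ (e W).hom = f
        simp
      semisimple := fun V => by
        obtain ⟨n, S, hS, ⟨i⟩⟩ := h.semisimple (F.inv.obj V)
        exact ⟨n, fun i => F.obj (S i), fun i => have := hS i; simple_obj F (S i),
          ⟨(e V).symm ≪≫ F.mapIso i ≪≫ F.mapBiproduct S⟩⟩
      finite_simple := by
        obtain ⟨n, S, hS⟩ := h.finite_simple
        refine ⟨n, fun i => F.obj (S i), fun V _ => ?_⟩
        obtain ⟨i, ⟨j⟩⟩ := hS (F.inv.obj V) (simple_obj F.inv V)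
        exact ⟨i, ⟨(e V).symm ≪≫ F.mapIso j⟩⟩
      simple_unit := by
        have := h.simple_unit
        have := simple_obj F (𝟙_ C)
        exact Simple.of_iso (Functor.Monoidal.εIso F)
      rigid := by
        obtain ⟨_⟩ := h.rigid
        let _ : F.asEquivalence.functor.Monoidal := inferInstanceAs F.Monoidal
        let _ := F.asEquivalence.inverseMonoidal
        exact ⟨rigidCategoryOfEquivalence F.asEquivalence.symm.toAdjunction⟩ }

end Transfer

section Cocycle

variable {K : Type u} [Field K] [CharZero K] {X : Type v} {G : Type w}
  [Group X] [Group G] [MulDistribMulAction G X] [Fintype X] [DecidableEq X] [Fintype G]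
  [DecidableEq G] {M : CrossedModule X G} (ξ : NormalizedCocycle K M)

theorem QHMod.isFusionCategory : IsFusionCategory K (QHMod K (QHAlg ξ)) where
  hasKernels := inferInstance
  hasCokernels := inferInstance
  normalMono := inferInstance
  normalEpi := inferInstance
  finite_hom := inferInstance
  semisimple V := exists_iso_biproduct_simple V
  finite_simple := exists_fin_simple
  simple_unit := simple_of_finrank_eq_one (Module.finrank_self K)
  -- Right duals are also left duals in a braided category.
  rigid := ⟨BraidedCategory.rigidCategoryOfRightRigidCategory⟩

end Cocycle

theorem mainTheorem5 {K : Type u} [Field K] [IsAlgClosed K] [CharZero K] {X : Type v} {G : Type w}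
    [Group X] [Group G] [MulDistribMulAction G X] [Fintype X] [DecidableEq X] [Fintype G]
    [DecidableEq G] (M : CrossedModule X G) (ξ : NormalizedCocycle K M) :
    IsFusionCategory K (EquivariantCategory ξ) ∧ IsFusionCategory K (QHMod K (QHAlg ξ)) ∧
    ∃ (F : QHMod K (QHAlg ξ) ⥤ EquivariantCategory ξ) (_ : F.Braided)
      (φ : ∀ V : QHMod K (QHAlg ξ), V.carrier ≃ₗ[K] EquivariantCategory.carrier (F.obj V)),
      -- `F` is a `K`-linear braided tensor equivalence
      F.IsEquivalence ∧ F.Additive ∧ F.Linear K ∧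
      -- which is the identity on underlying spaces of objects, on morphisms and on tensor products
      (∀ (V W : QHMod K (QHAlg ξ)) (f : V ⟶ W) (v : V.carrier),
        CrossedPointed.lin (Equivariantization.und (F.map f)) (φ V v) = φ W (QHMod.lin f v)) ∧
      (∀ (V W : QHMod K (QHAlg ξ)) (v : V.carrier) (w : W.carrier),
        CrossedPointed.lin (Equivariantization.und (Functor.LaxMonoidal.μ F V W))
          (φ V v ⊗ₜ[K] φ W w) = φ (V ⊗ W) (v ⊗ₜ[K] w)) ∧
      -- the component of degree `x` is `V_x = t_x V`, and `g ▷ v = (t_x g) v` for `v ∈ V_x`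
      (∀ (V : QHMod K (QHAlg ξ)) (x : X) (v : V.carrier),
        EquivariantCategory.proj (F.obj V) x (φ V v) = φ V (V.ρ (QHAlg.t ξ x 1) v)) ∧
      (∀ (V : QHMod K (QHAlg ξ)) (x : X) (g : G) (v : V.carrier), V.ρ (QHAlg.t ξ x 1) v = v →
        EquivariantCategory.act (F.obj V) g (φ V v) = φ V (V.ρ (QHAlg.t ξ x g) v)) ∧
      -- the associativity constraint and the braiding on both sides, on homogeneous vectors
      (∀ (U V W : QHMod K (QHAlg ξ)) (x y z : X) (u : U.carrier) (v : V.carrier) (w : W.carrier),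
        U.ρ (QHAlg.t ξ x 1) u = u → V.ρ (QHAlg.t ξ y 1) v = v → W.ρ (QHAlg.t ξ z 1) w = w →
        QHMod.lin (α_ U V W).hom ((u ⊗ₜ[K] v) ⊗ₜ[K] w) =
            (ξ.ω x y z : K) • (u ⊗ₜ[K] (v ⊗ₜ[K] w)) ∧
          CrossedPointed.lin (Equivariantization.und (α_ (F.obj U) (F.obj V) (F.obj W)).hom)
              ((φ U u ⊗ₜ[K] φ V v) ⊗ₜ[K] φ W w) =
            (ξ.ω x y z : K) • (φ U u ⊗ₜ[K] (φ V v ⊗ₜ[K] φ W w))) ∧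
      (∀ (V W : QHMod K (QHAlg ξ)) (x y : X) (v : V.carrier) (w : W.carrier),
        V.ρ (QHAlg.t ξ x 1) v = v → W.ρ (QHAlg.t ξ y 1) w = w →
        QHMod.lin (β_ V W).hom (v ⊗ₜ[K] w) =
            (ξ.c x y : K) • (W.ρ (QHAlg.t ξ y (M.bd x)) w ⊗ₜ[K] v) ∧
          CrossedPointed.lin (Equivariantization.und (β_ (F.obj V) (F.obj W)).hom)
              (φ V v ⊗ₜ[K] φ W w) =
            (ξ.c x y : K) •
              (EquivariantCategory.act (F.obj W) (M.bd x) (φ W w) ⊗ₜ[K] φ V v)) := by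

  refine ⟨(QHMod.isFusionCategory ξ).of_equivalence (QHMod.equivariantFunctor ξ),
    QHMod.isFusionCategory ξ, QHMod.equivariantFunctor ξ, inferInstance,
    fun V => LinearEquiv.refl K V.carrier, inferInstance, inferInstance, inferInstance,
    fun V W f v => rfl, fun V W v w => rfl, fun V x v => rfl,
    fun V x g v hv => QHAlg.rep_shift_apply hv g, fun U V W x y z u v w hu hv hw => ⟨?_, ?_⟩,
    fun V W x y v w hv hw => ⟨?_, ?_⟩⟩
  · exact QHAlg.tens_D₃ hu hv hw _
  · exact Grading.assocHom_apply (QHAlg.isGrading_grading U.ρ) (QHAlg.isGrading_grading V.ρ)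
      (QHAlg.isGrading_grading W.ρ) ξ.ω hu hv hw
  · rw [← QHAlg.rep_shift_apply hw]
    exact QHAlg.isBraid_braid V.ρ W.ρ x y v w hv hw
  · exact EquivariantCategory.isBraid_braidingHom V.toEquivariant W.toEquivariant x y v w hv hw
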